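/- **Syntax.** Formulae of modal dependence logic (MDL) over a set $AP$ of atomic propositions are generated by $$\varphi ::= \top \mid \bot \mid q \mid \neg q \mid \varphi\vee\varphi \mid \varphi\mathbin{\dot\vee}\varphi \mid \varphi\wedge\varphi \mid \mathsf{AX}\,\varphi \mid \mathsf{EX}\,\varphi \mid {=}(p_1,\dots,p_n;q) \mid \neg{=}(p_1,\dots,p_n;q),$$ where $n\ge 0$, $p_1,\dots,p_n,q\in AP$; here $\mathbin{\dot\vee}$ denotes classical disjunction. The dependence atom ${=}(p_1,\dots,p_n;q)$ has arity $n$. For $k\ge 0$ and a set $M\subseteq\{\mathsf{AX},\mathsf{EX},\wedge,\vee,\mathbin{\dot\vee},\neg,\top,\bot,\mathrm{dep}\}$, $\mathrm{MDL}_k[M]$ is the set of formulae that are built from atomic propositions using only operators from $M$ (where $\mathrm{dep}$ stands for dependence atoms, and negated dependence atoms need both $\neg$ and $\mathrm{dep}$) and in which every dependence atom has arity at most $k$. **Semantics.** Let $W=(S,R,\pi)$ be a Kripke structure: $S\neq\emptyset$, $R\subseteq S\times S$, $\pi:S\to\mathcal P(AP)$. Truth in a team $T\subseteq S$ is defined by: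 - $W,T\models\top$ always; $W,T\models\bot$ iff $T=\emptyset$; - $W,T\models q$ iff $q\in\pi(s)$ for all $s\in T$; $W,T\models\neg q$ iff $q\notin\pi(s)$ for all $s\in T$; - $W,T\models{=}(p_1,\dots,p_n;q)$ iff for all $s_1,s_2\in T$: $\pi(s_1)\cap\{p_1,\dots,p_n\}\ne\pi(s_2)\cap\{p_1,\dots,p_n\}$ or $\pi(s_1)\cap\{q\}=\pi(s_2)\cap\{q\}$; $W,T\models\neg{=}(p_1,\dots,p_n;q)$ iff $T=\emptyset$; - $W,T\models\varphi\wedge\psi$ iff $W,T\models\varphi$ and $W,T\models\psi$; $W,T\models\varphi\mathbin{\dot\vee}\psi$ iff $W,T\models\varphi$ or $W,T\models\psi$; - $W,T\models\varphi\vee\psi$ iff there are $T_1,T_2$ with $T=T_1\cup T_2$, $W,T_1\models\varphi$ and $W,T_2\models\psi$; - $W,T\models\mathsf{AX}\,\varphi$ iff $W,\{s'\mid \exists s\in T:\ (s,s')\in R\}\models\varphi$; - $W,T\models\mathsf{EX}\,\varphi$ iff there is $T'\subseteq S$ with $W,T'\models\varphi$ such that every $s\in T$ has some $s'\in T'$ with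 $(s,s')\in R$. **Model checking problem.** $\mathrm{MDL\text{-}MC}_k[M]$ is the set of strings $\langle W,T,\varphi\rangle$ such that $W$ is a finite Kripke structure, $T\subseteq S$, $\varphi\in\mathrm{MDL}_k[M]$ and $W,T\models\varphi$. Here atomic propositions are named by bit strings, and $\langle W,T,\varphi\rangle$ is a string over a fixed finite alphabet that lists, for each world, whether it belongs to $T$, its row of the adjacency matrix of $R$, and the names of the finitely many atomic propositions that label it, and then $\varphi$ in prefix notation. **Theorem 4.6.** Let $M\subseteq\{\mathsf{AX},\mathsf{EX},\neg,\mathrm{dep}\}$. Then for every $k\ge 0$ the problem $\mathrm{MDL\text{-}MC}_k[M]$ is in $\mathsf P$: there is a deterministic Turing machine which, on every input string $w$, decides within a number of steps polynomial in $|w|$ whether $w\in\mathrm{MDL\text{-}MC}_k[M]$. -/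

import Mathlib

namespace MDL

/-! ### Syntax -/

/-- Formulae of modal dependence logic over a set `AP` of atomic propositions, in negation normal
form. `dep ps q` is the dependence atom stating that `q` is determined by the propositions in the
list `ps`; its arity is `ps.length`. `or` is the splitting (dependence) disjunction, `cor` the
classical disjunction. -/
inductive Formula (AP : Type*) where
  | top
  | bot
  | prop (q : AP)
  | negProp (q : AP)
  | or (φ ψ : Formula AP)
  | cor (φ ψ : Formula AP)
  | and (φ ψ : Formula AP)
  | ax (φ : Formula AP)
  | ex (φ : Formula AP)
  | dep (ps : List AP) (q : AP)
  | negDep (ps : List AP) (q : AP)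

/-- The operators by which fragments of the logic are classified. -/
inductive Op where
  | ax | ex | and | or | cor | neg | top | bot | dep

/-- `φ.UsesOnly M`: the formula `φ` is built from atomic propositions using only operators from
`M`. -/
def Formula.UsesOnly {AP : Type*} (M : Set Op) : Formula AP → Prop
  | .top => Op.top ∈ M
  | .bot => Op.bot ∈ M
  | .prop _ => True
  | .negProp _ => Op.neg ∈ M
  | .or φ ψ => Op.or ∈ M ∧ φ.UsesOnly M ∧ ψ.UsesOnly M
  | .cor φ ψ => Op.cor ∈ M ∧ φ.UsesOnly M ∧ ψ.UsesOnly M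
  | .and φ ψ => Op.and ∈ M ∧ φ.UsesOnly M ∧ ψ.UsesOnly M
  | .ax φ => Op.ax ∈ M ∧ φ.UsesOnly M
  | .ex φ => Op.ex ∈ M ∧ φ.UsesOnly M
  | .dep _ _ => Op.dep ∈ M
  | .negDep _ _ => Op.neg ∈ M ∧ Op.dep ∈ M

/-- `φ.ArityLE k`: every dependence atom occurring in `φ` has arity at most `k`. -/
def Formula.ArityLE {AP : Type*} (k : ℕ) : Formula AP → Prop
  | .top => True
  | .bot => True
  | .prop _ => True
  | .negProp _ => True
  | .or φ ψ => φ.ArityLE k ∧ ψ.ArityLE k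
  | .cor φ ψ => φ.ArityLE k ∧ ψ.ArityLE k
  | .and φ ψ => φ.ArityLE k ∧ ψ.ArityLE k
  | .ax φ => φ.ArityLE k
  | .ex φ => φ.ArityLE k
  | .dep ps _ => ps.length ≤ k
  | .negDep ps _ => ps.length ≤ k

/-- The fragment `MDL_k[M]`: dependence atoms of arity at most `k`, operators from `M`. -/
def boundedFragment (AP : Type*) (k : ℕ) (M : Set Op) : Set (Formula AP) :=
  {φ | φ.ArityLE k ∧ φ.UsesOnly M}

/-! ### Semantics -/

/-- An `AP`-Kripke structure with (non-empty) set of worlds `S`. -/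
structure Kripke (AP S : Type*) where
  nonempty : Nonempty S
  /-- the accessibility relation -/
  R : S → S → Prop
  /-- the labeling function -/
  π : S → Set AP

/-- Team semantics: truth of a formula in a team `T` of a Kripke structure `W`. -/
def Sat {AP S : Type*} (W : Kripke AP S) : Set S → Formula AP → Prop
  | _, .top => True
  | T, .bot => T = ∅
  | T, .prop p => ∀ s ∈ T, p ∈ W.π s
  | T, .negProp p => ∀ s ∈ T, p ∉ W.π s
  | T, .or φ ψ => ∃ T₁ T₂ : Set S, T = T₁ ∪ T₂ ∧ Sat W T₁ φ ∧ Sat W T₂ ψ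
  | T, .cor φ ψ => Sat W T φ ∨ Sat W T ψ
  | T, .and φ ψ => Sat W T φ ∧ Sat W T ψ
  | T, .ax φ => Sat W {s' | ∃ s ∈ T, W.R s s'} φ
  | T, .ex φ => ∃ T' : Set S, Sat W T' φ ∧ ∀ s ∈ T, ∃ s' ∈ T', W.R s s'
  | T, .dep ps q => ∀ s₁ ∈ T, ∀ s₂ ∈ T,
      W.π s₁ ∩ {p | p ∈ ps} ≠ W.π s₂ ∩ {p | p ∈ ps} ∨ W.π s₁ ∩ {q} = W.π s₂ ∩ {q}
  | T, .negDep _ _ => T = ∅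

/-! ### Instances of the model checking problem and their encoding as strings -/

/-- Names of atomic propositions, a countably infinite supply: all bit strings. -/
abbrev Name := List Bool

/-- An explicitly presented model checking instance `(W, T, φ)`, where `W` is a finite Kripke
structure, whose worlds are numbered `0, …, n`: the accessibility relation is given by its
adjacency matrix, the labels of a world are given by a list of names, the team is given by its
characteristic vector. -/
structure Instance where
  n : ℕ
  adj : Fin (n + 1) → Fin (n + 1) → Bool
  labels : Fin (n + 1) → List Name
  inTeam : Fin (n + 1) → Bool
  formula : Formula Name

/-- The Kripke structure of an instance. -/
def Instance.kripke (I : Instance) : Kripke Name (Fin (I.n + 1)) where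
  nonempty := ⟨0⟩
  R s s' := I.adj s s' = true
  π s := {p | p ∈ I.labels s}

/-- The team of an instance. -/
def Instance.team (I : Instance) : Set (Fin (I.n + 1)) := {s | I.inTeam s = true}

/-- The finite input alphabet. -/
inductive Sym where
  | bit (b : Bool)
  | name | world | sep
  | top | bot | neg | or | cor | and | ax | ex | dep
  deriving DecidableEq, Fintype

/-- A name is written in binary, preceded by the marker `name`. -/
def encName (p : Name) : List Sym := Sym.name :: p.map Sym.bit

/-- Formulae are written in prefix notation. -/
def encFormula : Formula Name → List Sym
  | .top => [Sym.top]
  | .bot => [Sym.bot]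
  | .prop q => encName q
  | .negProp q => Sym.neg :: encName q
  | .or φ ψ => Sym.or :: (encFormula φ ++ encFormula ψ)
  | .cor φ ψ => Sym.cor :: (encFormula φ ++ encFormula ψ)
  | .and φ ψ => Sym.and :: (encFormula φ ++ encFormula ψ)
  | .ax φ => Sym.ax :: encFormula φ
  | .ex φ => Sym.ex :: encFormula φ
  | .dep ps q => Sym.dep :: (ps.flatMap encName ++ Sym.sep :: encName q)
  | .negDep ps q => Sym.neg :: Sym.dep :: (ps.flatMap encName ++ Sym.sep :: encName q)

/-- The record of a world: the marker `world`, its bit in the characteristic vector of the team,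
its row of the adjacency matrix, and the names of its labels. -/
def Instance.encWorld (I : Instance) (s : Fin (I.n + 1)) : List Sym :=
  Sym.world :: Sym.bit (I.inTeam s) ::
    ((List.ofFn (I.adj s)).map Sym.bit ++ (I.labels s).flatMap encName)

/-- The string `⟨W, T, φ⟩`: the records of all worlds in order, a separator, the formula. -/
def Instance.encode (I : Instance) : List Sym :=
  (List.finRange (I.n + 1)).flatMap I.encWorld ++ Sym.sep :: encFormula I.formula

/-- The model checking problem `MDL-MC_k[M]`, as a set of strings. -/
def modelChecking (k : ℕ) (M : Set Op) : Language Sym :=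
  {w | ∃ I : Instance, w = I.encode ∧
    I.formula ∈ boundedFragment Name k M ∧ Sat I.kripke I.team I.formula}

/-! ### The class P -/

open Classical in
/-- A language is in `P` if some deterministic (multi-stack) Turing machine, started on any string
`w` over the alphabet, halts after a number of steps that is bounded by a polynomial in the length
of `w`, with output the bit saying whether `w` belongs to the language. -/
def InP {Γ : Type} (L : Language Γ) : Prop :=
  Nonempty (Turing.TM2ComputableInPolyTime (id : List Γ → List Γ) Computability.encodeBool
    (fun w => decide (w ∈ L)))

end MDL

namespace MDL

open Turing

/-! ### Structured programs for stack machines -/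

/-! Without binary connectives a formula is a string of modalities ending in a single atom. The only
source of non-locality is that atom when it is a positive dependence atom: a team satisfies it iff
there is a Boolean function `f` of at most `k` arguments such that every world of the team satisfies
"the last proposition has the value `f` of the others". For fixed `f` this condition concerns single
worlds, so the atom has a denotation, a set of worlds, and a team satisfies the atom read in this
way iff it is contained in that set.

The modalities respect this. The successors of `T` lie in a set `D` iff `T` lies in the set of
worlds all of whose successors are in `D`; and for `EX` the best choice of successor team is `D`
itself. Hence the choice of `f` can be pulled out in front of the whole formula: `T` satisfies `φ`
iff `T ⊆ den k f W φ` for some `f`. This is `sat_iff_den`. As `k` is fixed there are only the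
constantly many functions `(Fin k → Bool) → Bool` to try, and for each of them the denotation is
computed from the atom outwards, one sweep over the adjacency matrix per modality.

The rest turns this into a machine with a time bound. `Runs.simulate` places structured programs
into a stack machine. `runsIn_cmd` compiles programs whose only loops run once over the positions of
the input; such programs are polynomial by their shape, so afterwards only their denotation
`Prog.eval` matters, and `inP_of_prog` states the resulting criterion.

The format of the input is mostly a regular language: in this fragment prefix notation needs no
stack and arities are bounded, so a finite automaton handles everything except that each row has as
many entries as there are worlds. The automaton also tags every letter with its role, which lets
later passes recognise letters without parsing (`acc_of_accept`, `tag_encRaw`, `tag_encFormula`).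
Each pass of the program is identified with a fold `scan` over the tagged word, and these folds are
evaluated on tagged instances; `foldr_encFormula` and `tryAll_tagged` connect them with `den`. -/

/-- An elementary operation on the register and the stacks. -/
inductive Act (K : Type) (Γ : K → Type) (σ : Type)
  | push (k : K) (f : σ → Γ k)
  | pop (k : K) (f : σ → Option (Γ k) → σ)
  | peek (k : K) (f : σ → Option (Γ k) → σ)
  | load (f : σ → σ)

/-- Structured programs over the elementary operations. -/
inductive Cmd (K : Type) (Γ : K → Type) (σ : Type)
  | act (l : List (Act K Γ σ))
  | seq (a b : Cmd K Γ σ)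
  | ite (b : σ → Bool) (c d : Cmd K Γ σ)
  | loop (b : σ → Bool) (c : Cmd K Γ σ)

section Cmd

variable {K : Type} [DecidableEq K] {Γ : K → Type} {σ : Type}

/-- The effect of an elementary operation. -/
def Act.run : Act K Γ σ → σ × (∀ k, List (Γ k)) → σ × (∀ k, List (Γ k))
  | .push k f, s => (s.1, Function.update s.2 k (f s.1 :: s.2 k))
  | .pop k f, s => (f s.1 (s.2 k).head?, Function.update s.2 k (s.2 k).tail)
  | .peek k f, s => (f s.1 (s.2 k).head?, s.2)
  | .load f, s => (f s.1, s.2)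

/-- The effect of a list of elementary operations. -/
def runActs (l : List (Act K Γ σ)) (s : σ × (∀ k, List (Γ k))) : σ × (∀ k, List (Γ k)) :=
  l.foldl (fun s a => a.run s) s

/-- An elementary operation as the beginning of a statement of a stack machine. -/
def Act.stmt {Λ : Type} : Act K Γ σ → TM2.Stmt Γ Λ σ → TM2.Stmt Γ Λ σ
  | .push k f, q => .push k f q
  | .pop k f, q => .pop k f q
  | .peek k f, q => .peek k f q
  | .load f, q => .load f q

/-- A statement of a stack machine may contain any number of stack operations before its jump, so a
whole list of them costs one step. This justifies the cost 1 of `act` in `Runs`. -/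
theorem stepAux_actStmts {Λ : Type} (l : List (Act K Γ σ)) (q : TM2.Stmt Γ Λ σ)
    (s : σ × (∀ k, List (Γ k))) :
    TM2.stepAux (l.foldr Act.stmt q) s.1 s.2 =
      TM2.stepAux q (runActs l s).1 (runActs l s).2 := by
  induction l generalizing s with
  | nil => rfl
  | cons a l ih =>
    have h := ih (a.run s)
    simp only [runActs, List.foldl_cons, List.foldr_cons] at h ⊢
    rw [← h]
    cases a <;> rfl

/-- `Runs c s s' t`: started in `s`, the program `c` ends in `s'` after `t` steps. -/
inductive Runs : Cmd K Γ σ → σ × (∀ k, List (Γ k)) → σ × (∀ k, List (Γ k)) → ℕ → Prop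
  | act (l s) : Runs (.act l) s (runActs l s) 1
  | seq {a b s s₁ s₂ t₁ t₂} : Runs a s s₁ t₁ → Runs b s₁ s₂ t₂ → Runs (.seq a b) s s₂ (t₁ + t₂)
  | ite_true {b c d s s' t} : b s.1 = true → Runs c s s' t → Runs (.ite b c d) s s' (t + 1)
  | ite_false {b c d s s' t} : b s.1 = false → Runs d s s' t → Runs (.ite b c d) s s' (t + 1)
  | loop_false {b c s} : b s.1 = false → Runs (.loop b c) s s 1
  | loop_true {b c s s₁ s₂ t₁ t₂} : b s.1 = true → Runs c s s₁ t₁ → Runs (.loop b c) s₁ s₂ t₂ →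
      Runs (.loop b c) s s₂ (t₁ + t₂ + 1)

/-- The program points of a program. -/
def Cmd.Lab : Cmd K Γ σ → Type
  | .act _ => Unit
  | .seq a b => a.Lab ⊕ b.Lab
  | .ite _ c d => Option (c.Lab ⊕ d.Lab)
  | .loop _ c => Option c.Lab

instance Cmd.labFintype : (c : Cmd K Γ σ) → Fintype c.Lab
  | .act _ => inferInstanceAs (Fintype Unit)
  | .seq a b =>
    haveI := a.labFintype; haveI := b.labFintype
    inferInstanceAs (Fintype (a.Lab ⊕ b.Lab))
  | .ite _ c d =>
    haveI := c.labFintype; haveI := d.labFintype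
    inferInstanceAs (Fintype (Option (c.Lab ⊕ d.Lab)))
  | .loop _ c =>
    haveI := c.labFintype
    inferInstanceAs (Fintype (Option c.Lab))

/-- The first program point of a program. -/
def Cmd.entry : (c : Cmd K Γ σ) → c.Lab
  | .act _ => ()
  | .seq a _ => Sum.inl a.entry
  | .ite _ _ _ => none
  | .loop _ _ => none

/-- The statement at a program point, where `e` embeds the program points into the labels and
`x` is the label to go to at the end. -/
def Cmd.code {Λ : Type} : (c : Cmd K Γ σ) → (c.Lab → Λ) → Λ → c.Lab → TM2.Stmt Γ Λ σ
  | .act l, _, x, _ => l.foldr Act.stmt (.goto fun _ => x)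
  | .seq a b, e, _, .inl p => a.code (fun p => e (.inl p)) (e (.inr b.entry)) p
  | .seq _ b, e, x, .inr p => b.code (fun p => e (.inr p)) x p
  | .ite b c d, e, _, none =>
    .branch b (.goto fun _ => e (some (.inl c.entry))) (.goto fun _ => e (some (.inr d.entry)))
  | .ite _ c _, e, x, some (.inl p) => c.code (fun p => e (some (.inl p))) x p
  | .ite _ _ d, e, x, some (.inr p) => d.code (fun p => e (some (.inr p))) x p
  | .loop b c, e, x, none => .branch b (.goto fun _ => e (some c.entry)) (.goto fun _ => x)
  | .loop _ c, e, _, some p => c.code (fun p => e (some p)) (e none) p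

/-- The embedding `e` and the exit label `x` are arbitrary because subprograms sit at shifted labels
and leave to different places: the first part of a sequence exits to the entry of the second, a loop
body exits to the loop test. -/
theorem Runs.simulate {Λ : Type} {c : Cmd K Γ σ} {s s' : σ × (∀ k, List (Γ k))} {t : ℕ}
    (h : Runs c s s' t) (m : Λ → TM2.Stmt Γ Λ σ) (e : c.Lab → Λ) (x : Λ)
    (hm : ∀ p, m (e p) = c.code e x p) :
    (flip bind (TM2.step m))^[t] (some ⟨some (e c.entry), s.1, s.2⟩) =
      some (⟨some x, s'.1, s'.2⟩ : TM2.Cfg Γ Λ σ) := by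
  induction h generalizing x with
  | act l s =>
    have h := hm ()
    simp only [Function.iterate_one, flip, Option.bind_eq_bind, Option.bind_some, Cmd.entry]
    erw [TM2.step.eq_2, h]
    simp only [Cmd.code, stepAux_actStmts, TM2.stepAux]
  | seq h₁ h₂ ih₁ ih₂ =>
    rw [add_comm, Function.iterate_add_apply]
    erw [ih₁ (fun p => e (.inl p)) (e (.inr (Cmd.entry _))) fun p => hm (.inl p)]
    exact ih₂ (fun p => e (.inr p)) x fun p => hm (.inr p)
  | ite_true hb h₁ ih =>
    have h := hm none
    rw [Function.iterate_add_apply, Function.iterate_one]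
    simp only [flip, Option.bind_eq_bind, Option.bind_some, Cmd.entry]
    erw [TM2.step.eq_2, h]
    simp only [Cmd.code, TM2.stepAux, hb, cond_true]
    exact ih (fun p => e (some (.inl p))) x fun p => hm (some (.inl p))
  | ite_false hb h₁ ih =>
    have h := hm none
    rw [Function.iterate_add_apply, Function.iterate_one]
    simp only [flip, Option.bind_eq_bind, Option.bind_some, Cmd.entry]
    erw [TM2.step.eq_2, h]
    simp only [Cmd.code, TM2.stepAux, hb, cond_false]
    exact ih (fun p => e (some (.inr p))) x fun p => hm (some (.inr p))
  | loop_false hb =>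
    have h := hm none
    rw [Function.iterate_one]
    simp only [flip, Option.bind_eq_bind, Option.bind_some, Cmd.entry]
    erw [TM2.step.eq_2, h]
    simp only [Cmd.code, TM2.stepAux, hb, cond_false]
  | loop_true hb h₁ h₂ ih₁ ih₂ =>
    have h := hm none
    rw [Function.iterate_add_apply, Function.iterate_one]
    simp only [flip, Option.bind_eq_bind, Option.bind_some, Cmd.entry]
    erw [TM2.step.eq_2, h]
    simp only [Cmd.code, TM2.stepAux, hb, cond_true]
    rw [add_comm, Function.iterate_add_apply]
    erw [ih₁ (fun p => e (some p)) (e none) fun p => hm (some p)]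
    exact ih₂ e x hm

end Cmd

open Classical in
/-- A language is in `P` if it is decided in polynomial time by a structured program. -/
theorem inP_of_runs {S K σ : Type} [Fintype S] [DecidableEq K] [Fintype K] [Fintype σ]
    (k₀ k₁ : K) (hk : k₀ ≠ k₁) (Γ : K → Type) (e₀ : Γ k₀ ≃ S) (e₁ : Γ k₁ ≃ Bool) (s₀ : σ)
    (c : Cmd K Γ σ) (L : Language S) (T : Polynomial ℕ)
    (h : ∀ w : List S, ∃ t ≤ T.eval w.length,
      Runs c (s₀, Function.update (fun _ => []) k₀ (w.map e₀.symm))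
        (s₀, Function.update (fun _ => []) k₁ [e₁.symm (decide (w ∈ L))]) t) :
    InP L := by
  have : Fintype (Γ k₀) := Fintype.ofEquiv S e₀.symm
  let m : Option c.Lab → TM2.Stmt Γ (Option c.Lab) σ
    | none => .halt
    | some p => c.code some none p
  -- The label `none` is the common exit, where the machine halts; executing this statement is the
  -- additional step in `T + 1`.
  refine ⟨⟨⟨⟨k₀, k₁, Γ, Option c.Lab, some c.entry, σ, s₀, m⟩, e₀, e₁⟩, T + 1, fun w => ?_⟩⟩
  have h' := h w
  choose t ht hr using h'
  refine ⟨⟨t + 1, ?_⟩, by simpa using ht⟩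
  have hs := hr.simulate m some none fun _ => rfl
  rw [add_comm, Function.iterate_add_apply]
  -- The initial and final stacks of the machine model are given by casts along `k = k₀` and `k =
  -- k₁`; `hi` and `ho` replace them by `Function.update`.
  have hi : (fun k => @dite (List (Γ k)) (k = k₀) (inferInstance) (fun h => by
      rw [h]; exact w.map e₀.symm) fun _ => []) =
      Function.update (fun _ => []) k₀ (w.map e₀.symm) := by
    funext k
    by_cases hk' : k = k₀
    · subst hk'; simp
    · simp [hk']
  have ho : (fun k => @dite (List (Γ k)) (k = k₁) (inferInstance) (fun h => by
      rw [h]; exact [e₁.symm (decide (w ∈ L))]) fun _ => []) =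
      Function.update (fun _ => []) k₁ [e₁.symm (decide (w ∈ L))] := by
    funext k
    by_cases hk' : k = k₁
    · subst hk'; simp
    · simp [hk']
  have hinit : (⟨some (some c.entry), s₀, Function.update (fun _ => []) k₀ (w.map e₀.symm)⟩ :
      TM2.Cfg Γ (Option c.Lab) σ) = ⟨some (some c.entry), s₀, _⟩ := congrArg _ hi.symm
  have hfin : (⟨none, s₀, Function.update (fun _ => []) k₁ [e₁.symm (decide (w ∈ L))]⟩ :
      TM2.Cfg Γ (Option c.Lab) σ) = ⟨none, s₀, _⟩ := congrArg _ ho.symm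
  simp only [hinit] at hs
  refine (congrArg _ hs).trans ?_
  rw [Function.iterate_one]
  simp only [flip, Option.bind_eq_bind, FinTM2.step]
  exact congrArg some hfin

/-! ### Derived rules for structured programs -/

section Drain

variable {K : Type} [DecidableEq K] {Γ : K → Type} {σ : Type}

/-- `RunsIn c s s' T`: started in `s`, the program `c` ends in `s'` after at most `T` steps. -/
def RunsIn (c : Cmd K Γ σ) (s s' : σ × (∀ k, List (Γ k))) (T : ℕ) : Prop :=
  ∃ t ≤ T, Runs c s s' t

theorem RunsIn.mono {c : Cmd K Γ σ} {s s' : σ × (∀ k, List (Γ k))} {T T' : ℕ}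
    (h : RunsIn c s s' T) (hT : T ≤ T') : RunsIn c s s' T' :=
  let ⟨t, ht, hr⟩ := h
  ⟨t, ht.trans hT, hr⟩

theorem RunsIn.congr {c : Cmd K Γ σ} {s s' r r' : σ × (∀ k, List (Γ k))} {T : ℕ}
    (h : RunsIn c s s' T) (hs : s = r) (hs' : s' = r') : RunsIn c r r' T :=
  hs ▸ hs' ▸ h

theorem RunsIn.act {l : List (Act K Γ σ)} {s s' : σ × (∀ k, List (Γ k))}
    (h : runActs l s = s') : RunsIn (.act l) s s' 1 :=
  ⟨1, le_rfl, h ▸ .act l s⟩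

theorem RunsIn.seq {a b : Cmd K Γ σ} {s s₁ s₂ : σ × (∀ k, List (Γ k))} {T₁ T₂ : ℕ}
    (h₁ : RunsIn a s s₁ T₁) (h₂ : RunsIn b s₁ s₂ T₂) : RunsIn (.seq a b) s s₂ (T₁ + T₂) :=
  let ⟨_, ht₁, hr₁⟩ := h₁
  let ⟨_, ht₂, hr₂⟩ := h₂
  ⟨_, add_le_add ht₁ ht₂, .seq hr₁ hr₂⟩

theorem RunsIn.ite_true {b : σ → Bool} {c d : Cmd K Γ σ} {s s' : σ × (∀ k, List (Γ k))} {T : ℕ}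
    (hb : b s.1 = true) (h : RunsIn c s s' T) : RunsIn (.ite b c d) s s' (T + 1) :=
  let ⟨_, ht, hr⟩ := h
  ⟨_, Nat.add_le_add_right ht 1, .ite_true hb hr⟩

theorem RunsIn.ite_false {b : σ → Bool} {c d : Cmd K Γ σ} {s s' : σ × (∀ k, List (Γ k))} {T : ℕ}
    (hb : b s.1 = false) (h : RunsIn d s s' T) : RunsIn (.ite b c d) s s' (T + 1) :=
  let ⟨_, ht, hr⟩ := h
  ⟨_, Nat.add_le_add_right ht 1, .ite_false hb hr⟩

/-- Repeat `a; X` as long as `b` holds after `a`. -/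
def Cmd.drain (a : List (Act K Γ σ)) (b : σ → Bool) (X : Cmd K Γ σ) : Cmd K Γ σ :=
  .seq (.act a) (.loop b (.seq X (.act a)))

theorem RunsIn.drain_nil {a : List (Act K Γ σ)} {b : σ → Bool} {X : Cmd K Γ σ}
    {s s' : σ × (∀ k, List (Γ k))} (hs : runActs a s = s') (hb : b s'.1 = false) :
    RunsIn (.drain a b X) s s' 2 := by
  subst hs
  exact ⟨2, le_rfl, .seq (.act a s) (.loop_false hb)⟩

/-- The occurrence of `a` at the end of the loop body is the leading `a` of the remaining drain, so
a run of the latter is taken apart and its loop part reused. -/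
theorem RunsIn.drain_cons {a : List (Act K Γ σ)} {b : σ → Bool} {X : Cmd K Γ σ}
    {s s₁ s₂ s' : σ × (∀ k, List (Γ k))} {T₁ T₂ : ℕ} (hs : runActs a s = s₁) (hb : b s₁.1 = true)
    (hX : RunsIn X s₁ s₂ T₁) (h : RunsIn (.drain a b X) s₂ s' T₂) :
    RunsIn (.drain a b X) s s' (T₁ + T₂ + 2) := by
  subst hs
  obtain ⟨t₁, ht₁, hr₁⟩ := hX
  obtain ⟨t, ht, hr⟩ := h
  cases hr with
  | seq h₁ h₂ =>
    cases h₁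
    exact ⟨_, by omega, .seq (.act a s) (.loop_true hb (.seq hr₁ (.act a _)) h₂)⟩

/-- Empty the stack `k`. -/
def Cmd.clear (f : σ → Bool → σ) (b : σ → Bool) (k : K) : Cmd K Γ σ :=
  .drain [.pop k fun r x => f r x.isSome] b (.act [])

/-- The final register is left unspecified, since clearing only takes place when the register is
about to be reset. -/
theorem runsIn_clear (f : σ → Bool → σ) (b : σ → Bool) (hb : ∀ r x, b (f r x) = x) (k : K)
    (l : List (Γ k)) : ∀ (s : σ × (∀ k, List (Γ k))), s.2 k = l →
    ∃ r', RunsIn (.clear f b k) s (r', Function.update s.2 k []) (3 * l.length + 2) := by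
  induction l with
  | nil =>
    intro s hs
    exact ⟨_, .drain_nil (by simp [runActs, Act.run, hs]; rfl) (by simp [hb])⟩
  | cons x l ih =>
    intro s hs
    obtain ⟨r', h⟩ := ih (f s.1 true, Function.update s.2 k l) (by simp)
    refine ⟨r', (RunsIn.drain_cons (s₁ := (f s.1 true, Function.update s.2 k l)) ?_ (hb _ _)
      (.act rfl) (by simpa [Cmd.clear, runActs] using h)).mono ?_⟩
    · simp [runActs, Act.run, hs]
    · simp; omega

/-- Empty the stacks of a list. -/
def Cmd.clearAll (f : σ → Bool → σ) (b : σ → Bool) (l : List K) : Cmd K Γ σ :=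
  l.foldr (fun k c => .seq (.clear f b k) c) (.act [])

theorem runsIn_clearAll (f : σ → Bool → σ) (b : σ → Bool) (hb : ∀ r x, b (f r x) = x) (N : ℕ)
    (l : List K) : ∀ (s : σ × (∀ k, List (Γ k))), (∀ k, (s.2 k).length ≤ N) →
    ∃ r', RunsIn (.clearAll f b l) s (r', fun k => if k ∈ l then [] else s.2 k)
      (l.length * (3 * N + 2) + 1) := by
  induction l with
  | nil => exact fun s _ => ⟨s.1, (RunsIn.act rfl).mono (by simp)⟩
  | cons k l ih =>
    intro s hs
    obtain ⟨r₁, h₁⟩ := runsIn_clear f b hb k _ s rfl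
    obtain ⟨r₂, h₂⟩ := ih (r₁, Function.update s.2 k []) fun k' => by
      by_cases h : k' = k
      · subst h; simp
      · simpa [h] using hs k'
    have e : (fun k' => if k' ∈ l then [] else Function.update s.2 k [] k') =
        fun k' => if k' ∈ k :: l then [] else s.2 k' := by
      funext k'
      by_cases h : k' = k
      · subst h; simp
      · simp [h]
    rw [e] at h₂
    refine ⟨r₂, (h₁.seq h₂).mono ?_⟩
    have := hs k
    simp only [List.length_cons, add_mul]
    omega

end Drain

/-! ### Programs with pointers into a word -/

/-- Programs over a read-only word with letters in `A`, a cell in `C` for each position of the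
word, pointers `V` to positions, and a register in `σ`. The index of an access is the sum of a
list of pointers. -/
inductive Prog (A C σ V : Type)
  | load (f : σ → σ)
  | inc (v : V)
  | dec (v : V)
  | reset (v : V)
  | read (vs : List V) (f : σ → Option (A × C) → σ)
  | write (vs : List V) (f : σ → C → C)
  | seq (P Q : Prog A C σ V)
  | ite (b : σ → Bool) (P Q : Prog A C σ V)
  | loop (v : V) (P : Prog A C σ V)

/-- The states of programs with pointers. -/
@[ext]
structure PState (C σ V : Type) where
  /-- the register -/
  v : σ
  /-- the pointers -/
  p : V → ℕ
  /-- the cells -/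
  m : ℕ → C

section Prog

variable {A C σ V : Type} [DecidableEq V]

/-- Redirect a pointer. -/
def PState.setPtr (s : PState C σ V) (v : V) (x : ℕ) : PState C σ V :=
  { s with p := Function.update s.p v x }

/-- The denotation of a program with pointers. -/
def Prog.eval (w : List A) : Prog A C σ V → PState C σ V → PState C σ V
  | .load f, s => { s with v := f s.v }
  | .inc v, s => s.setPtr v (min w.length (s.p v + 1))
  | .dec v, s => s.setPtr v (s.p v - 1)
  | .reset v, s => s.setPtr v 0
  | .read vs f, s =>
    { s with v := f s.v (w[(vs.map s.p).sum]?.map fun a => (a, s.m (vs.map s.p).sum)) }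
  | .write vs f, s =>
    if (vs.map s.p).sum < w.length then
      { s with m := Function.update s.m (vs.map s.p).sum (f s.v (s.m (vs.map s.p).sum)) }
    else s
  | .seq P Q, s => Q.eval w (P.eval w s)
  | .ite b P Q, s => if b s.v then P.eval w s else Q.eval w s
  | .loop v P, s =>
    (fun s => (P.eval w s).setPtr v ((P.eval w s).p v + 1))^[w.length] (s.setPtr v 0)

/-- The program does not move the pointer `v`. -/
def Prog.Keeps (v : V) : Prog A C σ V → Prop
  | .load _ => True
  | .inc u => u ≠ v
  | .dec u => u ≠ v
  | .reset u => u ≠ v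
  | .read _ _ => True
  | .write _ _ => True
  | .seq P Q => P.Keeps v ∧ Q.Keeps v
  | .ite _ P Q => P.Keeps v ∧ Q.Keeps v
  | .loop u P => u ≠ v ∧ P.Keeps v

/-- The body of a loop does not move the loop pointer. -/
def Prog.WF : Prog A C σ V → Prop
  | .load _ => True
  | .inc _ => True
  | .dec _ => True
  | .reset _ => True
  | .read _ _ => True
  | .write _ _ => True
  | .seq P Q => P.WF ∧ Q.WF
  | .ite _ P Q => P.WF ∧ Q.WF
  | .loop v P => P.Keeps v ∧ P.WF

/-- Applied to the body of a loop, this makes the loop pointer a reliable counter of iterations. -/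
theorem Prog.eval_keeps (w : List A) {v : V} {P : Prog A C σ V} (h : P.Keeps v)
    (s : PState C σ V) : (P.eval w s).p v = s.p v := by
  induction P generalizing s with
  | load | read => rfl
  | inc u | dec u | reset u =>
    simp only [Keeps] at h
    simp [eval, PState.setPtr, Function.update_of_ne (Ne.symm h)]
  | write vs f => simp only [eval]; split <;> rfl
  | seq P Q ihP ihQ => rw [eval, ihQ h.2, ihP h.1]
  | ite b P Q ihP ihQ =>
    simp only [eval]
    split
    · exact ihP h.1 s
    · exact ihQ h.2 s
  | loop u P ih =>
    simp only [eval]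
    suffices ∀ n s', s'.p v = s.p v →
        ((fun s => (P.eval w s).setPtr u ((P.eval w s).p u + 1))^[n] s').p v = s.p v from
      this _ _ (by simp [PState.setPtr, Function.update_of_ne (Ne.symm h.1)])
    intro n
    induction n with
    | zero => exact fun s' h' => h'
    | succ n ihn =>
      intro s' h'
      rw [Function.iterate_succ_apply]
      apply ihn
      simp [PState.setPtr, Function.update_of_ne (Ne.symm h.1), ih h.2, h']

end Prog

/-! ### The stacks of the machine running a program with pointers -/

/-- The stacks: input, output, the two halves of the tape, a spare stack, and for every pointer
its value and the distance to the end of the word, in unary. -/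
inductive Stk (V : Type)
  | inp | out | left | right | tmp
  | cl (v : V)
  | cr (v : V)
  deriving DecidableEq, Fintype

/-- The stack alphabets, where `S` is the input alphabet and `X` the tape alphabet. -/
def StkAlph (S X V : Type) : Stk V → Type
  | .inp => S
  | .out => Bool
  | .left => X
  | .right => X
  | _ => Unit

/-- The register of the machine. -/
structure MReg (σ X Q : Type) where
  /-- the register of the program -/
  v : σ
  /-- a buffer for a tape symbol -/
  buf : Option X
  /-- whether the last stack tested was non-empty -/
  flag : Bool
  /-- the state of the automaton reading the input -/
  q : Q
  deriving Fintype

section Stk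

variable {S X V σ Q : Type}

/-- A stack assignment with empty input and output stacks. -/
def stks (l r : List X) (t : List Unit) (cl cr : V → List Unit) :
    ∀ k : Stk V, List (StkAlph S X V k)
  | .inp => []
  | .out => []
  | .left => l
  | .right => r
  | .tmp => t
  | .cl v => cl v
  | .cr v => cr v

/-- Programs of the machine. -/
abbrev MCmd (S X V σ Q : Type) := Cmd (Stk V) (StkAlph S X V) (MReg σ X Q)

/-- Elementary operations of the machine. -/
abbrev MAct (S X V σ Q : Type) := Act (Stk V) (StkAlph S X V) (MReg σ X Q)

/-- Push on the stack `left`. -/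
def pushL (f : MReg σ X Q → X) : MAct S X V σ Q := .push .left f

/-- Pop from the stack `left`. -/
def popL (f : MReg σ X Q → Option X → MReg σ X Q) : MAct S X V σ Q := .pop .left f

/-- Push on the stack `right`. -/
def pushR (f : MReg σ X Q → X) : MAct S X V σ Q := .push .right f

/-- Pop from the stack `right`. -/
def popR (f : MReg σ X Q → Option X → MReg σ X Q) : MAct S X V σ Q := .pop .right f

/-- Push on the stack `tmp`. -/
def pushT (f : MReg σ X Q → Unit) : MAct S X V σ Q := .push .tmp f

/-- Pop from the stack `tmp`. -/
def popT (f : MReg σ X Q → Option Unit → MReg σ X Q) : MAct S X V σ Q := .pop .tmp f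

/-- Peek at the stack `right`. -/
def peekR (f : MReg σ X Q → Option X → MReg σ X Q) : MAct S X V σ Q := .peek .right f

/-- Push a unit on the stack `cl v`. -/
def pushCl (v : V) : MAct S X V σ Q := .push (.cl v) fun _ => ()

/-- Pop from the stack `cl v`, recording whether it was non-empty. -/
def popCl (v : V) : MAct S X V σ Q := .pop (.cl v) fun g x => { g with flag := x.isSome }

/-- Push a unit on the stack `cr v`. -/
def pushCr (v : V) : MAct S X V σ Q := .push (.cr v) fun _ => ()

/-- Pop from the stack `cr v`, recording whether it was non-empty. -/
def popCr (v : V) : MAct S X V σ Q := .pop (.cr v) fun g x => { g with flag := x.isSome }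

/-- Test whether the stack `cr v` is non-empty. -/
def peekCr (v : V) : MAct S X V σ Q := .peek (.cr v) fun g x => { g with flag := x.isSome }

variable [DecidableEq V] (g : MReg σ X Q) (l r : List X) (t : List Unit) (cl cr : V → List Unit)

@[simp] theorem run_pushL (f : MReg σ X Q → X) :
    (pushL f).run (g, stks (S := S) l r t cl cr) = (g, stks (S := S) (f g :: l) r t cl cr) := by
  refine Prod.ext rfl (Function.update_eq_iff.2 ⟨rfl, fun k hk => ?_⟩)
  cases k <;> first | rfl | exact absurd rfl hk

@[simp] theorem run_popL (f : MReg σ X Q → Option X → MReg σ X Q) :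
    (popL f).run (g, stks (S := S) l r t cl cr) =
      (f g l.head?, stks (S := S) l.tail r t cl cr) := by
  refine Prod.ext rfl (Function.update_eq_iff.2 ⟨rfl, fun k hk => ?_⟩)
  cases k <;> first | rfl | exact absurd rfl hk

@[simp] theorem run_pushR (f : MReg σ X Q → X) :
    (pushR f).run (g, stks (S := S) l r t cl cr) = (g, stks (S := S) l (f g :: r) t cl cr) := by
  refine Prod.ext rfl (Function.update_eq_iff.2 ⟨rfl, fun k hk => ?_⟩)
  cases k <;> first | rfl | exact absurd rfl hk

@[simp] theorem run_popR (f : MReg σ X Q → Option X → MReg σ X Q) :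
    (popR f).run (g, stks (S := S) l r t cl cr) =
      (f g r.head?, stks (S := S) l r.tail t cl cr) := by
  refine Prod.ext rfl (Function.update_eq_iff.2 ⟨rfl, fun k hk => ?_⟩)
  cases k <;> first | rfl | exact absurd rfl hk

@[simp] theorem run_pushT (f : MReg σ X Q → Unit) :
    (pushT f).run (g, stks (S := S) l r t cl cr) = (g, stks (S := S) l r (f g :: t) cl cr) := by
  refine Prod.ext rfl (Function.update_eq_iff.2 ⟨rfl, fun k hk => ?_⟩)
  cases k <;> first | rfl | exact absurd rfl hk

@[simp] theorem run_popT (f : MReg σ X Q → Option Unit → MReg σ X Q) :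
    (popT f).run (g, stks (S := S) l r t cl cr) =
      (f g t.head?, stks (S := S) l r t.tail cl cr) := by
  refine Prod.ext rfl (Function.update_eq_iff.2 ⟨rfl, fun k hk => ?_⟩)
  cases k <;> first | rfl | exact absurd rfl hk

@[simp] theorem run_peekR (f : MReg σ X Q → Option X → MReg σ X Q) :
    (peekR f).run (g, stks (S := S) l r t cl cr) = (f g r.head?, stks (S := S) l r t cl cr) :=
  rfl

@[simp] theorem run_peekCr (v : V) :
    (peekCr v).run (g, stks (S := S) l r t cl cr) =
      ({ g with flag := (cr v).head?.isSome }, stks (S := S) l r t cl cr) :=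
  rfl

@[simp] theorem run_pushCl (v : V) :
    (pushCl v).run (g, stks (S := S) l r t cl cr) =
      (g, stks (S := S) l r t (Function.update cl v (() :: cl v)) cr) := by
  refine Prod.ext rfl (Function.update_eq_iff.2
    ⟨(Function.update_self (β := fun _ => List Unit) ..).symm, fun k hk => ?_⟩)
  cases k with
  | cl u =>
    exact (Function.update_of_ne (β := fun _ => List Unit) (fun h => hk (congrArg _ h)) ..).symm
  | _ => rfl

@[simp] theorem run_popCl (v : V) :
    (popCl v).run (g, stks (S := S) l r t cl cr) =
      ({ g with flag := (cl v).head?.isSome },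
        stks (S := S) l r t (Function.update cl v (cl v).tail) cr) := by
  refine Prod.ext rfl (Function.update_eq_iff.2
    ⟨(Function.update_self (β := fun _ => List Unit) ..).symm, fun k hk => ?_⟩)
  cases k with
  | cl u =>
    exact (Function.update_of_ne (β := fun _ => List Unit) (fun h => hk (congrArg _ h)) ..).symm
  | _ => rfl

@[simp] theorem run_pushCr (v : V) :
    (pushCr v).run (g, stks (S := S) l r t cl cr) =
      (g, stks (S := S) l r t cl (Function.update cr v (() :: cr v))) := by
  refine Prod.ext rfl (Function.update_eq_iff.2
    ⟨(Function.update_self (β := fun _ => List Unit) ..).symm, fun k hk => ?_⟩)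
  cases k with
  | cr u =>
    exact (Function.update_of_ne (β := fun _ => List Unit) (fun h => hk (congrArg _ h)) ..).symm
  | _ => rfl

@[simp] theorem run_popCr (v : V) :
    (popCr v).run (g, stks (S := S) l r t cl cr) =
      ({ g with flag := (cr v).head?.isSome },
        stks (S := S) l r t cl (Function.update cr v (cr v).tail)) := by
  refine Prod.ext rfl (Function.update_eq_iff.2
    ⟨(Function.update_self (β := fun _ => List Unit) ..).symm, fun k hk => ?_⟩)
  cases k with
  | cr u =>
    exact (Function.update_of_ne (β := fun _ => List Unit) (fun h => hk (congrArg _ h)) ..).symm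
  | _ => rfl

/-- Move the head forward as often as the pointer `v` says, moving the pointer to the spare
stack. -/
def seekCmd [Inhabited X] (v : V) : MCmd S X V σ Q :=
  .drain [popCl v] (·.flag)
    (.seq (.act [pushT fun _ => (), popR fun g x => { g with buf := x }])
      (.ite (fun g => g.buf.isSome) (.act [pushL fun g => g.buf.getD default]) (.act [])))

theorem reverse_take_succ {l : List X} {a : ℕ} {x : X} (h : l[a]? = some x) :
    (l.take (a + 1)).reverse = x :: (l.take a).reverse := by
  simp [List.take_add_one, h]

/-- The tape is a zipper: the letters before the head, reversed, and the letters from the head on.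
Since `take` and `drop` saturate, the formula for the final position remains true when the head
would pass the end of the tape, where nothing is moved any more. The pointer survives as `n` units
on the spare stack. -/
theorem runsIn_seekCmd [Inhabited X] (v : V) (l : List X) (cr : V → List Unit) (n : ℕ) :
    ∀ (r : MReg σ X Q) (a j : ℕ) (cl : V → List Unit), cl v = List.replicate n () →
    ∃ r' : MReg σ X Q, r'.v = r.v ∧ RunsIn (seekCmd (S := S) v)
      (r, stks (l.take a).reverse (l.drop a) (List.replicate j ()) cl cr)
      (r', stks (l.take (a + n)).reverse (l.drop (a + n)) (List.replicate (j + n) ())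
        (Function.update cl v []) cr) (5 * n + 2) := by
  induction n with
  | zero =>
    intro r a j cl h
    exact ⟨{ r with flag := false }, rfl,
      .drain_nil (by simp [runActs,  h]) rfl⟩
  | succ n ih =>
    intro r a j cl h
    obtain ⟨r', hr', h'⟩ := ih { r with flag := true, buf := (l.drop a).head? } (a + 1) (j + 1)
      (Function.update cl v (List.replicate n ())) (by simp)
    refine ⟨r', hr', ?_⟩
    rw [Function.update_idem] at h'
    have e : a + 1 + n = a + (n + 1) ∧ j + 1 + n = j + (n + 1) := by omega
    rw [e.1, e.2] at h'
    refine (RunsIn.drain_cons (s₁ := ({ r with flag := true },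
      stks (l.take a).reverse (l.drop a) (List.replicate j ())
        (Function.update cl v (List.replicate n ())) cr)) (T₁ := 3) ?_ rfl ?_ h').mono (by omega)
    · simp [runActs,  h, List.replicate_succ]
    · refine RunsIn.seq (T₁ := 1) (T₂ := 2)
        (s₁ := ({ r with flag := true, buf := (l.drop a).head? },
          stks (l.take a).reverse (l.drop (a + 1)) (List.replicate (j + 1) ())
            (Function.update cl v (List.replicate n ())) cr)) ?_ ?_
      · refine RunsIn.act ?_
        simp [runActs, List.replicate_succ]
      · rcases hx : l[a]? with _ | x
        · refine .ite_false (by simp [List.head?_drop, hx]) (RunsIn.act ?_)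
          have : l.length ≤ a := by simpa using hx
          simp [runActs, List.take_of_length_le this,
            List.take_of_length_le (this.trans (Nat.le_succ a))]
        · refine .ite_true (by simp [List.head?_drop, hx]) (RunsIn.act ?_)
          simp [runActs, reverse_take_succ hx, List.head?_drop, hx]

/-- Restore the pointer `v` from the spare stack. -/
def restoreCmd (v : V) : MCmd S X V σ Q :=
  .drain [popT fun g x => { g with flag := x.isSome }] (·.flag)
    (.act [pushCl v])

theorem runsIn_restoreCmd (v : V) (l r : List X) (cr : V → List Unit) (n : ℕ) :
    ∀ (g : MReg σ X Q) (j : ℕ) (cl : V → List Unit), cl v = List.replicate j () →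
    ∃ g' : MReg σ X Q, g'.v = g.v ∧ RunsIn (restoreCmd (S := S) v)
      (g, stks l r (List.replicate n ()) cl cr)
      (g', stks l r [] (Function.update cl v (List.replicate (j + n) ())) cr) (3 * n + 2) := by
  induction n with
  | zero =>
    intro g j cl h
    exact ⟨{ g with flag := false }, rfl,
      .drain_nil (by simp [runActs, ← h]) rfl⟩
  | succ n ih =>
    intro g j cl h
    obtain ⟨g', hg', h'⟩ := ih { g with flag := true } (j + 1)
      (Function.update cl v (List.replicate (j + 1) ())) (by simp)
    refine ⟨g', hg', ?_⟩
    rw [Function.update_idem, show j + 1 + n = j + (n + 1) by omega] at h'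
    refine (RunsIn.drain_cons (s₁ := ({ g with flag := true },
      stks l r (List.replicate n ()) cl cr)) (T₁ := 1) ?_ rfl ?_ h').mono (by omega)
    · simp [runActs, List.replicate_succ]
    · refine RunsIn.act ?_
      simp [runActs, h, List.replicate_succ]

/-- Move the head to the beginning of the tape. -/
def rewindCmd [Inhabited X] : MCmd S X V σ Q :=
  .drain [popL fun g x => { g with buf := x }] (·.buf.isSome)
    (.act [pushR fun g => g.buf.getD default])

/-- The automaton state `q` is tracked as well, because the first rewinding happens between reading
the input and passing the final automaton state to the program. -/
theorem runsIn_rewindCmd [Inhabited X] (t : List Unit) (cl cr : V → List Unit) (l : List X) :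
    ∀ (g : MReg σ X Q) (r : List X),
    ∃ g' : MReg σ X Q, g'.v = g.v ∧ g'.q = g.q ∧ RunsIn (rewindCmd (S := S))
      (g, stks l r t cl cr) (g', stks [] (l.reverse ++ r) t cl cr) (3 * l.length + 2) := by
  induction l with
  | nil =>
    intro g r
    exact ⟨{ g with buf := none }, rfl, rfl, .drain_nil (by simp [runActs]) rfl⟩
  | cons x l ih =>
    intro g r
    obtain ⟨g', hg', hq', h'⟩ := ih { g with buf := some x } (x :: r)
    refine ⟨g', hg', hq', ?_⟩
    rw [List.reverse_cons, List.append_assoc, List.singleton_append]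
    refine (RunsIn.drain_cons (s₁ := ({ g with buf := some x },
      stks l r t cl cr)) (T₁ := 1) ?_ rfl ?_ h').mono (by simp; omega)
    · simp [runActs]
    · refine RunsIn.act ?_
      simp [runActs]

/-- Move the pointer `v` to the first position. -/
def resetCmd (v : V) : MCmd S X V σ Q :=
  .drain [popCl v] (·.flag) (.act [pushCr v])

theorem runsIn_resetCmd (v : V) (l r : List X) (t : List Unit) (n : ℕ) :
    ∀ (g : MReg σ X Q) (j : ℕ) (cl cr : V → List Unit), cl v = List.replicate n () →
      cr v = List.replicate j () →
    ∃ g' : MReg σ X Q, g'.v = g.v ∧ RunsIn (resetCmd (S := S) v)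
      (g, stks l r t cl cr)
      (g', stks l r t (Function.update cl v [])
        (Function.update cr v (List.replicate (j + n) ()))) (3 * n + 2) := by
  induction n with
  | zero =>
    intro g j cl cr h hj
    exact ⟨{ g with flag := false }, rfl,
      .drain_nil (by simp [runActs,  h, ← hj]) rfl⟩
  | succ n ih =>
    intro g j cl cr h hj
    obtain ⟨g', hg', h'⟩ := ih { g with flag := true } (j + 1)
      (Function.update cl v (List.replicate n ()))
      (Function.update cr v (List.replicate (j + 1) ())) (by simp) (by simp)
    refine ⟨g', hg', ?_⟩
    rw [Function.update_idem, Function.update_idem, show j + 1 + n = j + (n + 1) by omega] at h'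
    refine (RunsIn.drain_cons (s₁ := ({ g with flag := true },
      stks l r t (Function.update cl v (List.replicate n ())) cr)) (T₁ := 1) ?_ rfl ?_ h').mono
        (by omega)
    · simp [runActs,  h, List.replicate_succ]
    · refine RunsIn.act ?_
      simp [runActs, hj, List.replicate_succ]

end Stk

/-! ### Compiling programs with pointers -/

section Compile

variable {S A C V σ Q : Type} [DecidableEq V] [Inhabited A] [Inhabited C]

/-- Move the head to the sum of the pointers of a list. -/
def seekAllCmd {X : Type} [Inhabited X] (vs : List V) : MCmd S X V σ Q :=
  vs.foldr (fun v c => .seq (.seq (seekCmd v) (restoreCmd v)) c) (.act [])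

/-- Seeking starts wherever the head is, so seeking along several pointers in turn adds them up. The
coefficient `8` consists of `5` for seeking and `3` for restoring the pointer. -/
theorem runsIn_seekAllCmd {X : Type} [Inhabited X] (l : List X) (p : V → ℕ) (N : ℕ)
    (hp : ∀ v, p v ≤ N) (cr : V → List Unit) (vs : List V) : ∀ (g : MReg σ X Q) (a : ℕ),
    ∃ g' : MReg σ X Q, g'.v = g.v ∧ RunsIn (seekAllCmd (S := S) vs)
      (g, stks (l.take a).reverse (l.drop a) [] (fun v => List.replicate (p v) ()) cr)
      (g', stks (l.take (a + (vs.map p).sum)).reverse (l.drop (a + (vs.map p).sum)) []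
        (fun v => List.replicate (p v) ()) cr) (vs.length * (8 * N + 4) + 1) := by
  induction vs with
  | nil => exact fun g a => ⟨g, rfl, (RunsIn.act rfl).mono (by simp)⟩
  | cons v vs ih =>
    intro g a
    obtain ⟨g₁, hg₁, h₁⟩ := runsIn_seekCmd (S := S) v l cr (p v) g a 0
      (fun v => List.replicate (p v) ()) rfl
    obtain ⟨g₂, hg₂, h₂⟩ := runsIn_restoreCmd (S := S) v (l.take (a + p v)).reverse
      (l.drop (a + p v)) cr (p v) g₁ 0
      (Function.update (fun v => List.replicate (p v) ()) v []) (by simp)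
    obtain ⟨g₃, hg₃, h₃⟩ := ih g₂ (a + p v)
    have e : Function.update (Function.update (fun v => List.replicate (p v) ()) v []) v
        (List.replicate (0 + p v) ()) = fun v => List.replicate (p v) () := by
      simp
    rw [e] at h₂
    rw [zero_add] at h₁
    rw [add_assoc, ← List.sum_cons, ← List.map_cons] at h₃
    refine ⟨g₃, hg₃.trans (hg₂.trans hg₁), ((h₁.seq h₂).seq h₃).mono ?_⟩
    have := hp v
    simp only [List.length_cons, add_mul]
    omega

/-- The tape holding the word `w` and the cells `m`. -/
def tape (w : List A) (m : ℕ → C) : List (A × C) :=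
  w.mapIdx fun i a => (a, m i)

omit [Inhabited A] [Inhabited C] in
@[simp] theorem length_tape (w : List A) (m : ℕ → C) : (tape w m).length = w.length := by
  simp [tape]

omit [Inhabited A] [Inhabited C] in
@[simp] theorem getElem?_tape (w : List A) (m : ℕ → C) (i : ℕ) :
    (tape w m)[i]? = w[i]?.map fun a => (a, m i) := by
  simp [tape]

omit [Inhabited A] [Inhabited C] in
-- The form is that of the zipper at position `i` after its letter has been replaced.
theorem tape_update (w : List A) (m : ℕ → C) (i : ℕ) (c : C) (a : A) (ha : w[i]? = some a) :
    tape w (Function.update m i c) =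
      (tape w m).take i ++ (a, c) :: (tape w m).drop (i + 1) := by
  have hi : i < w.length := (List.getElem?_eq_some_iff.1 ha).1
  have h := List.set_eq_take_append_cons_drop (l := tape w m) (i := i) (a := (a, c))
  rw [length_tape, if_pos hi] at h
  rw [← h]
  refine List.ext_getElem? fun j => ?_
  rw [List.getElem?_set, getElem?_tape, getElem?_tape, length_tape]
  by_cases hj : i = j
  · subst hj
    simp [hi, (List.getElem?_eq_some_iff.1 ha).2]
  · simp [hj, Function.update_of_ne (Ne.symm hj)]

/-- The stacks representing a state of a program with pointers. -/
def phys (w : List A) (s : PState C σ V) : ∀ k : Stk V, List (StkAlph S (A × C) V k) :=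
  stks [] (tape w s.m) [] (fun v => List.replicate (s.p v) ())
    fun v => List.replicate (w.length - s.p v) ()

/-- The compiled program. -/
def Prog.cmd : Prog A C σ V → MCmd S (A × C) V σ Q
  | .load f => .act [.load fun g => { g with v := f g.v }]
  | .inc v => .seq (.act [popCr v]) (.ite (·.flag) (.act [pushCl v]) (.act []))
  | .dec v => .seq (.act [popCl v]) (.ite (·.flag) (.act [pushCr v]) (.act []))
  | .reset v => resetCmd v
  | .read vs f => .seq (seekAllCmd vs)
      (.seq (.act [peekR fun g x => { g with v := f g.v x }]) rewindCmd)
  | .write vs f => .seq (seekAllCmd vs) (.seq (.act [popR fun g x => { g with buf := x }])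
      (.seq (.ite (fun g => g.buf.isSome)
        (.act [pushR fun g => ((g.buf.getD default).1, f g.v (g.buf.getD default).2)]) (.act []))
        rewindCmd))
  | .seq P Q => .seq P.cmd Q.cmd
  | .ite b P Q => .ite (fun g => b g.v) P.cmd Q.cmd
  | .loop v P => .seq (resetCmd v)
      (.drain [peekCr v] (·.flag) (.seq P.cmd (.act [popCr v, pushCl v])))

/-- A time bound for the compiled program, in the length of the word. -/
noncomputable def Prog.time : Prog A C σ V → Polynomial ℕ
  | .load _ => 1
  | .inc _ => 3
  | .dec _ => 3
  | .reset _ => 3 * Polynomial.X + 2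
  | .read vs _ => Polynomial.C vs.length * (8 * Polynomial.X + 4) + 1 + (1 + (3 * Polynomial.X + 2))
  | .write vs _ => Polynomial.C vs.length * (8 * Polynomial.X + 4) + 1 + (1 + (2 + (3 * Polynomial.X + 2)))
  | .seq P Q => P.time + Q.time
  | .ite _ P Q => P.time + Q.time + 1
  | .loop _ P => 3 * Polynomial.X + 2 + (Polynomial.X * (P.time + 3) + 2)

omit [Inhabited A] [Inhabited C] in
theorem phys_setPtr (w : List A) (s : PState C σ V) (v : V) (x : ℕ) :
    phys (S := S) w (s.setPtr v x) = stks [] (tape w s.m) []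
      (Function.update (fun v => List.replicate (s.p v) ()) v (List.replicate x ()))
      (Function.update (fun v => List.replicate (w.length - s.p v) ()) v
        (List.replicate (w.length - x) ())) := by
  unfold phys PState.setPtr
  congr 1 <;>
  · funext u
    by_cases h : u = v
    · subst h; simp
    · simp [h]

omit [Inhabited A] [Inhabited C] in
-- This bound makes the two unary stacks of a pointer complementary: `w.length - s.p v` is then a
-- true difference. For a loop, the pointer plus the remaining iterations stays at most `w.length`,
-- as the body does not move the pointer.
theorem Prog.eval_le (w : List A) (P : Prog A C σ V) (hP : P.WF) (s : PState C σ V)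
    (hs : ∀ v, s.p v ≤ w.length) (v : V) : (P.eval w s).p v ≤ w.length := by
  induction P generalizing s v with
  | load | read => exact hs v
  | inc u | dec u | reset u =>
    have := hs v
    have := hs u
    simp only [eval, PState.setPtr, Function.update_apply]
    split <;> omega
  | write vs f => simp only [eval]; split <;> exact hs v
  | seq P Q ihP ihQ => exact ihQ hP.2 _ (ihP hP.1 s hs) v
  | ite b P Q ihP ihQ =>
    simp only [eval]
    split
    · exact ihP hP.1 s hs v
    · exact ihQ hP.2 s hs v
  | loop u P ih =>
    simp only [eval]
    suffices ∀ n s', (∀ v, s'.p v ≤ w.length) → s'.p u + n ≤ w.length →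
        ∀ v, ((fun s => (P.eval w s).setPtr u ((P.eval w s).p u + 1))^[n] s').p v ≤ w.length by
      refine this _ _ (fun v => ?_) (by simp [PState.setPtr]) v
      have := hs v
      simp only [PState.setPtr, Function.update_apply]
      split <;> omega
    intro n
    induction n with
    | zero => exact fun s' h' _ => h'
    | succ n ihn =>
      intro s' h' hn
      have hu := Prog.eval_keeps w hP.1 s'
      rw [Function.iterate_succ_apply]
      apply ihn
      · intro v
        simp only [PState.setPtr, Function.update_apply]
        split
        · omega
        · exact ih hP.2 _ h' v
      · simp only [PState.setPtr, Function.update_self]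
        omega

theorem runsIn_rewind_tape (w : List A) (s : PState C σ V) (g : MReg σ (A × C) Q)
    (a : ℕ) : ∃ g' : MReg σ (A × C) Q, g'.v = g.v ∧ RunsIn (rewindCmd (S := S))
      (g, stks ((tape w s.m).take a).reverse ((tape w s.m).drop a) []
        (fun v => List.replicate (s.p v) ()) fun v => List.replicate (w.length - s.p v) ())
      (g', phys w s) (3 * w.length + 2) := by
  obtain ⟨g', hg', -, h⟩ := runsIn_rewindCmd (S := S) [] (fun v => List.replicate (s.p v) ())
    (fun v => List.replicate (w.length - s.p v) ()) ((tape w s.m).take a).reverse g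
    ((tape w s.m).drop a)
  refine ⟨g', hg', RunsIn.mono (T := _) ?_ (le_refl _)⟩
  rw [List.reverse_reverse, List.take_append_drop] at h
  exact h.mono (by simp)

/-- The invariant between commands is `phys`: head at the beginning, spare stack empty, every
pointer stored with its complement. Only the program part of the machine register is tracked; buffer
and flag are scratch. -/
theorem runsIn_cmd (w : List A) (P : Prog A C σ V) (hP : P.WF) :
    ∀ (s : PState C σ V) (_ : ∀ v, s.p v ≤ w.length) (g : MReg σ (A × C) Q) (_ : g.v = s.v),
    ∃ g' : MReg σ (A × C) Q, g'.v = (P.eval w s).v ∧ RunsIn (P.cmd (S := S))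
      (g, phys w s) (g', phys w (P.eval w s)) (P.time.eval w.length) := by
  induction P with
  | load f =>
    intro s hs g hg
    exact ⟨{ g with v := f g.v }, by simp [Prog.eval, hg], (RunsIn.act rfl).mono
      (by simp [Prog.time])⟩
  | inc v =>
    intro s hs g hg
    have hv := hs v
    rw [Prog.eval, phys_setPtr]
    -- An empty complement stack means that the pointer is at the end of the word; then `inc` has no
    -- effect, in agreement with the `min` in `Prog.eval`.
    rcases h : w.length - s.p v with _ | d
    · refine ⟨{ g with flag := false }, hg, (RunsIn.seq (T₁ := 1) (T₂ := 2) (.act rfl)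
        (RunsIn.ite_false ?_ (RunsIn.act ?_))).mono (by simp [Prog.time])⟩
      · simp [runActs, phys, h]
      · have e : min w.length (s.p v + 1) = s.p v := by omega
        simp [runActs, phys, h, e]
    · refine ⟨{ g with flag := true }, hg, (RunsIn.seq (T₁ := 1) (T₂ := 2) (.act rfl)
        (RunsIn.ite_true ?_ (RunsIn.act ?_))).mono (by simp [Prog.time])⟩
      · simp [runActs, phys, h, List.replicate_succ]
      · have e : min w.length (s.p v + 1) = s.p v + 1 := by omega
        have e' : w.length - (s.p v + 1) = d := by omega
        simp [runActs, phys, h, e, e', List.replicate_succ]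
  | dec v =>
    intro s hs g hg
    have hv := hs v
    rw [Prog.eval, phys_setPtr]
    rcases h : s.p v with _ | d
    · refine ⟨{ g with flag := false }, hg, (RunsIn.seq (T₁ := 1) (T₂ := 2) (.act rfl)
        (RunsIn.ite_false ?_ (RunsIn.act ?_))).mono (by simp [Prog.time])⟩
      · simp [runActs, phys, h]
      · have e' : Function.update (fun v => List.replicate (w.length - s.p v) ()) v
          (List.replicate w.length ()) = fun v => List.replicate (w.length - s.p v) () := by
            rw [Function.update_eq_self_iff, h, Nat.sub_zero]
        simp [runActs, phys, h, e']
    · refine ⟨{ g with flag := true }, hg, (RunsIn.seq (T₁ := 1) (T₂ := 2) (.act rfl)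
        (RunsIn.ite_true ?_ (RunsIn.act ?_))).mono (by simp [Prog.time])⟩
      · simp [runActs, phys, h, List.replicate_succ]
      · have e' : w.length - d = w.length - (d + 1) + 1 := by omega
        simp [runActs, phys, h, e', List.replicate_succ]
  | reset v =>
    intro s hs g hg
    have hv := hs v
    obtain ⟨g', hg', h⟩ := runsIn_resetCmd (S := S) v [] (tape w s.m) [] (s.p v) g (w.length - s.p v)
      (fun v => List.replicate (s.p v) ()) (fun v => List.replicate (w.length - s.p v) ()) rfl rfl
    refine ⟨g', hg'.trans hg, ?_⟩
    rw [Prog.eval, phys_setPtr]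
    rw [Nat.sub_add_cancel hv] at h
    exact h.mono (by simp [Prog.time, hv])
  | read vs f =>
    intro s hs g hg
    obtain ⟨g₁, hg₁, h₁⟩ := runsIn_seekAllCmd (S := S) (tape w s.m) s.p w.length hs
      (fun v => List.replicate (w.length - s.p v) ()) vs g 0
    simp only [zero_add] at h₁
    obtain ⟨g₂, hg₂, h₂⟩ := runsIn_rewind_tape (S := S) w s
      ({ g₁ with v := f g₁.v ((tape w s.m).drop (vs.map s.p).sum).head? } : MReg σ (A × C) Q)
      (vs.map s.p).sum
    refine ⟨g₂, ?_, (RunsIn.seq h₁ (.seq (.act (by simp [runActs])) h₂)).mono ?_⟩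
    · rw [hg₂]
      simp [Prog.eval, hg₁, hg, List.head?_drop]
    · simp [Prog.time]
  | write vs f =>
    intro s hs g hg
    obtain ⟨g₁, hg₁, h₁⟩ := runsIn_seekAllCmd (S := S) (tape w s.m) s.p w.length hs
      (fun v => List.replicate (w.length - s.p v) ()) vs g 0
    simp only [zero_add] at h₁
    -- Rewinding is described on the tape that already contains the new cell.
    obtain ⟨g₂, hg₂, h₂⟩ := runsIn_rewind_tape (S := S) w (Prog.eval w (.write vs f) s)
      ({ g₁ with buf := ((tape w s.m).drop (vs.map s.p).sum).head? } : MReg σ (A × C) Q)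
      (vs.map s.p).sum
    have hg₂' : g₂.v = s.v := by rw [hg₂]; simp [hg₁, hg]
    refine ⟨g₂, ?_, (RunsIn.seq (T₂ := 1 + (2 + (3 * w.length + 2))) h₁ (.seq (.act rfl)
      (.seq ?_ h₂))).mono ?_⟩
    · rw [hg₂', Prog.eval]
      split <;> rfl
    · rcases hx : w[(vs.map s.p).sum]? with _ | a
      · have hn : ¬ (vs.map s.p).sum < w.length := by simpa using hx
        refine RunsIn.ite_false ?_ (RunsIn.act ?_)
        · simp [runActs, List.head?_drop, hx]
        · have : (tape w s.m).length ≤ (vs.map s.p).sum := by simpa using hn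
          simp [runActs, Prog.eval, hn, List.drop_of_length_le this]
      · have hn : (vs.map s.p).sum < w.length := (List.getElem?_eq_some_iff.1 hx).1
        refine RunsIn.ite_true ?_ (RunsIn.act ?_)
        · simp [runActs, List.head?_drop, hx]
        · simp only [runActs, Prog.eval, hn, if_true, tape_update _ _ _ _ _ hx]
          have hl : ((tape w s.m).take (vs.map s.p).sum).length = (vs.map s.p).sum := by
            simp [hn.le]
          rw [List.take_left' hl, List.drop_left' hl]
          simp [List.head?_drop, hx, hg₁, hg]
    · simp [Prog.time]
  | seq P R ihP ihR =>
    intro s hs g hg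
    obtain ⟨g₁, hg₁, h₁⟩ := ihP hP.1 s hs g hg
    obtain ⟨g₂, hg₂, h₂⟩ := ihR hP.2 _ (P.eval_le w hP.1 s hs) g₁ hg₁
    exact ⟨g₂, hg₂, (h₁.seq h₂).mono (by simp [Prog.time])⟩
  | ite b P R ihP ihR =>
    intro s hs g hg
    rcases hb : b s.v with _ | _
    · obtain ⟨g', hg', h⟩ := ihR hP.2 s hs g hg
      simp only [Prog.eval, hb]
      exact ⟨g', hg', (RunsIn.ite_false (by simpa [hg] using hb) h).mono (by simp [Prog.time])⟩
    · obtain ⟨g', hg', h⟩ := ihP hP.1 s hs g hg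
      simp only [Prog.eval, hb]
      exact ⟨g', hg', (RunsIn.ite_true (by simpa [hg] using hb) h).mono (by simp [Prog.time])⟩
  | loop v P ih =>
    intro s hs g hg
    have hv := hs v
    obtain ⟨g₁, hg₁, h₁⟩ := runsIn_resetCmd (S := S) v [] (tape w s.m) [] (s.p v) g
      (w.length - s.p v)
      (fun v => List.replicate (s.p v) ()) (fun v => List.replicate (w.length - s.p v) ()) rfl rfl
    rw [Nat.sub_add_cancel hv] at h₁
    -- The number `n` of remaining iterations is the height of the stack `cr v`, so the loop pointer
    -- itself serves as the counter and no further stack is needed.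
    suffices ∀ (n : ℕ) (s' : PState C σ V) (g' : MReg σ (A × C) Q), (∀ v, s'.p v ≤ w.length) →
        s'.p v + n = w.length → g'.v = s'.v → ∃ g'' : MReg σ (A × C) Q,
        g''.v = ((fun s => (P.eval w s).setPtr v ((P.eval w s).p v + 1))^[n] s').v ∧
        RunsIn (.drain [peekCr v] (·.flag) (.seq P.cmd (.act [popCr v, pushCl v])))
          (g', phys (S := S) w s')
          (g'', phys w ((fun s => (P.eval w s).setPtr v ((P.eval w s).p v + 1))^[n] s'))
          (n * (P.time.eval w.length + 3) + 2) by
      obtain ⟨g₂, hg₂, h₂⟩ := this w.length (s.setPtr v 0) g₁ (fun u => by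
        have := hs u
        simp only [PState.setPtr, Function.update_apply]
        split <;> omega) (by simp [PState.setPtr]) (by rw [hg₁, hg]; rfl)
      refine ⟨g₂, hg₂, (RunsIn.seq h₁ (s₂ := (g₂, phys w (Prog.eval w (.loop v P) s)))
        (T₂ := w.length * (P.time.eval w.length + 3) + 2) ?_).mono ?_⟩
      · rw [phys_setPtr] at h₂
        exact h₂
      · simp [Prog.time]
        omega
    intro n
    induction n with
    | zero =>
      intro s' g' hs' hn hg'
      refine ⟨{ g' with flag := false }, hg', (RunsIn.drain_nil ?_ rfl).mono (by simp)⟩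
      simp [runActs, phys, ← hn]
    | succ n ihn =>
      intro s' g' hs' hn hg'
      have hk := P.eval_keeps w hP.1 s'
      have hle := P.eval_le w hP.2 s' hs'
      obtain ⟨g₂, hg₂, h₂⟩ := ih hP.2 s' hs' { g' with flag := true } hg'
      obtain ⟨g₃, hg₃, h₃⟩ := ihn ((P.eval w s').setPtr v ((P.eval w s').p v + 1))
        { g₂ with flag := true } (fun u => by
          have := hle u
          simp only [PState.setPtr, Function.update_apply]
          split <;> omega) (by simp [PState.setPtr, hk]; omega) hg₂
      rw [← Function.iterate_succ_apply] at h₃ hg₃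
      have e : w.length - s'.p v = n + 1 := by omega
      have e' : w.length - (s'.p v + 1) = n := by omega
      refine ⟨g₃, hg₃, (RunsIn.drain_cons (s₁ := ({ g' with flag := true }, phys w s')) ?_ rfl
        (h₂.seq (.act (l := [popCr v, pushCl v]) ?_)) h₃).mono ?_⟩
      · simp [runActs, phys, e, List.replicate_succ]
      · rw [phys_setPtr]
        simp [runActs, phys, e, hk, e', List.replicate_succ]
      · rw [add_mul]
        omega

end Compile

/-! ### Reading the input -/

/-- The word `w` together with the states of an automaton reading it: each letter is paired with
the state after it. -/
def tag {S Q : Type} (δ : Q → S → Q) : Q → List S → List (S × Q)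
  | _, [] => []
  | q, a :: w => (a, δ q a) :: tag δ (δ q a) w

@[simp] theorem length_tag {S Q : Type} (δ : Q → S → Q) (q : Q) (w : List S) :
    (tag δ q w).length = w.length := by
  induction w generalizing q with
  | nil => rfl
  | cons a w ih => simp [tag, ih]

section Load

variable {S C V σ Q : Type} [DecidableEq V] [Fintype V] [Inhabited S] [Inhabited Q] [Inhabited C]

/-- Read the input, running the automaton `δ`. -/
noncomputable def loadCmd (δ : Q → S → Q) : MCmd S ((S × Q) × C) V σ Q :=
  .drain [.pop .inp fun g (x : Option S) => match x with
      | none => { g with buf := none }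
      | some a => { g with buf := some ((a, δ g.q a), default), q := δ g.q a }]
    (·.buf.isSome)
    (.act (pushL (fun g => g.buf.getD default) :: (Finset.univ.toList (α := V)).map pushCr))

omit [Fintype V] [Inhabited S] [Inhabited Q] [Inhabited C] in
theorem runActs_pushCr {X : Type} (l r : List X) (t : List Unit) (cl : V → List Unit)
    (g : MReg σ X Q) (vs : List V) (hvs : vs.Nodup) : ∀ cr : V → List Unit,
    runActs (vs.map pushCr) (g, stks (S := S) l r t cl cr) =
      (g, stks l r t cl fun v => if v ∈ vs then () :: cr v else cr v) := by
  induction vs with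
  | nil => intro cr; simp [runActs]
  | cons v vs ih =>
    intro cr
    have h := ih (List.nodup_cons.1 hvs).2 (Function.update cr v (() :: cr v))
    simp only [runActs, List.map_cons, List.foldl_cons, run_pushCr] at h ⊢
    rw [h]
    congr 2
    funext u
    have hv := (List.nodup_cons.1 hvs).1
    by_cases hu : u = v
    · subst hu; simp [hv]
    · simp [hu]

omit [DecidableEq V] [Fintype V] [Inhabited S] [Inhabited Q] [Inhabited C] in
-- `stks` has an empty input stack; this lemma lets the facts about `stks` be used while input is
-- still left.
theorem runActs_push_update {K : Type} [DecidableEq K] {Γ : K → Type} {ρ : Type} (k : K)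
    (w : List (Γ k)) (l : List (Act K Γ ρ)) (hl : ∀ a ∈ l, ∃ k' f, k' ≠ k ∧ a = .push k' f) :
    ∀ s : ρ × (∀ k, List (Γ k)), runActs l (s.1, Function.update s.2 k w) =
      ((runActs l s).1, Function.update (runActs l s).2 k w) := by
  induction l with
  | nil => exact fun s => rfl
  | cons a l ih =>
    intro s
    obtain ⟨k', f, hk, rfl⟩ := hl a (by simp)
    have h := ih (fun a ha => hl a (List.mem_cons_of_mem _ ha)) ((Act.push k' f).run s)
    simp only [runActs, List.foldl_cons, Act.run] at h ⊢
    rw [← h, Function.update_of_ne hk, Function.update_comm hk]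

/-- Each letter read adds one unit to `cr v` for every pointer, so that at the end all pointers
stand at 0 with complement the length of the word. The tape appears reversed on `left` and is put
right by rewinding. -/
theorem runsIn_loadCmd (δ : Q → S → Q) (w : List S) : ∀ (g : MReg σ ((S × Q) × C) Q)
    (l : List ((S × Q) × C)) (n : ℕ),
    ∃ g' : MReg σ ((S × Q) × C) Q, g'.v = g.v ∧ g'.q = w.foldl δ g.q ∧
      RunsIn (loadCmd δ)
      (g, Function.update (stks l [] [] (fun _ : V => []) fun _ => List.replicate n ()) .inp w)
      (g', stks (((tag δ g.q w).map fun a => (a, default)).reverse ++ l) [] [] (fun _ => [])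
        fun _ => List.replicate (n + w.length) ()) (3 * w.length + 2) := by
  induction w with
  | nil =>
    intro g l n
    refine ⟨{ g with buf := none }, rfl, rfl, (RunsIn.drain_nil ?_ rfl).mono (by simp)⟩
    refine Prod.ext rfl ?_
    funext k
    cases k <;> rfl
  | cons a w ih =>
    intro g l n
    obtain ⟨g', hg', hq', h⟩ := ih { g with buf := some ((a, δ g.q a), default), q := δ g.q a }
      (((a, δ g.q a), default) :: l) (n + 1)
    have e : n + 1 + w.length = n + (a :: w).length := by simp; omega
    rw [e] at h
    refine ⟨g', hg', hq', ?_⟩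
    simp only [tag, List.map_cons, List.reverse_cons, List.append_assoc, List.singleton_append]
    refine (RunsIn.drain_cons (T₁ := 1)
      (s₁ := ({ g with buf := some ((a, δ g.q a), default), q := δ g.q a },
        Function.update (stks l [] [] (fun _ : V => []) fun _ => List.replicate n ()) .inp w))
      ?_ rfl (.act ?_) h).mono (by simp; omega)
    · refine Prod.ext rfl (Function.update_idem ..)
    · refine (runActs_push_update _ _ _ ?_
        (({ g with buf := some ((a, δ g.q a), default), q := δ g.q a } : MReg σ ((S × Q) × C) Q),
        stks l [] [] (fun _ : V => []) fun _ => List.replicate n ())).trans ?_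
      · intro b hb
        rcases List.mem_cons.1 hb with rfl | hb
        · exact ⟨.left, _, by simp, rfl⟩
        · obtain ⟨v, -, rfl⟩ := List.mem_map.1 hb
          exact ⟨.cr v, _, by simp, rfl⟩
      · have h' := runActs_pushCr (S := S) (((a, δ g.q a), default) :: l) [] [] (fun _ => [])
          ({ g with buf := some ((a, δ g.q a), default), q := δ g.q a } : MReg σ ((S × Q) × C) Q)
          (Finset.univ.toList (α := V)) (Finset.nodup_toList _) fun _ => List.replicate n ()
        have h'' : runActs (pushL (fun g => g.buf.getD default) ::
            (Finset.univ.toList (α := V)).map pushCr)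
            (({ g with buf := some ((a, δ g.q a), default), q := δ g.q a } :
              MReg σ ((S × Q) × C) Q), stks (S := S) l [] [] (fun _ : V => [])
                fun _ => List.replicate n ()) =
            ({ g with buf := some ((a, δ g.q a), default), q := δ g.q a },
              stks (((a, δ g.q a), default) :: l) [] [] (fun _ : V => [])
                fun _ => List.replicate (n + 1) ()) := by
          simp only [runActs, List.foldl_cons, run_pushL, Option.getD_some] at h' ⊢
          rw [h']
          simp [List.replicate_succ]
        exact congrArg (fun r => (r.1, Function.update r.2 .inp w)) h''

omit [Inhabited Q] in
theorem inP_of_prog [Fintype S] [Fintype Q] [Fintype σ] [Fintype C] (δ : Q → S → Q) (q₀ : Q)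
    (init : Q → σ) (P : Prog (S × Q) C σ V) (hP : P.WF) (out : σ → Bool) (L : Language S)
    (hL : ∀ w, w ∈ L ↔
      out (P.eval (tag δ q₀ w) ⟨init (w.foldl δ q₀), fun _ => 0, fun _ => default⟩).v = true) :
    InP L := by
  classical
  have : Inhabited Q := ⟨q₀⟩
  -- A halting configuration must have all stacks except the output empty and the register at its
  -- initial value, hence the clean-up after the answer has been pushed.
  let fin : MCmd S ((S × Q) × C) V σ Q :=
    .seq (.act [.push .out fun g => (out g.v : Bool)])
      (.seq (.clearAll (fun g x => { g with flag := x }) (·.flag)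
        ((Finset.univ.toList (α := Stk V)).filter fun k => k ≠ Stk.out))
        (.act [.load fun _ => ⟨init q₀, none, false, q₀⟩]))
  let c : MCmd S ((S × Q) × C) V σ Q := .seq (loadCmd δ)
    (.seq rewindCmd (.seq (.act [.load fun g => { g with v := init g.q }]) (.seq P.cmd fin)))
  let N : ℕ := Fintype.card (Stk V)
  refine inP_of_runs (S := S) (K := Stk V) .inp .out (by simp) (StkAlph S ((S × Q) × C) V) (Equiv.refl S)
    (Equiv.refl Bool) (⟨init q₀, none, false, q₀⟩ : MReg σ ((S × Q) × C) Q) c L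
    ((3 * Polynomial.X + 2) + ((3 * Polynomial.X + 2) + (1 + (P.time + (1 +
      (Polynomial.C N * (3 * (Polynomial.X + 1) + 2) + 1 + 1)))))) fun w => ?_
  obtain ⟨g₁, hg₁, hq₁, h₁⟩ := runsIn_loadCmd (V := V) (C := C) δ w
    ⟨init q₀, none, false, q₀⟩ [] 0
  obtain ⟨g₂, hg₂, hq₂, h₂⟩ := runsIn_rewindCmd (S := S) [] (fun _ : V => [])
    (fun _ => List.replicate (0 + w.length) ())
    (((tag δ q₀ w).map fun a => (a, (default : C))).reverse ++ []) g₁ []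
  obtain ⟨g₃, hg₃, h₃⟩ := runsIn_cmd (S := S) (tag δ q₀ w) P hP
    ⟨init (w.foldl δ q₀), fun _ => 0, fun _ => default⟩ (by simp) { g₂ with v := init g₂.q }
    (by simp [hq₂, hq₁])
  have hle := P.eval_le (tag δ q₀ w) hP ⟨init (w.foldl δ q₀), fun _ => 0, fun _ => default⟩
    (by simp)
  set s := P.eval (tag δ q₀ w) ⟨init (w.foldl δ q₀), fun _ => 0, fun _ => default⟩ with hs
  -- The tape and the pointer stacks have height at most `w.length`; the summand 1 is for the answer
  -- on the output stack.
  obtain ⟨g₄, h₄⟩ := runsIn_clearAll (Γ := StkAlph S ((S × Q) × C) V)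
    (fun (g : MReg σ ((S × Q) × C) Q) x => { g with flag := x }) (·.flag) (fun _ _ => rfl)
    (w.length + 1) ((Finset.univ.toList (α := Stk V)).filter fun k => k ≠ Stk.out)
    (g₃, Function.update (phys (tag δ q₀ w) s) .out [out g₃.v]) (by
      intro k
      have : ∀ v, s.p v ≤ w.length := by simpa using hle
      cases k with
      | cl v => exact (List.length_replicate ..).le.trans ((this v).trans (Nat.le_succ _))
      | cr v => exact (List.length_replicate ..).le.trans (by simp; omega)
      | out => exact Nat.le_add_left 1 _
      | right => exact (length_tape _ _).le.trans (by simp)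
      | _ => exact Nat.zero_le _)
  refine RunsIn.mono (T := (3 * w.length + 2) + ((3 * w.length + 2) + (1 + (P.time.eval w.length +
    (1 + ((N * (3 * (w.length + 1) + 2) + 1) + 1)))))) ?_ (by simp)
  have e₁ : (Function.update (fun _ => []) Stk.inp (w.map (Equiv.refl S).symm) :
      ∀ k, List (StkAlph S ((S × Q) × C) V k)) =
      Function.update (stks [] [] [] (fun _ => []) fun _ => List.replicate 0 ()) .inp w := by
    funext k
    cases k <;> first | rfl | exact List.map_id w
  have e₂ : (tag δ q₀ w).map (fun a => (a, (default : C))) =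
      tape (tag δ q₀ w) fun _ => default :=
    List.ext_getElem? fun i => by simp
  have h₂' : RunsIn (rewindCmd (S := S)) (g₁, stks (((tag δ q₀ w).map
      fun a => (a, (default : C))).reverse ++ []) [] [] (fun _ => [])
        fun _ : V => List.replicate (0 + w.length) ())
      (g₂, phys (tag δ q₀ w) ⟨init (w.foldl δ q₀), fun _ => 0, fun _ => default⟩)
      (3 * w.length + 2) := by
    have : phys (S := S) (tag δ q₀ w) (⟨init (w.foldl δ q₀), fun _ => 0, fun _ => default⟩ :
        PState C σ V) = stks [] (((tag δ q₀ w).map fun a => (a, (default : C))).reverse ++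
          []).reverse [] (fun _ => []) fun _ => List.replicate (0 + w.length) () := by
      simp [phys, e₂]
    rw [this]
    simpa using h₂
  have h₅ : RunsIn (.act [.push .out fun g => (out g.v : Bool)]) (g₃, phys (S := S) (tag δ q₀ w) s)
      (g₃, Function.update (phys (tag δ q₀ w) s) .out [out g₃.v]) 1 := .act rfl
  have e₃ : decide (w ∈ L) = out g₃.v := by
    rw [hg₃, hs]
    exact Bool.eq_iff_iff.2 (decide_eq_true_iff.trans (hL w))
  refine RunsIn.congr (r' := (_, _)) (h₁.seq (h₂'.seq (RunsIn.seq (.act rfl) (RunsIn.seq (T₁ := P.time.eval w.length)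
    (by rwa [length_tag] at h₃) (h₅.seq (RunsIn.seq (h₄.mono ?_) (.act rfl))))))) (Prod.ext rfl e₁.symm) ?_
  · gcongr
    refine (List.length_filter_le _ _).trans ?_
    simp [N]
  · refine Prod.ext rfl ?_
    funext k
    by_cases hk : k = .out
    · subst hk
      simp only [runActs, Act.run, e₃, List.foldl_cons, List.foldl_nil]
      simp
      rfl
    · simp [runActs, Act.run, hk]

end Load

/-! ### The automaton checking the format of an instance -/

/-- The states of the automaton: the role of the letter just read. `pr b`, `dp b r`, `dsep b` and
`dq b` are inside the atom of the formula, with `b` telling whether it is negated and `r` how many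
names of the dependence atom have begun. -/
inductive Tag (k : ℕ)
  | dead | init | world | team | row | lab | form | ng
  | pr (b : Bool)
  | dp (b : Bool) (r : Fin (k + 1))
  | dsep (b : Bool)
  | dq (b : Bool)
  deriving DecidableEq, Fintype

instance : Inhabited Sym := ⟨.sep⟩

open Classical in
/-- The transition function of the automaton. -/
noncomputable def next (k : ℕ) (M : Set Op) : Tag k → Sym → Tag k
  | .init, .world => .world
  | .world, .bit _ => .team
  | .team, .bit _ => .row
  | .team, .name => .lab
  | .team, .world => .world
  | .team, .sep => .form
  | .row, .bit _ => .row
  | .row, .name => .lab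
  | .row, .world => .world
  | .row, .sep => .form
  | .lab, .bit _ => .lab
  | .lab, .name => .lab
  | .lab, .world => .world
  | .lab, .sep => .form
  | .form, .ax => if Op.ax ∈ M then .form else .dead
  | .form, .ex => if Op.ex ∈ M then .form else .dead
  | .form, .neg => if Op.neg ∈ M then .ng else .dead
  | .form, .name => .pr false
  | .form, .dep => if Op.dep ∈ M then .dp false 0 else .dead
  | .ng, .name => .pr true
  | .ng, .dep => if Op.dep ∈ M then .dp true 0 else .dead
  | .pr b, .bit _ => .pr b
  | .dp b r, .bit _ => if r = 0 then .dead else .dp b r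
  | .dp b r, .name => if h : r.1 + 1 < k + 1 then .dp b ⟨r.1 + 1, h⟩ else .dead
  | .dp b _, .sep => .dsep b
  | .dsep b, .name => .dq b
  | .dq b, .bit _ => .dq b
  | _, _ => .dead

/-- The accepting states. -/
def Tag.accept {k : ℕ} : Tag k → Bool
  | .pr _ => true
  | .dq _ => true
  | _ => false

/-- The contents of a world record: team bit, row of the adjacency matrix, labels. -/
abbrev Rec := Bool × List Bool × List Name

/-- The record of a world as a string. -/
def encRec (r : Rec) : List Sym :=
  Sym.world :: Sym.bit r.1 :: (r.2.1.map Sym.bit ++ r.2.2.flatMap encName)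

/-- The string consisting of records and a formula. -/
def encRaw (recs : List Rec) (φ : Formula Name) : List Sym :=
  recs.flatMap encRec ++ Sym.sep :: encFormula φ

/-- The words leading from a state to acceptance. -/
def Acc (k : ℕ) (M : Set Op) : Tag k → List Sym → Prop
  | .dead, _ => False
  | .init, w => ∃ recs φ, recs ≠ [] ∧ φ ∈ boundedFragment Name k M ∧ w = encRaw recs φ
  | .world, w => ∃ (b : Bool) (row : List Bool) (ls : List Name) (recs : List Rec) (φ : _),
      φ ∈ boundedFragment Name k M ∧
      w = Sym.bit b :: (row.map Sym.bit ++ (ls.flatMap encName ++ encRaw recs φ))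
  | .team, w | .row, w | .lab, w => ∃ (row : List Bool) (ls : List Name) (recs : List Rec) (φ : _),
      φ ∈ boundedFragment Name k M ∧
      w = row.map Sym.bit ++ (ls.flatMap encName ++ encRaw recs φ)
  | .form, w => ∃ φ ∈ boundedFragment Name k M, w = encFormula φ
  | .ng, w => ∃ φ, (Op.neg ∈ M → φ ∈ boundedFragment Name k M) ∧ Sym.neg :: w = encFormula φ
  | .pr _, w | .dq _, w => ∃ p : Name, w = p.map Sym.bit
  | .dp _ r, w => ∃ (p : Name) (ps : List Name) (q : Name), r.1 + ps.length ≤ k ∧ (r = 0 → p = []) ∧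
      w = p.map Sym.bit ++ (ps.flatMap encName ++ Sym.sep :: encName q)
  | .dsep _, w => ∃ q : Name, w = encName q

/-- `Acc` describes the residual languages, and the induction checks that each is closed under the
transitions read backwards. In state `ng` the automaton has forgotten that negation is allowed, so
membership in the fragment is conditional there and is discharged at the letter `neg`. Only this
direction is needed; that encodings are accepted comes from `tag_encFormula`. -/
theorem acc_of_accept (k : ℕ) (M : Set Op) (w : List Sym) :
    ∀ q : Tag k, (w.foldl (next k M) q).accept = true → Acc k M q w := by
  induction w with
  | nil =>
    intro q hq
    cases q <;> simp [Tag.accept] at hq <;> exact ⟨[], rfl⟩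
  | cons a w ih =>
    intro q hq
    have h := ih _ hq
    clear ih hq
    -- The states `team`, `row` and `lab` have the same residual language: the list `row` absorbs
    -- all leading bits, whether they continue a row or a label.
    have mid : ∀ q', (q' = .lab ∨ q' = .row ∨ q' = .team) → (∀ b, a = .bit b → Acc k M .lab w) →
        (a = .name → Acc k M .lab w) → (a = .world → Acc k M .world w) →
        (a = .sep → Acc k M .form w) → ((∃ b, a = .bit b) ∨ a = .name ∨ a = .world ∨ a = .sep) →
        Acc k M q' (a :: w) := by
      intro q' hq' h₁ h₂ h₃ h₄ h₅
      have : Acc k M .lab (a :: w) := by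
        rcases h₅ with ⟨b, rfl⟩ | rfl | rfl | rfl
        · obtain ⟨row, ls, recs, φ, hφ, rfl⟩ := h₁ b rfl
          exact ⟨b :: row, ls, recs, φ, hφ, by simp⟩
        · obtain ⟨p, ls, recs, φ, hφ, rfl⟩ := h₂ rfl
          exact ⟨[], p :: ls, recs, φ, hφ, by simp [encName]⟩
        · obtain ⟨b, row, ls, recs, φ, hφ, rfl⟩ := h₃ rfl
          exact ⟨[], [], (b, row, ls) :: recs, φ, hφ, by simp [encRaw, encRec]⟩
        · obtain ⟨φ, hφ, rfl⟩ := h₄ rfl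
          exact ⟨[], [], [], φ, hφ, by simp [encRaw]⟩
      rcases hq' with rfl | rfl | rfl <;> exact this
    cases q with
    | dead => cases a <;> exact h
    | init =>
      cases a with
      | world =>
        obtain ⟨b, row, ls, recs, φ, hφ, rfl⟩ := h
        exact ⟨(b, row, ls) :: recs, φ, by simp, hφ, by simp [encRaw, encRec]⟩
      | _ => exact h.elim
    | world =>
      cases a with
      | bit b =>
        obtain ⟨row, ls, recs, φ, hφ, rfl⟩ := h
        exact ⟨b, row, ls, recs, φ, hφ, rfl⟩
      | _ => exact h.elim
    | team | row | lab =>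
      cases a with
      | bit | name | world | sep =>
        exact mid _ (by simp) (by first | exact fun _ _ => h | exact nofun)
          (by first | exact fun _ => h | exact nofun) (by first | exact fun _ => h | exact nofun)
          (by first | exact fun _ => h | exact nofun) (by simp)
      | _ => exact h.elim
    | form =>
      cases a with
      | ax =>
        by_cases hM : Op.ax ∈ M <;> simp only [next, hM, if_true, if_false] at h
        · obtain ⟨φ, hφ, rfl⟩ := h
          exact ⟨.ax φ, ⟨hφ.1, hM, hφ.2⟩, rfl⟩
        · exact h.elim
      | ex =>
        by_cases hM : Op.ex ∈ M <;> simp only [next, hM, if_true, if_false] at h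
        · obtain ⟨φ, hφ, rfl⟩ := h
          exact ⟨.ex φ, ⟨hφ.1, hM, hφ.2⟩, rfl⟩
        · exact h.elim
      | neg =>
        by_cases hM : Op.neg ∈ M <;> simp only [next, hM, if_true, if_false] at h
        · obtain ⟨φ, hφ, h⟩ := h
          exact ⟨φ, hφ hM, h⟩
        · exact h.elim
      | name =>
        obtain ⟨p, rfl⟩ := h
        exact ⟨.prop p, ⟨trivial, trivial⟩, rfl⟩
      | dep =>
        by_cases hM : Op.dep ∈ M <;> simp only [next, hM, if_true, if_false] at h
        · obtain ⟨p, ps, q, hps, hp, rfl⟩ := h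
          refine ⟨.dep ps q, ⟨by simpa [Formula.ArityLE] using hps, hM⟩, ?_⟩
          simp [hp rfl, encFormula]
        · exact h.elim
      | _ => exact h.elim
    | ng =>
      cases a with
      | name =>
        obtain ⟨p, rfl⟩ := h
        exact ⟨.negProp p, fun hM => ⟨trivial, hM⟩, rfl⟩
      | dep =>
        by_cases hM : Op.dep ∈ M <;> simp only [next, hM, if_true, if_false] at h
        · obtain ⟨p, ps, q, hps, hp, rfl⟩ := h
          refine ⟨.negDep ps q, fun hn => ⟨by simpa [Formula.ArityLE] using hps, hn, hM⟩, ?_⟩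
          simp [hp rfl, encFormula]
        · exact h.elim
      | _ => exact h.elim
    | pr b | dq b =>
      cases a with
      | bit b =>
        obtain ⟨p, rfl⟩ := h
        exact ⟨b :: p, rfl⟩
      | _ => exact h.elim
    | dp b r =>
      cases a with
      | bit c =>
        by_cases hr : r = 0 <;> simp only [next, hr, if_true, if_false] at h
        · exact h.elim
        · obtain ⟨p, ps, q, hps, hp, rfl⟩ := h
          exact ⟨c :: p, ps, q, hps, fun h => (hr h).elim, rfl⟩
      | name =>
        by_cases hr : r.1 + 1 < k + 1 <;> simp only [next, hr, dif_pos, dif_neg, not_false_iff] at h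
        · obtain ⟨p, ps, q, hps, hp, rfl⟩ := h
          refine ⟨[], p :: ps, q, ?_, fun _ => rfl, by simp [encName]⟩
          simp only [List.length_cons] at hps ⊢
          omega
        · exact h.elim
      | sep =>
        obtain ⟨q, rfl⟩ := h
        exact ⟨[], [], q, by simpa using Nat.lt_succ_iff.1 r.2, fun _ => rfl, rfl⟩
      | _ => exact h.elim
    | dsep b =>
      cases a with
      | name =>
        obtain ⟨p, rfl⟩ := h
        exact ⟨p, rfl⟩
      | _ => exact h.elim

/-! ### The tagged form of an instance -/

section Tags

variable {k : ℕ} {M : Set Op}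

theorem tag_append {S Q : Type} (δ : Q → S → Q) (q : Q) (u v : List S) :
    tag δ q (u ++ v) = tag δ q u ++ tag δ (u.foldl δ q) v := by
  induction u generalizing q with
  | nil => rfl
  | cons a u ih => simp [tag, ih]

theorem map_fst_tag {S Q : Type} (δ : Q → S → Q) (q : Q) (u : List S) :
    (tag δ q u).map Prod.fst = u := by
  induction u generalizing q with
  | nil => rfl
  | cons a u ih => simp [tag, ih]

theorem foldl_bits {x : Tag k} (hx : ∀ b, next k M x (.bit b) = x) (p : List Bool) :
    (p.map Sym.bit).foldl (next k M) x = x := by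
  induction p with
  | nil => rfl
  | cons b p ih => simpa [hx] using ih

theorem tag_bits {x : Tag k} (hx : ∀ b, next k M x (.bit b) = x) (p : List Bool) :
    tag (next k M) x (p.map Sym.bit) = p.map fun b => (Sym.bit b, x) := by
  induction p with
  | nil => rfl
  | cons b p ih => simp [tag, hx, ih]

/-- The states in which a record may end. -/
def Tag.Mid (x : Tag k) : Prop := x = .team ∨ x = .row ∨ x = .lab

/-- A tagged label. -/
def tLabel (k : ℕ) (p : Name) : List (Sym × Tag k) :=
  (.name, .lab) :: p.map fun b => (.bit b, .lab)

/-- The tagged record of a world. -/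
def tRec (k : ℕ) (r : Rec) : List (Sym × Tag k) :=
  (.world, .world) :: (.bit r.1, .team) ::
    (r.2.1.map (fun b => (.bit b, .row)) ++ r.2.2.flatMap (tLabel k))

theorem tag_labels (ls : List Name) : ∀ {x : Tag k}, x.Mid →
    tag (next k M) x (ls.flatMap encName) = ls.flatMap (tLabel k) ∧
      ((ls.flatMap encName).foldl (next k M) x).Mid := by
  induction ls with
  | nil => exact fun hx => ⟨rfl, hx⟩
  | cons p ls ih =>
    intro x hx
    have h : next k M x .name = .lab := by rcases hx with rfl | rfl | rfl <;> rfl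
    have hb : ∀ b, next k M .lab (.bit b) = .lab := fun _ => rfl
    have ih' := ih (x := .lab) (.inr (.inr rfl))
    constructor
    · simp [encName, tag, tag_append, h, tag_bits hb, foldl_bits hb, ih'.1, tLabel]
    · simpa [encName, h, foldl_bits hb] using ih'.2

theorem tag_row (row : List Bool) : ∀ {x : Tag k}, x = .team ∨ x = .row →
    tag (next k M) x (row.map Sym.bit) = row.map (fun b => (.bit b, .row)) ∧
      ((row.map Sym.bit).foldl (next k M) x).Mid := by
  have hb : ∀ b, next k M .row (.bit b) = .row := fun _ => rfl
  cases row with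
  | nil => exact fun {x} hx => ⟨rfl, by rcases hx with rfl | rfl <;> simp [Tag.Mid]⟩
  | cons b row =>
    intro x hx
    have h : next k M x (.bit b) = .row := by rcases hx with rfl | rfl <;> rfl
    exact ⟨by simp [tag, h, tag_bits hb], by simp [h, foldl_bits hb, Tag.Mid]⟩

theorem tag_encRec (r : Rec) {x : Tag k} (hx : x = .init ∨ x.Mid) :
    tag (next k M) x (encRec r) = tRec k r ∧ ((encRec r).foldl (next k M) x).Mid := by
  have h : next k M x .world = .world := by rcases hx with rfl | rfl | rfl | rfl <;> rfl
  have h' : next k M .world (.bit r.1) = .team := rfl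
  obtain ⟨h₁, h₂⟩ := tag_row (k := k) (M := M) r.2.1 (.inl rfl)
  obtain ⟨h₃, h₄⟩ := tag_labels (k := k) (M := M) r.2.2 h₂
  exact ⟨by simp only [encRec, tag, h, h', tag_append, h₁, h₃, tRec],
    by simpa only [encRec, List.foldl_cons, h, h', List.foldl_append] using h₄⟩

/-- The side condition excludes the one case in which the automaton is still in `init`: no record
read at all. -/
theorem tag_encRecs (recs : List Rec) : ∀ {x : Tag k}, x = .init ∨ x.Mid →
    tag (next k M) x (recs.flatMap encRec) = recs.flatMap (tRec k) ∧
      (recs ≠ [] ∨ x.Mid → ((recs.flatMap encRec).foldl (next k M) x).Mid) := by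
  induction recs with
  | nil => exact fun hx => ⟨rfl, by simp⟩
  | cons r recs ih =>
    intro x hx
    obtain ⟨h₁, h₂⟩ := tag_encRec (M := M) r hx
    obtain ⟨h₃, h₄⟩ := ih (.inr h₂)
    exact ⟨by simp only [List.flatMap_cons, tag_append, h₁, h₃],
      fun _ => by simpa only [List.flatMap_cons, List.foldl_append] using h₄ (.inr h₂)⟩

/-- The tags of the records depend neither on `M` nor on what follows, so the tagged word has the
explicit shape `tRec` for each record, to which the folds are applied later. -/
theorem tag_encRaw (recs : List Rec) (hr : recs ≠ []) (φ : Formula Name) :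
    tag (next k M) .init (encRaw recs φ) =
        recs.flatMap (tRec k) ++ (.sep, .form) :: tag (next k M) .form (encFormula φ) ∧
      (encRaw recs φ).foldl (next k M) .init = (encFormula φ).foldl (next k M) .form := by
  obtain ⟨h₁, h₂⟩ := tag_encRecs (k := k) (M := M) recs (.inl rfl)
  have h : next k M ((recs.flatMap encRec).foldl (next k M) .init) .sep = .form := by
    rcases h₂ (.inl hr) with h | h | h <;> rw [h] <;> rfl
  exact ⟨by simp only [encRaw, tag_append, h₁, tag, h],
    by simp only [encRaw, List.foldl_append, List.foldl_cons, h]⟩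

/-- The states in the formula. -/
def Tag.InFormula : Tag k → Prop
  | .init | .world | .team | .row | .lab => False
  | _ => True

/-- Record tags never return once the formula has begun. Hence passes that react only to record tags
leave their state unchanged on the rest of the word. -/
theorem inFormula_tag (w : List Sym) : ∀ {x : Tag k}, x.InFormula →
    ∀ a ∈ tag (next k M) x w, a.2.InFormula := by
  induction w with
  | nil => intro x _ a ha; simp [tag] at ha
  | cons c w ih =>
    intro x hx a ha
    have h : (next k M x c).InFormula := by
      cases x <;> first | exact hx.elim | (cases c <;> simp only [next] <;> (try split) <;> trivial)
    rcases List.mem_cons.1 ha with rfl | ha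
    · exact h
    · exact ih h a ha

/-- The name following a position. -/
def nameOf : List (Sym × Tag k) → Name
  | (.bit b, _) :: l => b :: nameOf l
  | _ => []

theorem nameOf_bits (x : Tag k) (p : Name) (l : List (Sym × Tag k)) (hl : nameOf l = []) :
    nameOf (p.map (fun b => (Sym.bit b, x)) ++ l) = p := by
  induction p with
  | nil => simpa using hl
  | cons b p ih => simp [nameOf, ih]

/-- If the letter begins a name in the formula, the index of that name: `some r` for the `r`-th
name determining, `none` for the last name. -/
def nameIdx : Sym × Tag k → Option (Option (Fin k))
  | (.name, .pr _) => some none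
  | (.name, .dq _) => some none
  | (.name, .dp _ r) => if h : r = 0 then none else some (some (r.pred h))
  | _ => none

/-- The names in the formula with their indices. -/
def names : List (Sym × Tag k) → List (Option (Fin k) × Name)
  | [] => []
  | a :: l => ((nameIdx a).map fun i => (i, nameOf l)).toList ++ names l

theorem names_bits (x : Tag k) (p : Name) (l : List (Sym × Tag k)) :
    names (p.map (fun b => (Sym.bit b, x)) ++ l) = names l := by
  induction p with
  | nil => rfl
  | cons b p ih => simp [names, ih, nameIdx]

/-- The name with a given index in the atom of a formula. -/
def Formula.nameAt (k : ℕ) : Formula Name → Option (Fin k) → Option Name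
  | .prop q, none => some q
  | .negProp q, none => some q
  | .dep _ q, none => some q
  | .negDep _ q, none => some q
  | .dep ps _, some r => ps[r.1]?
  | .negDep ps _, some r => ps[r.1]?
  | .ax φ, i => φ.nameAt k i
  | .ex φ, i => φ.nameAt k i
  | _, _ => none

/-- The final state of the automaton after a formula. -/
def Formula.kind (k : ℕ) : Formula Name → Tag k
  | .prop _ => .pr false
  | .negProp _ => .pr true
  | .dep _ _ => .dq false
  | .negDep _ _ => .dq true
  | .ax φ => φ.kind k
  | .ex φ => φ.kind k
  | _ => .dead

/-- The state `dp b r` counts the names already begun, so entry `j` of the full list is entry `j -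
r` of the names still to come. The middle statement, that no bit comes first, ensures that the bits
of the preceding name end where this word starts. -/
theorem tag_dep (b : Bool) (q : Name) (ps : List Name) : ∀ (r : Fin (k + 1)),
    r.1 + ps.length ≤ k →
    (ps.flatMap encName ++ Sym.sep :: encName q).foldl (next k M) (.dp b r) = .dq b ∧
    nameOf (tag (next k M) (.dp b r) (ps.flatMap encName ++ Sym.sep :: encName q)) = [] ∧
    ∀ i p, (i, p) ∈ names (tag (next k M) (.dp b r) (ps.flatMap encName ++ Sym.sep :: encName q)) ↔
      (i = none ∧ p = q) ∨ ∃ j : Fin k, i = some j ∧ r.1 ≤ j.1 ∧ ps[j.1 - r.1]? = some p := by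
  have hb : ∀ c, next k M (.dq b) (.bit c) = .dq b := fun _ => rfl
  have h₁ : ∀ r : Fin (k + 1), next k M (.dp b r) .sep = .dsep b := fun _ => rfl
  have h₂ : next k M (.dsep b) .name = .dq b := rfl
  induction ps with
  | nil =>
    intro r hr
    refine ⟨by simp [encName, h₁, h₂, foldl_bits hb], by simp [tag, nameOf], fun i p => ?_⟩
    have h := names_bits (.dq b) q ([] : List (Sym × Tag k))
    have h' := nameOf_bits (.dq b) q ([] : List (Sym × Tag k)) rfl
    rw [List.append_nil] at h h'
    simp [tag, encName, h₁, h₂, tag_bits hb, names, nameIdx, h, h']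
  | cons p₀ ps ih =>
    intro r hr
    rw [List.length_cons] at hr
    have hr' : r.1 + 1 < k + 1 := by omega
    have h₃ : next k M (.dp b r) .name = .dp b ⟨r.1 + 1, hr'⟩ := by simp [next, hr']
    -- Bits are rejected in `dp b 0`, where no name has begun; with a positive count the state is
    -- stable under bits.
    have hne : (⟨r.1 + 1, hr'⟩ : Fin (k + 1)) ≠ 0 := fun h => by simpa using congrArg Fin.val h
    have hb' : ∀ c, next k M (.dp b ⟨r.1 + 1, hr'⟩) (.bit c) = .dp b ⟨r.1 + 1, hr'⟩ := by
      intro c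
      simp only [next, hne, if_false]
    obtain ⟨i₁, i₂, i₃⟩ := ih ⟨r.1 + 1, hr'⟩ (by simp only; omega)
    refine ⟨?_, ?_, ?_⟩
    · simpa [encName, h₃, foldl_bits hb'] using i₁
    · simp [encName, tag, nameOf]
    · intro i p
      have e : tag (next k M) (.dp b r) ((p₀ :: ps).flatMap encName ++ Sym.sep :: encName q) =
          (.name, .dp b ⟨r.1 + 1, hr'⟩) :: (p₀.map (fun c => (.bit c, .dp b ⟨r.1 + 1, hr'⟩)) ++
            tag (next k M) (.dp b ⟨r.1 + 1, hr'⟩)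
              (ps.flatMap encName ++ Sym.sep :: encName q)) := by
        rw [List.flatMap_cons, encName, List.cons_append, List.cons_append, tag, h₃,
          List.append_assoc, tag_append, tag_bits hb', foldl_bits hb']
      have h₀ : nameIdx ((.name, .dp b ⟨r.1 + 1, hr'⟩) : Sym × Tag k) =
          some (some ⟨r.1, by omega⟩) := by
        simp only [nameIdx, hne, dif_neg, not_false_iff]
        rfl
      rw [e, names, h₀, names_bits, nameOf_bits _ _ _ i₂, List.mem_append, i₃]
      constructor
      · rintro (h | h | ⟨j, rfl, hj, h⟩)
        · simp only [Option.map_some, Option.toList_some, List.mem_singleton, Prod.mk.injEq] at h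
          exact .inr ⟨_, h.1, le_rfl, by simp [h.2]⟩
        · exact .inl h
        · simp only at hj h
          refine .inr ⟨j, rfl, by omega, ?_⟩
          rw [show j.1 - r.1 = j.1 - (r.1 + 1) + 1 by omega, List.getElem?_cons_succ, h]
      · rintro (h | ⟨j, rfl, hj, h⟩)
        · exact .inr (.inl h)
        · rcases hj.eq_or_lt with hj' | hj'
          · rw [← hj', Nat.sub_self, List.getElem?_cons_zero] at h
            refine .inl ?_
            simp [hj', Option.some.inj h]
          · refine .inr (.inr ⟨j, rfl, hj', ?_⟩)
            rw [show j.1 - r.1 = j.1 - (r.1 + 1) + 1 by omega, List.getElem?_cons_succ] at h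
            exact h

/-- The inclusion `hM` excludes constants and binary connectives, so there is exactly one atom. The
final state determines its kind, and `names` lists its propositions with their argument positions;
the modalities in front contribute nothing. -/
theorem tag_encFormula (hM : M ⊆ {Op.ax, Op.ex, Op.neg, Op.dep}) (φ : Formula Name)
    (hφ : φ ∈ boundedFragment Name k M) :
    (encFormula φ).foldl (next k M) .form = φ.kind k ∧ (φ.kind k).accept = true ∧
    ∀ i p, (i, p) ∈ names (tag (next k M) .form (encFormula φ)) ↔ φ.nameAt k i = some p := by
  have atom : ∀ (b : Bool) (q : Name) (i : Option (Fin k)) (p : Name), (i, p) ∈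
      names (((.name, .pr b) : Sym × Tag k) :: q.map fun c => (Sym.bit c, .pr b)) ↔
        i = none ∧ p = q := by
    intro b q i p
    have h := names_bits (.pr b) q ([] : List (Sym × Tag k))
    have h' := nameOf_bits (.pr b) q ([] : List (Sym × Tag k)) rfl
    rw [List.append_nil] at h h'
    simp [names, nameIdx, h, h']
  have hb : ∀ (b : Bool) c, next k M (.pr b) (.bit c) = .pr b := fun _ _ => rfl
  induction φ with
  | top => simpa using hM hφ.2
  | bot => simpa using hM hφ.2
  | or φ ψ => simpa using hM hφ.2.1
  | cor φ ψ => simpa using hM hφ.2.1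
  | and φ ψ => simpa using hM hφ.2.1
  | prop q =>
    have h : next k M .form .name = .pr false := rfl
    refine ⟨by simp [encFormula, encName, h, foldl_bits (hb _), Formula.kind], rfl, fun i p => ?_⟩
    rw [encFormula, encName, tag, h, tag_bits (hb _), atom]
    cases i <;> simp [Formula.nameAt, eq_comm]
  | negProp q =>
    have h : next k M .form .neg = .ng := if_pos hφ.2
    have h' : next k M .ng .name = .pr true := rfl
    refine ⟨by simp [encFormula, encName, h, h', foldl_bits (hb _), Formula.kind], rfl,
      fun i p => ?_⟩
    rw [encFormula, encName, tag, h, tag, h', tag_bits (hb _), names, List.mem_append, atom]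
    cases i <;> simp [Formula.nameAt, eq_comm, nameIdx]
  | ax φ ih =>
    have h : next k M .form .ax = .form := if_pos hφ.2.1
    obtain ⟨h₁, h₂, h₃⟩ := ih ⟨hφ.1, hφ.2.2⟩
    exact ⟨by simpa [encFormula, h, Formula.kind] using h₁, h₂,
      by simpa [encFormula, h, tag, names, nameIdx, Formula.nameAt] using h₃⟩
  | ex φ ih =>
    have h : next k M .form .ex = .form := if_pos hφ.2.1
    obtain ⟨h₁, h₂, h₃⟩ := ih ⟨hφ.1, hφ.2.2⟩
    exact ⟨by simpa [encFormula, h, Formula.kind] using h₁, h₂,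
      by simpa [encFormula, h, tag, names, nameIdx, Formula.nameAt] using h₃⟩
  | dep ps q =>
    have h : next k M .form .dep = .dp false 0 := if_pos hφ.2
    obtain ⟨h₁, -, h₃⟩ := tag_dep (k := k) (M := M) false q ps 0
      (by simpa [Formula.ArityLE] using hφ.1)
    refine ⟨by simpa [encFormula, h, Formula.kind] using h₁, rfl, fun i p => ?_⟩
    rw [encFormula, tag, h, names, List.mem_append, h₃]
    cases i <;> simp [nameIdx, Formula.nameAt, eq_comm]
  | negDep ps q =>
    have h : next k M .form .neg = .ng := if_pos hφ.2.1
    have h' : next k M .ng .dep = .dp true 0 := if_pos hφ.2.2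
    obtain ⟨h₁, -, h₃⟩ := tag_dep (k := k) (M := M) true q ps 0
      (by simpa [Formula.ArityLE] using hφ.1)
    refine ⟨by simpa [encFormula, h, h', Formula.kind] using h₁, rfl, fun i p => ?_⟩
    rw [encFormula, tag, h, names, tag, h', names, List.mem_append, List.mem_append, h₃]
    cases i <;> simp [nameIdx, Formula.nameAt, eq_comm]

end Tags

/-! ### Rules for loops -/

section Loops

variable {A C σ V τ : Type} [DecidableEq V]

theorem Prog.eval_loop_inv (w : List A) (v : V) {P : Prog A C σ V} (hP : P.Keeps v)
    (Inv : ℕ → PState C σ V → Prop) (s : PState C σ V) (h₀ : Inv 0 (s.setPtr v 0))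
    (hstep : ∀ i t a, w[i]? = some a → t.p v = i → Inv i t →
      Inv (i + 1) ((P.eval w t).setPtr v (i + 1))) :
    Inv w.length (Prog.eval w (.loop v P) s) ∧ (Prog.eval w (.loop v P) s).p v = w.length := by
  suffices ∀ n i t, t.p v = i → i + n = w.length → Inv i t →
      Inv w.length ((fun s => (P.eval w s).setPtr v ((P.eval w s).p v + 1))^[n] t) ∧
      ((fun s => (P.eval w s).setPtr v ((P.eval w s).p v + 1))^[n] t).p v = w.length from
    this w.length 0 _ (by simp [PState.setPtr]) (by simp) h₀
  intro n
  induction n with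
  | zero => rintro i t rfl hi h; rw [← hi]; exact ⟨h, rfl⟩
  | succ n ih =>
    rintro i t hv hi h
    have hk := P.eval_keeps w hP t
    rw [Function.iterate_succ_apply, hk, hv]
    refine ih (i + 1) _ (by simp [PState.setPtr]) (by omega) ?_
    exact hstep i t w[i] (List.getElem?_eq_getElem (by omega)) hv h

/-- Fold over a list, where each step depends on a letter and the rest of the list. -/
def scan (F : A → List A → τ → τ) : List A → τ → τ
  | [], x => x
  | a :: l, x => scan F l (F a l x)

/-- The invariant after `i` rounds is that folding the rest of the word from the current abstract
value yields the overall result. Thereby a loop is replaced by a pure function, up to the simulation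
relation `R`. -/
theorem Prog.eval_loop_scan (w : List A) (v : V) {P : Prog A C σ V} (hP : P.Keeps v)
    (F : A → List A → τ → τ) (R : τ → PState C σ V → Prop) (x : τ) (s : PState C σ V)
    (h₀ : R x (s.setPtr v 0))
    (hstep : ∀ pre a post x t, w = pre ++ a :: post → t.p v = pre.length → R x t →
      R (F a post x) ((P.eval w t).setPtr v (pre.length + 1))) :
    R (scan F w x) (Prog.eval w (.loop v P) s) := by
  obtain ⟨⟨y, hy, hR⟩, -⟩ := Prog.eval_loop_inv w v hP
    (fun i t => ∃ y, scan F (w.drop i) y = scan F w x ∧ R y t) s ⟨x, rfl, h₀⟩ (by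
      rintro i t a ha hv ⟨y, hy, hR⟩
      obtain ⟨hi, rfl⟩ := List.getElem?_eq_some_iff.1 ha
      have hd : w.drop i = w[i] :: w.drop (i + 1) := (List.cons_getElem_drop_succ ..).symm
      have hl : (w.take i).length = i := by simp [hi.le]
      refine ⟨F w[i] (w.drop (i + 1)) y, by rw [← hy, hd, scan], ?_⟩
      have h := hstep (w.take i) w[i] (w.drop (i + 1)) y t (by rw [← hd, List.take_append_drop])
        (by rw [hl, hv]) hR
      rwa [hl] at h)
  rw [List.drop_length, scan] at hy
  rwa [← hy]

/-- Modify the cell `i` if it belongs to the word. -/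
def wr (n : ℕ) (m : ℕ → C) (i : ℕ) (f : C → C) : ℕ → C :=
  if i < n then Function.update m i (f (m i)) else m

/-- Pointers saturate at the length of the word, and accesses at that position have no effect. A
saturated pointer therefore behaves like the unbounded counter it stands for. -/
theorem wr_min (n : ℕ) (m : ℕ → C) (i : ℕ) (f : C → C) : wr n m (min n i) f = wr n m i f := by
  unfold wr
  rcases Nat.lt_or_ge i n with h | h
  · rw [Nat.min_eq_right h.le]
  · rw [Nat.min_eq_left h, if_neg (lt_irrefl n), if_neg (by omega)]

theorem getElem?_min (w : List A) (i : ℕ) : w[min w.length i]? = w[i]? := by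
  rcases Nat.lt_or_ge i w.length with h | h
  · rw [Nat.min_eq_right h.le]
  · rw [Nat.min_eq_left h]; simp [h]

theorem Prog.eval_write_one (w : List A) (v : V) (f : σ → C → C) (s : PState C σ V) :
    Prog.eval w (.write [v] f) s = { s with m := wr w.length s.m (s.p v) (f s.v) } := by
  simp only [eval, wr, List.map_cons, List.map_nil, List.sum_singleton]
  split <;> rfl

/-- Apply a function to all cells of the word. -/
theorem Prog.eval_mapCells (w : List A) (v : V) (f : σ → C → C) (s : PState C σ V) :
    ∃ p, (∀ u, u ≠ v → p u = s.p u) ∧ Prog.eval w (.loop v (.write [v] f)) s =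
      ⟨s.v, p, fun c => if c < w.length then f s.v (s.m c) else s.m c⟩ := by
  obtain ⟨⟨h₁, h₂, h₃⟩, -⟩ := Prog.eval_loop_inv w v (P := .write [v] f) trivial
    (fun i t => t.v = s.v ∧ (∀ u, u ≠ v → t.p u = s.p u) ∧
      t.m = fun c => if c < i then f s.v (s.m c) else s.m c) s
    ⟨rfl, fun u hu => by simp [PState.setPtr, hu], by simp [PState.setPtr]⟩ (by
      rintro i t a ha hv ⟨h₁, h₂, h₃⟩
      have hi : i < w.length := (List.getElem?_eq_some_iff.1 ha).1
      rw [Prog.eval_write_one]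
      refine ⟨h₁, fun u hu => by simp [PState.setPtr, hu, h₂], ?_⟩
      simp only [PState.setPtr, wr, hv, hi, if_true, h₁, h₃]
      funext c
      by_cases hc : c = i
      · subst hc; simp
      · have : c < i + 1 ↔ c < i := by omega
        simp [hc, this])
  exact ⟨_, h₂, PState.ext h₁ rfl h₃⟩

end Loops

/-! ### The program deciding the model checking problem -/

/-- The pointers of the program. -/
inductive Ptr
  | i | j | r | s | c | d
  deriving DecidableEq

instance : Fintype Ptr := ⟨{.i, .j, .r, .s, .c, .d}, fun x => by cases x <;> decide⟩

/-- The state of the comparison of two names. -/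
inductive Cmp
  | fresh | run | ne | eq
  deriving DecidableEq

instance : Fintype Cmp := ⟨{.fresh, .run, .ne, .eq}, fun x => by cases x <;> decide⟩

/-- The information kept at a position of the input. The worlds and the columns of the adjacency
matrix are numbered from 1. -/
structure Cell (k : ℕ) where
  /-- whether the world with this number is in the denotation of the current formula -/
  x : Bool
  /-- the value of `x` being computed, and whether there is a world with this number -/
  y : Bool
  /-- whether the world with this number is labeled with the name of a given index -/
  m : Option (Fin k) → Bool
  deriving Fintype

instance (k : ℕ) : Inhabited (Cell k) := ⟨⟨false, false, fun _ => false⟩⟩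

/-- The part of the register with a lasting value. -/
structure Core (k : ℕ) where
  /-- the final state of the automaton -/
  fin : Tag k
  /-- all rows have had the right length so far -/
  ok : Bool
  /-- the current row has the right length so far -/
  full : Bool
  /-- the worlds of the team are in the denotation of the formula so far -/
  tm : Bool
  /-- one of the choices of values for the dependence atom was good -/
  res : Bool
  deriving Fintype

/-- The register of the program. -/
structure Reg (k : ℕ) where
  /-- the lasting part -/
  core : Core k
  /-- the current letter -/
  cur : Option (Sym × Tag k)
  /-- the index of the current name -/
  idx : Option (Option (Fin k))
  /-- the state of the comparison of names -/
  cmp : Cmp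
  /-- a bit of the first name -/
  bit : Option Bool
  /-- the value of the current column -/
  b : Bool
  deriving Fintype

/-- The initial register. -/
def Reg.init {k : ℕ} (q : Tag k) : Reg k :=
  ⟨⟨q, false, false, false, false⟩, none, none, .fresh, none, false⟩

/-- Programs over tagged words. -/
abbrev TProg (k : ℕ) := Prog (Sym × Tag k) (Cell k) (Reg k) Ptr

infixr:60 " ;; " => Prog.seq

section Programs

variable {k : ℕ}

/-- The current letter has the tag `q`. -/
def Reg.at (q : Tag k) (g : Reg k) : Bool := g.cur.any fun a => decide (a.2 = q)

/-- The empty program. -/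
def skip : TProg k := .load id

/-- Read the letter at a pointer. -/
def rd (v : Ptr) : TProg k := .read [v] fun g o => { g with cur := o.map Prod.fst }

/-- Look up a bit of the cell at a pointer. -/
def look (v : Ptr) (h : Cell k → Bool) (f : Reg k → Bool → Reg k) : TProg k :=
  .read [v] fun g o => f g (o.any fun x => h x.2)

/-- Mark the number of a world. -/
def countBody : TProg k :=
  rd .j ;; .ite (Reg.at .world) (.inc .s ;; .write [.s] fun _ x => { x with y := true }) skip

/-- Mark the numbers of worlds. -/
def countPass : TProg k := .reset .s ;; .loop .j countBody

/-- Process a letter in checking the lengths of rows. -/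
def checkBody : TProg k :=
  rd .j ;;
    .ite (Reg.at .world)
      (.load (fun g => { g with core :=
          { g.core with ok := g.core.ok && g.core.full, full := false } }) ;;
        .reset .c ;; .inc .c)
      (.ite (Reg.at .row)
        (look .c Cell.y (fun g b => { g with core := { g.core with ok := g.core.ok && b } }) ;;
          .inc .c ;;
          look .c Cell.y (fun g b => { g with core := { g.core with full := !b } }))
        skip)

/-- Check that every row has as many entries as there are worlds. -/
def checkPass : TProg k :=
  .load (fun g => { g with core := { g.core with ok := true, full := true } }) ;;
  .reset .c ;; .loop .j checkBody

/-- The letter as a bit. -/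
def bitOf (o : Option (Sym × Tag k)) : Option Bool :=
  match o with
  | some (.bit b, _) => some b
  | _ => none

/-- One step in comparing names. -/
def Cmp.step (x y : Option Bool) : Cmp → Cmp
  | .fresh => .run
  | .run => if x = y then (if x = none then .eq else .run) else .ne
  | .ne => .ne
  | .eq => .eq

/-- Compare the letters at two positions. -/
def cmpBody : TProg k :=
  .read [.i, .d] (fun g o => { g with bit := bitOf (o.map Prod.fst) }) ;;
    .read [.j, .d] fun g o => { g with cmp := g.cmp.step g.bit (bitOf (o.map Prod.fst)) }

/-- Compare the names following two positions. -/
def cmpPass : TProg k := .load (fun g => { g with cmp := .fresh }) ;; .loop .d cmpBody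

/-- Process a letter in searching labels. -/
def labelBody : TProg k :=
  rd .j ;;
    .ite (Reg.at .world) (.inc .s)
      (.ite (fun g => decide (g.cur = some (.name, .lab)))
        (cmpPass ;; .ite (fun g => decide (g.cmp = .ne)) skip
          (.write [.s] fun g x => { x with m := fun t => x.m t || decide (g.idx = some t) }))
        skip)

/-- Mark the worlds labeled with the name following a position. -/
def labelPass : TProg k := .reset .s ;; .loop .j labelBody

/-- Mark the worlds labeled with the name beginning at a position. -/
def nameBody : TProg k :=
  rd .i ;; .load (fun g => { g with idx := g.cur.bind nameIdx }) ;;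
    .ite (fun g => g.idx.isSome) labelPass skip

/-- Mark the worlds labeled with the names in the formula. -/
def namePass : TProg k := .loop .i nameBody

/-- Whether a world with given labels is in the denotation of the atom of the formula, if the
dependence atom requires the last proposition to have the value `f` of the others. -/
def atomVal (f : (Fin k → Bool) → Bool) (q : Tag k) (m : Option (Fin k) → Bool) : Bool :=
  match q with
  | .pr false => m none
  | .pr true => !m none
  | .dq false => m none == f fun r => m (some r)
  | _ => false

/-- The value of a modal formula, accounting for one more world that may be a successor. -/
def comb (o e x y : Bool) : Bool := if o then y && (!e || x) else y || (e && x)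

/-- Process a letter in computing the denotation of a formula beginning with a modality. -/
def modalBody (o : Bool) : TProg k :=
  rd .j ;;
    .ite (Reg.at .world)
      (.inc .s ;; .reset .c ;; .write [.s] fun _ x => { x with y := o })
      (.ite (Reg.at .row)
        (.inc .c ;; look .c Cell.x (fun g b => { g with b := b }) ;;
          .write [.s] fun g x => { x with y := comb o (bitOf g.cur == some true) g.b x.y })
        skip)

/-- Compute the denotation of a formula beginning with a modality. -/
def modalPass (o : Bool) : TProg k :=
  .reset .s ;; .reset .c ;; .loop .j (modalBody o) ;;
    .loop .j (.write [.j] fun _ x => { x with x := x.y })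

/-- Apply the modality at a position. -/
def opsBody : TProg k :=
  .dec .r ;; rd .r ;;
    .ite (fun g => decide (g.cur.map Prod.fst = some .ax)) (modalPass true)
      (.ite (fun g => decide (g.cur.map Prod.fst = some .ex)) (modalPass false) skip)

/-- Compute the denotation of the formula from that of the atom. -/
def opsPass : TProg k := .loop .r skip ;; .loop .i opsBody

/-- Process a letter in checking the team. -/
def teamBody : TProg k :=
  rd .j ;;
    .ite (Reg.at .world) (.inc .s)
      (.ite (fun g => decide (g.cur = some (.bit true, .team)))
        (look .s Cell.x fun g b => { g with core := { g.core with tm := g.core.tm && b } })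
        skip)

/-- Check that the team is included in the denotation. -/
def teamPass : TProg k :=
  .load (fun g => { g with core := { g.core with tm := true } }) ;;
  .reset .s ;; .loop .j teamBody

/-- Evaluate the formula for one choice of values for the dependence atom. -/
def evalPass (f : (Fin k → Bool) → Bool) : TProg k :=
  .loop .j (.write [.j] fun g x => { x with x := atomVal f g.core.fin x.m }) ;;
  opsPass ;; teamPass ;;
  .load fun g => { g with core := { g.core with res := g.core.res || g.core.tm } }

/-- The whole program. -/
def mainProg (fs : List ((Fin k → Bool) → Bool)) : TProg k :=
  countPass ;; checkPass ;; namePass ;; fs.foldr (fun f P => evalPass f ;; P) skip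

/-- The answer of the program. -/
def Reg.out (g : Reg k) : Bool := g.core.ok && g.core.full && g.core.fin.accept && g.core.res

theorem wf_evalPass (f : (Fin k → Bool) → Bool) : (evalPass f).WF := by
  simp [evalPass, opsPass, opsBody, teamPass, teamBody, modalPass, modalBody, rd, look, skip,
    Prog.WF, Prog.Keeps]

theorem wf_mainProg (fs : List ((Fin k → Bool) → Bool)) : (mainProg fs).WF := by
  have : (fs.foldr (fun f P => evalPass f ;; P) skip).WF := by
    induction fs with
    | nil => trivial
    | cons f fs ih => exact ⟨wf_evalPass f, ih⟩
  simp [mainProg, countPass, countBody, checkPass, checkBody, namePass, nameBody, labelPass,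
    labelBody, cmpPass, cmpBody, rd, look, skip, Prog.WF, Prog.Keeps]
  simpa [skip] using this

end Programs

/-! ### The effect of the parts of the program -/

section Effects

variable {k : ℕ} (w : List (Sym × Tag k))

/-- The states of the program. -/
abbrev TState (k : ℕ) := PState (Cell k) (Reg k) Ptr

theorem eval_load (f : Reg k → Reg k) (t : TState k) :
    Prog.eval w (.load f) t = { t with v := f t.v } := rfl

theorem eval_seq (P Q : TProg k) (t : TState k) :
    (P ;; Q).eval w t = Q.eval w (P.eval w t) := rfl

theorem eval_ite (b : Reg k → Bool) (P Q : TProg k) (t : TState k) :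
    Prog.eval w (.ite b P Q) t = if b t.v then P.eval w t else Q.eval w t := rfl

theorem eval_reset (v : Ptr) (t : TState k) : Prog.eval w (.reset v) t = t.setPtr v 0 := rfl

theorem eval_skip (t : TState k) : skip.eval w t = t := rfl

/-- Throughout, a pointer used as a counter with value `i` is represented by `min w.length i`; this
is the form in which the invariants below mention pointers. -/
theorem eval_inc {v : Ptr} {t : TState k} {i : ℕ} (h : t.p v = min w.length i) :
    Prog.eval w (.inc v) t = t.setPtr v (min w.length (i + 1)) := by
  simp only [Prog.eval, h]
  congr 1
  omega

theorem eval_look {v : Ptr} (h : Cell k → Bool) (f : Reg k → Bool → Reg k) {t : TState k} {i : ℕ}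
    (hv : t.p v = min w.length i) :
    (look v h f).eval w t = { t with v := f t.v (decide (i < w.length) && h (t.m i)) } := by
  simp only [look, Prog.eval, List.map_cons, List.map_nil, List.sum_singleton, hv, getElem?_min]
  rcases Nat.lt_or_ge i w.length with hi | hi
  · simp [hi, Nat.min_eq_right hi.le]
  · simp [hi, Nat.not_lt.2 hi]

theorem eval_write {v : Ptr} (f : Reg k → Cell k → Cell k) {t : TState k} {i : ℕ}
    (hv : t.p v = min w.length i) :
    Prog.eval w (.write [v] f) t = { t with m := wr w.length t.m i (f t.v) } := by
  rw [Prog.eval_write_one, hv, wr_min]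

theorem eval_rd {v : Ptr} {t : TState k} {pre post : List (Sym × Tag k)}
    {a : Sym × Tag k} (hw : w = pre ++ a :: post) (hv : t.p v = pre.length) :
    (rd v).eval w t = { t with v := { t.v with cur := some a } } := by
  simp [rd, Prog.eval, hv, hw]

theorem at_some (q : Tag k) (g : Reg k) (a : Sym × Tag k) (h : g.cur = some a) :
    Reg.at q g = decide (a.2 = q) := by
  simp [Reg.at, h]

/-- One step in marking the numbers of worlds. -/
def countStep (n : ℕ) (a : Sym × Tag k) (_ : List (Sym × Tag k)) (x : ℕ × (ℕ → Cell k)) :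
    ℕ × (ℕ → Cell k) :=
  if a.2 = .world then (x.1 + 1, wr n x.2 (x.1 + 1) fun x => { x with y := true }) else x

theorem eval_countPass (s : TState k) :
    (countPass.eval w s).v.core = s.v.core ∧
      (countPass.eval w s).m = (scan (countStep w.length) w (0, s.m)).2 := by
  have h := Prog.eval_loop_scan w .j (P := countBody)
    (by simp [countBody, rd, skip, Prog.Keeps]) (countStep w.length)
    (fun x t => t.v.core = s.v.core ∧ t.p .s = min w.length x.1 ∧ t.m = x.2) (0, s.m)
    (s.setPtr .s 0) (by simp [PState.setPtr]) (by
      rintro pre a post x t hw hv ⟨h₁, h₂, h₃⟩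
      rw [countBody, eval_seq, eval_rd w hw hv, eval_ite, at_some _ _ a rfl]
      by_cases ha : a.2 = .world
      · simp only [ha, decide_true, if_true, eval_seq]
        rw [eval_inc w (i := x.1), eval_write w (i := x.1 + 1)]
        · simp [PState.setPtr, countStep, ha, h₁, h₃]
        · simp [PState.setPtr]
        · exact h₂
      · simp [PState.setPtr, countStep, ha, h₁, h₂, h₃, eval_skip])
  exact ⟨h.1, h.2.2⟩

/-- One step in checking the lengths of rows. -/
def checkStep (n : ℕ) (m : ℕ → Cell k) (a : Sym × Tag k) (_ : List (Sym × Tag k))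
    (x : ℕ × Bool × Bool) : ℕ × Bool × Bool :=
  if a.2 = .world then (1, x.2.1 && x.2.2, false)
  else if a.2 = .row then
    (x.1 + 1, x.2.1 && (decide (x.1 < n) && (m x.1).y),
      !(decide (x.1 + 1 < n) && (m (x.1 + 1)).y))
  else x

theorem eval_checkPass (s : TState k) :
    (checkPass.eval w s).v.core = { s.v.core with
      ok := (scan (checkStep w.length s.m) w (0, true, true)).2.1
      full := (scan (checkStep w.length s.m) w (0, true, true)).2.2 } ∧
      (checkPass.eval w s).m = s.m := by
  have h := Prog.eval_loop_scan w .j (P := checkBody)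
    (by simp [checkBody, rd, look, skip, Prog.Keeps]) (checkStep w.length s.m)
    (fun x t => t.v.core = { s.v.core with ok := x.2.1, full := x.2.2 } ∧
      t.p .c = min w.length x.1 ∧ t.m = s.m) (0, true, true)
    (PState.setPtr ⟨{ s.v with core := { s.v.core with ok := true, full := true } }, s.p, s.m⟩ .c 0)
    (by simp [PState.setPtr]) (by
      rintro pre a post x t hw hv ⟨h₁, h₂, h₃⟩
      rw [checkBody, eval_seq, eval_rd w hw hv, eval_ite, at_some _ _ a rfl]
      by_cases ha : a.2 = .world
      · simp only [ha, decide_true, if_true, eval_seq]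
        rw [eval_load, eval_reset, eval_inc w (i := 0)]
        · simp [PState.setPtr, checkStep, ha, h₁, h₃]
        · simp [PState.setPtr]
      · rw [decide_eq_false ha, if_neg (by simp), eval_ite, at_some _ _ a rfl]
        by_cases hb : a.2 = .row
        · simp only [hb, decide_true, if_true, eval_seq]
          have e : t.p .c = min w.length x.1 := h₂
          rw [eval_look w (i := x.1 + 1), eval_inc w (i := x.1), eval_look w (i := x.1)]
          · simp [PState.setPtr, checkStep, hb, h₁, h₃]
          · exact h₂
          · rwa [eval_look w (i := x.1)]
            exact h₂
          · rw [eval_inc w (i := x.1), eval_look w (i := x.1)]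
            · simp [PState.setPtr]
            · exact h₂
            · rwa [eval_look w (i := x.1)]
              exact h₂
        · simp [PState.setPtr, checkStep, ha, hb, h₁, h₂, h₃, eval_skip])
  exact ⟨h.1, h.2.2⟩

theorem nameOf_eq (l : List (Sym × Tag k)) :
    nameOf l = match bitOf l[0]? with
      | some b => b :: nameOf l.tail
      | none => [] := by
  rcases l with _ | ⟨⟨a, q⟩, l⟩
  · rfl
  · cases a <;> rfl

/-- Both names are read at a common offset `d` until they differ or both end. A name ends at the
first letter that is not a bit or at the end of the word, both of which `bitOf` reports as `none`.
-/
theorem eval_cmpPass {pre post pre' post' : List (Sym × Tag k)} {a a' : Sym × Tag k}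
    (hw : w = pre ++ a :: post) (hw' : w = pre' ++ a' :: post') (s : TState k)
    (hi : s.p .i = pre.length) (hj : s.p .j = pre'.length) :
    (cmpPass.eval w s).v.core = s.v.core ∧ (cmpPass.eval w s).v.idx = s.v.idx ∧
    (cmpPass.eval w s).m = s.m ∧ (∀ v, v ≠ .d → (cmpPass.eval w s).p v = s.p v) ∧
    ((cmpPass.eval w s).v.cmp ≠ .ne ↔ nameOf post' = nameOf post) := by
  -- Round 0 only skips the markers at which the names begin. After round `e` the first `e` letters
  -- behind the markers have been compared, so while no decision has been made it remains to compare
  -- the tails from `e` on.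
  let Inv : ℕ → TState k → Prop := fun i t =>
    t.v.core = s.v.core ∧ t.v.idx = s.v.idx ∧ t.m = s.m ∧ (∀ v, v ≠ .d → t.p v = s.p v) ∧
    match i with
    | 0 => t.v.cmp = .fresh
    | e + 1 => match t.v.cmp with
      | .fresh => False
      | .ne => nameOf post' ≠ nameOf post
      | .eq => nameOf post' = nameOf post
      | .run => nameOf post' = nameOf post ↔ nameOf (post'.drop e) = nameOf (post.drop e)
  obtain ⟨⟨h₁, h₂, h₃, h₄, h₅⟩, -⟩ : Inv w.length (cmpPass.eval w s) ∧ _ := by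
    refine Prog.eval_loop_inv w .d (P := cmpBody) (by simp [cmpBody, Prog.Keeps]) Inv
      { s with v := { s.v with cmp := .fresh } } ?_ ?_
    · exact ⟨rfl, rfl, rfl, fun v hv => by simp [PState.setPtr, hv], rfl⟩
    · rintro i t b hb hd ⟨h₁, h₂, h₃, h₄, h₅⟩
      refine ⟨h₁, h₂, h₃, fun v hv => by simp [PState.setPtr, hv, ← h₄ v hv, cmpBody, Prog.eval], ?_⟩
      have e₁ : t.p .i = pre.length := by rw [h₄ _ (by simp), hi]
      have e₂ : t.p .j = pre'.length := by rw [h₄ _ (by simp), hj]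
      simp only [cmpBody, Prog.eval, PState.setPtr, List.map_cons, List.map_nil, List.sum_cons,
        List.sum_nil, Nat.add_zero, e₁, e₂, hd, Option.map_map, Function.comp_def,
        Option.map_id']
      cases i with
      | zero => simp only [h₅, Cmp.step, List.drop_zero]
      | succ e =>
        have g₁ : w[pre.length + (e + 1)]? = (post.drop e)[0]? := by
          rw [hw]; simp [List.getElem?_append_right]
        have g₂ : w[pre'.length + (e + 1)]? = (post'.drop e)[0]? := by
          rw [hw']; simp [List.getElem?_append_right]
        rw [g₁, g₂]
        rcases hc : t.v.cmp <;> simp only [hc] at h₅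
        · rw [nameOf_eq (post'.drop e), nameOf_eq (post.drop e), List.tail_drop,
            List.tail_drop] at h₅
          rcases hx : bitOf (post.drop e)[0]? with _ | x <;>
          rcases hy : bitOf (post'.drop e)[0]? with _ | y <;>
          simp only [hx, hy] at h₅
          · simpa [Cmp.step] using h₅
          · simpa [Cmp.step] using h₅
          · simpa [Cmp.step] using h₅
          · by_cases hxy : x = y
            · subst hxy; simpa [Cmp.step] using h₅
            · simpa [Cmp.step, hxy, Ne.symm hxy] using h₅
        · simpa only [Cmp.step] using h₅
        · simpa only [Cmp.step] using h₅
  refine ⟨h₁, h₂, h₃, h₄, ?_⟩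
  -- After `w.length` rounds both tails are exhausted, so that an undecided comparison also means
  -- equality.
  have hn : w.length = (pre.length + post.length) + 1 := by rw [hw]; simp; omega
  have hn' : w.length = (pre'.length + post'.length) + 1 := by rw [hw']; simp; omega
  rw [hn] at h₅
  simp only [] at h₅
  rw [List.drop_eq_nil_of_le (by omega), List.drop_eq_nil_of_le (by omega)] at h₅
  rcases hc : (cmpPass.eval w s).v.cmp <;> simp only [hc] at h₅ <;> simpa using h₅

/-- One step in marking the worlds labeled with the name `p`, whose index is `t`. -/
def labelStep (n : ℕ) (p : Name) (t : Option (Fin k)) (a : Sym × Tag k)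
    (l : List (Sym × Tag k)) (x : ℕ × (ℕ → Cell k)) : ℕ × (ℕ → Cell k) :=
  if a.2 = .world then (x.1 + 1, x.2)
  else if a = (.name, .lab) ∧ nameOf l = p then
    (x.1, wr n x.2 x.1 fun x => { x with m := fun u => x.m u || decide (t = u) })
  else x

/-- One step in marking the worlds labeled with the names in the formula. -/
def nameStep (a : Sym × Tag k) (l : List (Sym × Tag k)) (m : ℕ → Cell k) : ℕ → Cell k :=
  match nameIdx a with
  | some t => (scan (labelStep w.length (nameOf l) t) w (0, m)).2
  | none => m

/-- The word of formula letters after `i` is fixed during the sweep, and `nameOf l` in `labelStep`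
is what the comparison at a label computes. -/
theorem eval_labelPass {pre post : List (Sym × Tag k)} {a : Sym × Tag k}
    (hw : w = pre ++ a :: post) (s : TState k) (hi : s.p .i = pre.length) (t : Option (Fin k))
    (ht : s.v.idx = some t) :
    (labelPass.eval w s).v.core = s.v.core ∧
      (labelPass.eval w s).m = (scan (labelStep w.length (nameOf post) t) w (0, s.m)).2 := by
  have h := Prog.eval_loop_scan w .j (P := labelBody)
    (by simp [labelBody, rd, cmpPass, cmpBody, skip, Prog.Keeps])
    (labelStep w.length (nameOf post) t)
    (fun x u => u.v.core = s.v.core ∧ u.v.idx = s.v.idx ∧ u.p .i = s.p .i ∧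
      u.p .s = min w.length x.1 ∧ u.m = x.2) (0, s.m) (s.setPtr .s 0)
    (by simp [PState.setPtr]) (by
      rintro pre' a' post' x u hw' hv ⟨h₁, h₂, h₃, h₄, h₅⟩
      rw [labelBody, eval_seq, eval_rd w hw' hv, eval_ite, at_some _ _ a' rfl]
      by_cases ha : a'.2 = .world
      · simp only [ha, decide_true, if_true]
        rw [eval_inc w (i := x.1)]
        · simp [PState.setPtr, labelStep, ha, h₁, h₂, h₃, h₅]
        · exact h₄
      · rw [decide_eq_false ha, if_neg (by simp), eval_ite]
        by_cases hb : a' = (.name, .lab)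
        · rw [if_pos (by simp [hb]), eval_seq, eval_ite]
          obtain ⟨g₁, g₂, g₃, g₄, g₅⟩ := eval_cmpPass w hw hw'
            ⟨⟨u.v.core, some a', u.v.idx, u.v.cmp, u.v.bit, u.v.b⟩, u.p, u.m⟩ (h₃.trans hi) hv
          generalize Prog.eval w cmpPass _ = z at g₁ g₂ g₃ g₄ g₅ ⊢
          simp only [h₁, h₂, h₅, ht] at g₁ g₂ g₃
          by_cases hc : nameOf post' = nameOf post
          · rw [if_neg (by simpa using g₅.2 hc), eval_write w (i := x.1)]
            · simp [PState.setPtr, labelStep, hb, hc, g₁, g₂, g₃, g₄, h₃, h₄, ht]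
            · rw [g₄ _ (by simp), ← h₄]
          · rw [if_pos (by simpa using mt g₅.1 hc), eval_skip]
            simp [PState.setPtr, labelStep, hb, hc, g₁, g₂, g₃, g₄, h₃, h₄, ht]
        · rw [if_neg (by simp [hb]), eval_skip]
          simp [PState.setPtr, labelStep, ha, hb, h₁, h₂, h₃, h₄, h₅])
  exact ⟨h.1, h.2.2.2.2⟩

theorem eval_namePass (s : TState k) :
    (namePass.eval w s).v.core = s.v.core ∧
      (namePass.eval w s).m = scan (nameStep w) w s.m := by
  refine Prog.eval_loop_scan w .i (P := nameBody)
    (by simp [nameBody, labelPass, labelBody, rd, cmpPass, cmpBody, skip, Prog.Keeps]) (nameStep w)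
    (fun x u => u.v.core = s.v.core ∧ u.m = x) s.m s ⟨rfl, rfl⟩ ?_
  rintro pre a post x u hw hv ⟨h₁, h₂⟩
  rw [nameBody, eval_seq, eval_rd w hw hv, eval_seq, eval_load, eval_ite]
  rcases ha : nameIdx a with _ | t
  · simp [PState.setPtr, nameStep, ha, eval_skip, h₁, h₂]
  · obtain ⟨g₁, g₂⟩ := eval_labelPass w hw
      ⟨⟨u.v.core, some a, some t, u.v.cmp, u.v.bit, u.v.b⟩, u.p, u.m⟩ hv t rfl
    simp only [h₁, h₂] at g₁ g₂
    simp [PState.setPtr, nameStep, ha, g₁, g₂, h₁, h₂]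

/-- One step in computing the denotation of a formula beginning with a modality. -/
def modalStep (n : ℕ) (o : Bool) (a : Sym × Tag k) (_ : List (Sym × Tag k))
    (x : ℕ × ℕ × (ℕ → Cell k)) : ℕ × ℕ × (ℕ → Cell k) :=
  if a.2 = .world then (x.1 + 1, 0, wr n x.2.2 (x.1 + 1) fun u => { u with y := o })
  else if a.2 = .row then (x.1, x.2.1 + 1, wr n x.2.2 x.1 fun u => { u with
    y := comb o (bitOf (some a) == some true)
      (decide (x.2.1 + 1 < n) && (x.2.2 (x.2.1 + 1)).x) u.y })
  else x

/-- The effect of a modality on the cells. -/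
def modal (o : Bool) (m : ℕ → Cell k) : ℕ → Cell k := fun c =>
  if c < w.length then { (scan (modalStep w.length o) w (0, 0, m)).2.2 c with
    x := ((scan (modalStep w.length o) w (0, 0, m)).2.2 c).y }
  else (scan (modalStep w.length o) w (0, 0, m)).2.2 c

theorem eval_modalPass (o : Bool) (s : TState k) :
    ((modalPass o).eval w s).v.core = s.v.core ∧
      ((modalPass o).eval w s).m = modal w o s.m := by
  have h := Prog.eval_loop_scan w .j (P := modalBody o)
    (by simp [modalBody, rd, look, skip, Prog.Keeps]) (modalStep w.length o)
    (fun x u => u.v.core = s.v.core ∧ u.p .s = min w.length x.1 ∧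
      u.p .c = min w.length x.2.1 ∧ u.m = x.2.2) (0, 0, s.m)
    ((s.setPtr .s 0).setPtr .c 0)
    (by simp [PState.setPtr]) (by
      rintro pre a post x u hw hv ⟨h₁, h₂, h₃, h₄⟩
      rw [modalBody, eval_seq, eval_rd w hw hv, eval_ite, at_some _ _ a rfl]
      by_cases ha : a.2 = .world
      · simp only [ha, decide_true, if_true, eval_seq]
        rw [eval_inc w (i := x.1) (t := ⟨⟨u.v.core, some a, _, _, _, _⟩, u.p, u.m⟩) h₂,
          eval_reset, eval_write w (i := x.1 + 1)]
        · simp [PState.setPtr, modalStep, ha, h₁, h₄]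
        · simp [PState.setPtr]
      · rw [decide_eq_false ha, if_neg (by simp), eval_ite, at_some _ _ a rfl]
        by_cases hb : a.2 = .row
        · simp only [hb, decide_true, if_true, eval_seq]
          rw [eval_inc w (i := x.2.1) (t := ⟨⟨u.v.core, some a, _, _, _, _⟩, u.p, u.m⟩) h₃,
            eval_look w (i := x.2.1 + 1) _ _ (by simp [PState.setPtr]), eval_write w (i := x.1)]
          · simp [PState.setPtr, modalStep, hb, h₁, h₂, h₄]
          · simp [PState.setPtr, h₂]
        · simp [PState.setPtr, modalStep, ha, hb, h₁, h₂, h₃, h₄, eval_skip])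
  obtain ⟨p, -, h'⟩ := Prog.eval_mapCells w .j (fun (_ : Reg k) (x : Cell k) => { x with x := x.y })
    (Prog.eval w (.loop .j (modalBody o)) ((s.setPtr .s 0).setPtr .c 0))
  rw [modalPass, eval_seq, eval_seq, eval_seq, eval_reset, eval_reset, h']
  exact ⟨h.1, by simp only [h.2.2.2]; rfl⟩

/-- The effect on the cells of a letter of the formula. -/
def opStep (a : Sym × Tag k) (m : ℕ → Cell k) : ℕ → Cell k :=
  if a.1 = .ax then modal w true m else if a.1 = .ex then modal w false m else m

theorem keeps_opsBody : (opsBody (k := k)).Keeps .i := by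
  simp [opsBody, modalPass, modalBody, rd, look, skip, Prog.Keeps]

theorem keeps_modalPass (o : Bool) : (modalPass (k := k) o).Keeps .r := by
  simp [modalPass, modalBody, rd, look, skip, Prog.Keeps]

/-- Modalities must be applied innermost first, that is from right to left, which is why the effect
is a `foldr`. The pointer `i` merely counts while `r` walks backwards. -/
theorem eval_opsPass (s : TState k) :
    (opsPass.eval w s).v.core = s.v.core ∧ (opsPass.eval w s).m = w.foldr (opStep w) s.m := by
  -- The empty loop is a way of moving `r` to the end of the word.
  obtain ⟨⟨h₁, h₂⟩, h₃⟩ := Prog.eval_loop_inv w .r (P := skip) (by simp [skip, Prog.Keeps])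
    (fun _ t => t.v.core = s.v.core ∧ t.m = s.m) s ⟨rfl, rfl⟩ (fun _ _ _ _ _ h => h)
  rw [opsPass, eval_seq]
  generalize Prog.eval w (.loop .r skip) s = u at h₁ h₂ h₃ ⊢
  obtain ⟨⟨g₁, -, g₂⟩, -⟩ := Prog.eval_loop_inv w .i (P := opsBody) keeps_opsBody
    (fun i t => t.v.core = s.v.core ∧ t.p .r = w.length - i ∧
      t.m = (w.drop (w.length - i)).foldr (opStep w) s.m) u
    ⟨h₁, by simp [PState.setPtr, h₃], by simp [PState.setPtr, h₂]⟩ (by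
      rintro i t b hb - ⟨h₁, h₂, h₃⟩
      have hi : i < w.length := (List.getElem?_eq_some_iff.1 hb).1
      have hd : w.drop (w.length - (i + 1)) = w[w.length - (i + 1)] :: w.drop (w.length - i) := by
        rw [show w.length - i = w.length - (i + 1) + 1 by omega]
        exact (List.cons_getElem_drop_succ ..).symm
      have hw : w = w.take (w.length - (i + 1)) ++
          w[w.length - (i + 1)] :: w.drop (w.length - i) := by
        rw [← hd, List.take_append_drop]
      have hp : (Prog.eval w (.dec .r) t).p .r = (w.take (w.length - (i + 1))).length := by
        simp [Prog.eval, PState.setPtr, h₂]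
        omega
      rw [hd, List.foldr_cons, ← h₃, opsBody, eval_seq, eval_seq, eval_rd w hw hp, eval_ite]
      generalize w[w.length - (i + 1)] = a
      generalize hu : ({ Prog.eval w (.dec .r) t with
        v := { (Prog.eval w (.dec .r) t).v with cur := some a } } : TState k) = u
      have e₁ : u.v.core = s.v.core := by rw [← hu, ← h₁]; rfl
      have e₂ : u.m = t.m := by rw [← hu]; rfl
      have e₃ : u.p .r = w.length - (i + 1) := by rw [← hu, hp]; simp
      have e₄ : u.v.cur = some a := by rw [← hu]
      simp only [eval_ite, e₄, Option.map_some, Option.some.injEq, decide_eq_true_eq, opStep]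
      have := fun o => eval_modalPass w o u
      have hk := fun o => Prog.eval_keeps w (keeps_modalPass o) u
      split
      · simp [PState.setPtr, this, hk, e₁, e₂, e₃]
      · split <;> simp [PState.setPtr, this, hk, e₁, e₂, e₃, eval_skip])
  refine ⟨g₁, ?_⟩
  simpa using g₂

/-- One step in checking the team. -/
def teamStep (n : ℕ) (m : ℕ → Cell k) (a : Sym × Tag k) (_ : List (Sym × Tag k))
    (x : ℕ × Bool) : ℕ × Bool :=
  if a.2 = .world then (x.1 + 1, x.2)
  else if a = (.bit true, .team) then (x.1, x.2 && (decide (x.1 < n) && (m x.1).x))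
  else x

theorem eval_teamPass (s : TState k) :
    (teamPass.eval w s).v.core =
      { s.v.core with tm := (scan (teamStep w.length s.m) w (0, true)).2 } ∧
      (teamPass.eval w s).m = s.m := by
  have h := Prog.eval_loop_scan w .j (P := teamBody)
    (by simp [teamBody, rd, look, skip, Prog.Keeps]) (teamStep w.length s.m)
    (fun x t => t.v.core = { s.v.core with tm := x.2 } ∧
      t.p .s = min w.length x.1 ∧ t.m = s.m) (0, true)
    (PState.setPtr ⟨{ s.v with core := { s.v.core with tm := true } }, s.p, s.m⟩ .s 0)
    (by simp [PState.setPtr]) (by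
      rintro pre a post x t hw hv ⟨h₁, h₂, h₃⟩
      rw [teamBody, eval_seq, eval_rd w hw hv, eval_ite, at_some _ _ a rfl]
      by_cases ha : a.2 = .world
      · simp only [ha, decide_true, if_true]
        rw [eval_inc w (i := x.1)]
        · simp [PState.setPtr, teamStep, ha, h₁, h₃]
        · exact h₂
      · rw [decide_eq_false ha, if_neg (by simp), eval_ite]
        by_cases hb : a = (.bit true, .team)
        · rw [if_pos (by simp [hb]), eval_look w (i := x.1)]
          · simp [PState.setPtr, teamStep, hb, h₁, h₂, h₃]
          · exact h₂
        · rw [if_neg (by simp [hb]), eval_skip]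
          simp [PState.setPtr, teamStep, ha, hb, h₁, h₂, h₃])
  exact ⟨h.1, h.2.2⟩

/-- The cells after evaluating the formula for one choice of values. -/
def denote (q : Tag k) (f : (Fin k → Bool) → Bool) (m : ℕ → Cell k) : ℕ → Cell k :=
  w.foldr (opStep w) fun c => if c < w.length then { m c with x := atomVal f q (m c).m } else m c

/-- Whether one of several choices of values is good. -/
def tryAll (q : Tag k) : List ((Fin k → Bool) → Bool) → (ℕ → Cell k) → Bool
  | [], _ => false
  | f :: fs, m =>
    (scan (teamStep w.length (denote w q f m)) w (0, true)).2 || tryAll q fs (denote w q f m)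

theorem eval_evalPass (f : (Fin k → Bool) → Bool) (s : TState k) :
    ∃ tm, ((evalPass f).eval w s).v.core = { s.v.core with
        tm := tm
        res := s.v.core.res ||
          (scan (teamStep w.length (denote w s.v.core.fin f s.m)) w (0, true)).2 } ∧
      ((evalPass f).eval w s).m = denote w s.v.core.fin f s.m := by
  obtain ⟨p, -, h⟩ := Prog.eval_mapCells w .j
    (fun (g : Reg k) (x : Cell k) => { x with x := atomVal f g.core.fin x.m }) s
  rw [evalPass, eval_seq, h, eval_seq, eval_seq, eval_load]
  obtain ⟨h₁, h₂⟩ := eval_opsPass w ⟨s.v, p, fun c =>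
    if c < w.length then { s.m c with x := atomVal f s.v.core.fin (s.m c).m } else s.m c⟩
  generalize Prog.eval w opsPass _ = u at h₁ h₂ ⊢
  obtain ⟨h₃, h₄⟩ := eval_teamPass w u
  generalize Prog.eval w teamPass _ = u' at h₃ h₄ ⊢
  simp only at h₁ h₂
  rw [h₁, h₂] at h₃
  exact ⟨u'.v.core.tm, by simp [h₃, denote], by rw [h₄, h₂]; rfl⟩

/-- The bit `tm` is scratch and is only asserted to exist; `res` collects the disjunction over all
choices. The cells are handed from one choice to the next, as `tryAll` records. -/
theorem eval_evalPasses (fs : List ((Fin k → Bool) → Bool)) : ∀ s : TState k,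
    ∃ tm, ((fs.foldr (fun f P => evalPass f ;; P) skip).eval w s).v.core = { s.v.core with
      tm := tm, res := s.v.core.res || tryAll w s.v.core.fin fs s.m } := by
  induction fs with
  | nil => exact fun s => ⟨s.v.core.tm, by simp [eval_skip, tryAll]⟩
  | cons f fs ih =>
    intro s
    obtain ⟨tm, h₁, h₂⟩ := eval_evalPass w f s
    obtain ⟨tm', h₃⟩ := ih ((evalPass f).eval w s)
    rw [h₁, h₂] at h₃
    exact ⟨tm', by rw [List.foldr_cons, eval_seq, h₃]; simp [tryAll, Bool.or_assoc]⟩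

theorem eval_mainProg (fs : List ((Fin k → Bool) → Bool)) (q : Tag k) :
    let m₁ := (scan (countStep w.length) w (0, fun _ => default)).2
    let m₂ := scan (nameStep w) w m₁
    Reg.out ((mainProg fs).eval w ⟨Reg.init q, fun _ => 0, fun _ => default⟩).v =
      ((scan (checkStep w.length m₁) w (0, true, true)).2.1 &&
      (scan (checkStep w.length m₁) w (0, true, true)).2.2 && q.accept && tryAll w q fs m₂) := by
  rw [mainProg, eval_seq, eval_seq, eval_seq]
  obtain ⟨a₁, a₂⟩ := eval_countPass w (⟨Reg.init q, fun _ => 0, fun _ => default⟩ : TState k)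
  generalize Prog.eval w countPass _ = u at a₁ a₂ ⊢
  obtain ⟨b₁, b₂⟩ := eval_checkPass w u
  generalize Prog.eval w checkPass _ = v at b₁ b₂ ⊢
  obtain ⟨c₁, c₂⟩ := eval_namePass w v
  generalize Prog.eval w namePass _ = x at c₁ c₂ ⊢
  obtain ⟨tm, h⟩ := eval_evalPasses w fs x
  rw [b₁, a₁, a₂] at c₁
  rw [b₂, a₂] at c₂
  rw [Reg.out, h, c₁, c₂]
  simp [Reg.init]

end Effects

/-! ### The effect of the program on instances -/

section Scan

variable {k : ℕ} {τ : Type}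

theorem scan_append_of_id {A : Type} {F : A → List A → τ → τ} {u : List A}
    (hu : ∀ a ∈ u, ∀ l x, F a l x = x) (v : List A) (x : τ) : scan F (u ++ v) x = scan F v x := by
  induction u with
  | nil => rfl
  | cons a u ih =>
    rw [List.cons_append, scan, hu a (by simp)]
    exact ih fun b hb => hu b (by simp [hb])

theorem scan_of_id {A : Type} {F : A → List A → τ → τ} {u : List A}
    (hu : ∀ a ∈ u, ∀ l x, F a l x = x) (x : τ) : scan F u x = x := by
  simpa [scan] using scan_append_of_id hu [] x

/-- Rule for folding over a tagged instance record by record. -/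
theorem scan_recs {F : Sym × Tag k → List (Sym × Tag k) → τ → τ} (R : ℕ → τ → Prop)
    (recs : List Rec) {T : List (Sym × Tag k)} (hT : ∀ a ∈ T, ∀ l x, F a l x = x)
    (hT' : nameOf T = []) {x : τ} (h₀ : R 0 x)
    (hs : ∀ i (h : i < recs.length) (l : List (Sym × Tag k)) x, nameOf l = [] → R i x →
      ∃ y, scan F (tRec k recs[i] ++ l) x = scan F l y ∧ R (i + 1) y) :
    R recs.length (scan F (recs.flatMap (tRec k) ++ T) x) := by
  suffices ∀ n i x, i + n = recs.length → R i x →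
      R recs.length (scan F ((recs.drop i).flatMap (tRec k) ++ T) x) by
    simpa using this recs.length 0 x (by simp) h₀
  intro n
  induction n with
  | zero =>
    intro i x hi h
    rw [List.drop_eq_nil_of_le (by omega), List.flatMap_nil, List.nil_append, scan_of_id hT, ← hi]
    exact h
  | succ n ih =>
    intro i x hi h
    have hd : recs.drop i = recs[i] :: recs.drop (i + 1) := (List.cons_getElem_drop_succ ..).symm
    have hn : nameOf ((recs.drop (i + 1)).flatMap (tRec k) ++ T) = [] := by
      rcases recs.drop (i + 1) with _ | ⟨r, l⟩
      · exact hT'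
      · rfl
    obtain ⟨y, hy, hR⟩ := hs i (by omega) _ x hn h
    rw [hd, List.flatMap_cons, List.append_assoc, hy]
    exact ih (i + 1) y (by omega) hR

theorem mem_labels {a : Sym × Tag k} {ls : List Name} (h : a ∈ ls.flatMap (tLabel k)) :
    a.2 = .lab := by
  obtain ⟨p, -, hp⟩ := List.mem_flatMap.1 h
  rcases List.mem_cons.1 hp with rfl | hp
  · rfl
  · obtain ⟨b, -, rfl⟩ := List.mem_map.1 hp
    rfl

theorem mem_row {a : Sym × Tag k} {row : List Bool}
    (h : a ∈ row.map fun b => ((Sym.bit b, .row) : Sym × Tag k)) : ∃ b, a = (.bit b, .row) := by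
  obtain ⟨b, -, rfl⟩ := List.mem_map.1 h
  exact ⟨b, rfl⟩

end Scan

/-! ### Numbering the worlds and checking that the adjacency matrix is square -/

section Format

variable {k : ℕ} {n : ℕ} {T : List (Sym × Tag k)}

/-- Numbers start at 1, so `recs.length < n` is what places all of them inside the word, where
writing has an effect. -/
theorem scan_countStep (hT : ∀ a ∈ T, a.2.InFormula) (hT' : nameOf T = []) (recs : List Rec)
    (hn : recs.length < n) (c : ℕ) :
    (scan (countStep n) (recs.flatMap (tRec k) ++ T) (0, fun _ => default)).2 c =
      { (default : Cell k) with y := decide (1 ≤ c ∧ c ≤ recs.length) } := by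
  refine (scan_recs (F := countStep n)
    (fun i x => x.1 = i ∧ ∀ c, x.2 c = { (default : Cell k) with y := decide (1 ≤ c ∧ c ≤ i) })
    recs ?_ hT' ?_ ?_).2 c
  · rintro ⟨a, q⟩ ha l x
    have := hT _ ha
    simp only [countStep]
    split
    · next h => subst h; exact this.elim
    · rfl
  · refine ⟨rfl, fun c => ?_⟩
    rw [decide_eq_false (by omega)]
    rfl
  · rintro i hi l x - ⟨h₁, h₂⟩
    refine ⟨(x.1 + 1, wr n x.2 (x.1 + 1) fun u => { u with y := true }), ?_, by rw [h₁], ?_⟩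
    · rw [tRec, List.cons_append, List.cons_append, scan, scan, List.append_assoc,
        scan_append_of_id, scan_append_of_id]
      · simp [countStep]
      · intro a ha l x
        simp [countStep, mem_labels ha]
      · intro a ha l x
        obtain ⟨b, rfl⟩ := mem_row ha
        simp [countStep]
    · intro c
      simp only [wr, h₁, if_pos (show i + 1 < n by omega)]
      rcases eq_or_ne c (i + 1) with rfl | hc
      · simp [h₂]
      · rw [Function.update_of_ne hc, h₂,
          decide_eq_decide.2 (show (1 ≤ c ∧ c ≤ i) ↔ (1 ≤ c ∧ c ≤ i + 1) by omega)]

/-- After `j` entries the column pointer is `j + 1`; `ok` accumulates `j ≤ N` and `full` is `N ≤ j`,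
both read off from the marks left by the counting pass. Together they say that the row has length
`N`. -/
theorem scan_checkStep_row {m : ℕ → Cell k} {N : ℕ} (hN : N < n)
    (hm : ∀ c, (m c).y = decide (1 ≤ c ∧ c ≤ N)) (l : List (Sym × Tag k)) (ok : Bool)
    (row : List Bool) : ∀ j,
    scan (checkStep n m) ((row.map fun b => (Sym.bit b, Tag.row)) ++ l)
      (j + 1, ok && decide (j ≤ N), decide (N ≤ j)) =
    scan (checkStep n m) l
      (j + row.length + 1, ok && decide (j + row.length ≤ N), decide (N ≤ j + row.length)) := by
  induction row with
  | nil => intro j; rfl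
  | cons b row ih =>
    intro j
    have h : checkStep n m (Sym.bit b, Tag.row)
        ((row.map fun b => (Sym.bit b, Tag.row)) ++ l)
        (j + 1, ok && decide (j ≤ N), decide (N ≤ j)) =
        (j + 1 + 1, ok && decide (j + 1 ≤ N), decide (N ≤ j + 1)) := by
      simp only [checkStep, hm, if_neg (show ¬ Tag.row = (Tag.world : Tag k) by simp), if_true,
        Prod.mk.injEq, true_and]
      constructor
      · rw [Bool.and_assoc]
        congr 1
        rw [Bool.eq_iff_iff]
        simp
        omega
      · rw [Bool.eq_iff_iff]
        simp
        omega
    rw [List.map_cons, List.cons_append, scan, h, ih (j + 1), List.length_cons,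
      show j + 1 + row.length = j + (row.length + 1) by omega]

/-- The bit `full` of a record is merged into `ok` only when the next record begins. The conjunction
of both bits is therefore the right invariant, and it covers the last record. -/
theorem scan_checkStep (hT : ∀ a ∈ T, a.2.InFormula) (hT' : nameOf T = []) (recs : List Rec)
    (hr : recs ≠ []) (hn : recs.length < n) {m : ℕ → Cell k}
    (hm : ∀ c, (m c).y = decide (1 ≤ c ∧ c ≤ recs.length)) :
    ((scan (checkStep n m) (recs.flatMap (tRec k) ++ T) (0, true, true)).2.1 &&
      (scan (checkStep n m) (recs.flatMap (tRec k) ++ T) (0, true, true)).2.2) = true ↔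
      ∀ r ∈ recs, r.2.1.length = recs.length := by
  have hpos : 0 < recs.length := List.length_pos_iff.2 hr
  have := scan_recs (F := checkStep n m)
    (fun i x => (x.2.1 && x.2.2) = true ↔ ∀ j (h : j < recs.length), j < i →
      recs[j].2.1.length = recs.length)
    recs (T := T) (x := (0, true, true)) ?_ hT' ?_ ?_
  · rw [this, List.forall_mem_iff_forall_getElem]
    exact forall₂_congr fun j h => by simp [h]
  · rintro ⟨a, q⟩ ha l x
    have := hT _ ha
    simp only [checkStep]
    split
    · next h => subst h; exact this.elim
    · split
      · next h => subst h; exact this.elim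
      · rfl
  · simp
  · rintro i hi l x - h
    refine ⟨(0 + recs[i].2.1.length + 1, (x.2.1 && x.2.2) &&
      decide (0 + recs[i].2.1.length ≤ recs.length),
      decide (recs.length ≤ 0 + recs[i].2.1.length)), ?_, ?_⟩
    · rw [tRec, List.cons_append, List.cons_append, scan, scan, List.append_assoc]
      have e : ∀ a l', checkStep n m (Sym.bit a, Tag.team) l'
          (checkStep n m (Sym.world, Tag.world) ((Sym.bit a, Tag.team) :: l') x) =
          (0 + 1, (x.2.1 && x.2.2) && decide (0 ≤ recs.length), decide (recs.length ≤ 0)) := by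
        intro a l'
        simp [checkStep, List.length_pos_iff.1 hpos]
      rw [e, scan_checkStep_row hn hm, scan_append_of_id]
      intro a ha l x
      simp [checkStep, mem_labels ha]
    · rw [Bool.and_assoc, Bool.and_eq_true, h]
      constructor
      · rintro ⟨h₁, h₂⟩ j hj hji
        rcases Nat.lt_succ_iff_lt_or_eq.1 hji with hji | rfl
        · exact h₁ j hj hji
        · simp at h₂
          omega
      · intro h'
        refine ⟨fun j hj hji => h' j hj (by omega), ?_⟩
        simp [h' i hi (by omega)]

end Format

/-! ### Marking the worlds labeled with the propositions of the atom -/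

section Labels

variable {k : ℕ} {n : ℕ} {T : List (Sym × Tag k)}

theorem scan_labelStep_bits (p : Name) (t : Option (Fin k)) (l : List (Sym × Tag k))
    (q : Name) (x : ℕ × (ℕ → Cell k)) :
    scan (labelStep n p t) ((q.map fun b => (Sym.bit b, Tag.lab)) ++ l) x =
      scan (labelStep n p t) l x := by
  refine scan_append_of_id (fun a ha l x => ?_) _ _
  obtain ⟨b, -, rfl⟩ := List.mem_map.1 ha
  simp [labelStep]

/-- The hypothesis `hl` keeps the last label from swallowing bits of what follows. -/
theorem scan_labelStep_labels (p : Name) (t : Option (Fin k)) {l : List (Sym × Tag k)}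
    (hl : nameOf l = []) {s : ℕ} (hs : s < n) (ls : List Name) : ∀ m : ℕ → Cell k,
    ∃ m', scan (labelStep n p t) (ls.flatMap (tLabel k) ++ l) (s, m) =
        scan (labelStep n p t) l (s, m') ∧
      ∀ c u, (m' c).m u = ((m c).m u || decide (c = s ∧ t = u ∧ p ∈ ls)) := by
  induction ls with
  | nil => exact fun m => ⟨m, rfl, by simp⟩
  | cons q ls ih =>
    intro m
    have hq : nameOf ((q.map fun b => (Sym.bit b, Tag.lab)) ++
        (ls.flatMap (tLabel k) ++ l)) = q := by
      refine nameOf_bits _ _ _ ?_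
      cases ls
      · exact hl
      · rfl
    rw [List.flatMap_cons, tLabel, List.cons_append, List.cons_append, List.append_assoc, scan,
      scan_labelStep_bits]
    by_cases hp : q = p
    · subst hp
      obtain ⟨m', h₁, h₂⟩ := ih
        (wr n m s fun x => { x with m := fun u => x.m u || decide (t = u) })
      refine ⟨m', by simpa [labelStep, hq] using h₁, fun c u => ?_⟩
      rw [h₂, wr, if_pos hs]
      rcases eq_or_ne c s with rfl | hc
      · by_cases ht : t = u <;> simp [ht]
      · simp [hc]
    · obtain ⟨m', h₁, h₂⟩ := ih m
      refine ⟨m', by simpa [labelStep, hq, hp] using h₁, fun c u => ?_⟩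
      rw [h₂]
      simp [Ne.symm hp]

theorem scan_labelStep (hT : ∀ a ∈ T, a.2.InFormula) (hT' : nameOf T = []) (recs : List Rec)
    (hn : recs.length < n) (p : Name) (t : Option (Fin k)) (m : ℕ → Cell k) (i : ℕ)
    (hi : i < recs.length) (u : Option (Fin k)) :
    ((scan (labelStep n p t) (recs.flatMap (tRec k) ++ T) (0, m)).2 (i + 1)).m u =
      ((m (i + 1)).m u || decide (t = u ∧ p ∈ recs[i].2.2)) := by
  have := (scan_recs (F := labelStep n p t) (fun j x => x.1 = j ∧
    ∀ i (hi : i < recs.length) u, (x.2 (i + 1)).m u = ((m (i + 1)).m u ||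
      decide (i < j ∧ t = u ∧ p ∈ recs[i].2.2))) recs (T := T) (x := (0, m)) ?_ hT' ?_ ?_).2 i hi u
  · rw [this]
    simp [hi]
  · rintro ⟨a, q⟩ ha l x
    have := hT _ ha
    simp only [labelStep]
    split
    · next h => subst h; exact this.elim
    · split
      · next h => obtain ⟨⟨-, rfl⟩, -⟩ := h; exact this.elim
      · rfl
  · simp
  · rintro j hj l x hl ⟨h₁, h₂⟩
    obtain ⟨m', h₃, h₄⟩ := scan_labelStep_labels (n := n) p t hl (s := j + 1) (by omega)
      recs[j].2.2 x.2
    refine ⟨(j + 1, m'), ?_, rfl, fun i hi u => ?_⟩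
    · rw [tRec, List.cons_append, List.cons_append, scan, scan, List.append_assoc,
        scan_append_of_id, ← h₃]
      · simp [labelStep, h₁]
      · intro a ha l x
        obtain ⟨b, rfl⟩ := mem_row ha
        simp [labelStep]
    · rw [h₄, h₂ i hi, Bool.or_assoc]
      congr 1
      rcases eq_or_ne i j with rfl | hij
      · simp
      · have : i < j + 1 ↔ i < j := by omega
        simp [hij, this]

/-- Letters of the records carry no name index, so only the names occurring in `T` cause a marking
pass. -/
theorem scan_nameStep (hT : ∀ a ∈ T, a.2.InFormula) (hT' : nameOf T = []) (recs : List Rec)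
    (hn : recs.length < (recs.flatMap (tRec k) ++ T).length) (m : ℕ → Cell k) (i : ℕ)
    (hi : i < recs.length) (u : Option (Fin k)) :
    (scan (nameStep (recs.flatMap (tRec k) ++ T)) (recs.flatMap (tRec k) ++ T) m (i + 1)).m u =
      true ↔ (m (i + 1)).m u = true ∨ ∃ p, (u, p) ∈ names T ∧ p ∈ recs[i].2.2 := by
  -- The outer fold is generalized to an arbitrary list while the word swept by the inner fold stays
  -- fixed.
  have key : ∀ (l : List (Sym × Tag k)) m,
      (scan (nameStep (recs.flatMap (tRec k) ++ T)) l m (i + 1)).m u = true ↔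
        (m (i + 1)).m u = true ∨ ∃ p, (u, p) ∈ names l ∧ p ∈ recs[i].2.2 := by
    intro l
    induction l with
    | nil => simp [scan, names]
    | cons a l ih =>
      intro m
      rw [scan, ih]
      rcases ha : nameIdx a with _ | t
      · simp [nameStep, ha, names]
      · simp only [nameStep, ha, scan_labelStep hT hT' recs hn _ _ _ i hi, names, Option.map_some,
          Option.toList_some, List.cons_append, List.nil_append, List.mem_cons, Prod.mk.injEq,
          Bool.or_eq_true, decide_eq_true_eq, or_assoc, eq_comm (a := t), or_and_right, exists_or,
          and_assoc, exists_and_left, exists_eq_left]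
  rw [scan_append_of_id, key]
  intro a ha l m
  have : nameIdx a = none := by
    obtain ⟨r, -, ha⟩ := List.mem_flatMap.1 ha
    simp only [tRec, List.mem_cons, List.mem_append] at ha
    rcases ha with rfl | rfl | ha | ha
    · rfl
    · rfl
    · obtain ⟨b, rfl⟩ := mem_row ha
      rfl
    · have := mem_labels ha
      rcases a with ⟨a, q⟩
      simp only at this
      subst this
      cases a <;> rfl
  simp [nameStep, this]

end Labels

/-! ### Denotations of modal formulae and the test of the team -/

section Modal

variable {k : ℕ} {n : ℕ} {T : List (Sym × Tag k)}

/-- The record of a world of an instance. -/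
def Instance.record (I : Instance) (s : Fin (I.n + 1)) : Rec :=
  (I.inTeam s, List.ofFn (I.adj s), I.labels s)

/-- The records of an instance. -/
def Instance.recs (I : Instance) : List Rec := (List.finRange (I.n + 1)).map I.record

theorem Instance.length_recs (I : Instance) : I.recs.length = I.n + 1 := by simp [recs]

theorem Instance.getElem_recs (I : Instance) (s : Fin (I.n + 1)) :
    I.recs[s.1]'(by rw [I.length_recs]; exact s.2) = I.record s := by simp [recs]

theorem Instance.encode_eq (I : Instance) : I.encode = encRaw I.recs I.formula := by
  simp only [encode, encRaw, recs, List.flatMap_map]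
  rfl

/-- Rule for folding over a tagged instance world by world. -/
theorem scan_instance {τ : Type} {F : Sym × Tag k → List (Sym × Tag k) → τ → τ}
    (R : ℕ → τ → Prop) (I : Instance) (hT : ∀ a ∈ T, ∀ l x, F a l x = x)
    (hT' : nameOf T = []) {x : τ} (h₀ : R 0 x)
    (hs : ∀ (s : Fin (I.n + 1)) (l : List (Sym × Tag k)) x, R s x →
      ∃ y, scan F (tRec k (I.record s) ++ l) x = scan F l y ∧ R (s + 1) y) :
    R (I.n + 1) (scan F (I.recs.flatMap (tRec k) ++ T) x) := by
  have := scan_recs R I.recs hT hT' h₀ fun i h l x _ hR => by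
    rw [I.length_recs] at h
    have := hs ⟨i, h⟩ l x hR
    rwa [← I.getElem_recs] at this
  rwa [I.length_recs] at this

/-- The truth of a modal formula, given the truth of its argument in all worlds of the range `U`
related to the given one. -/
def Holds (o : Bool) {U : Type*} (r x : U → Prop) : Prop :=
  if o then ∀ u, r u → x u else ∃ u, r u ∧ x u

/-- The row only changes the component `y` of the cell of its own world, whereas the tests read the
components `x`; so all tests refer to the original memory. -/
theorem scan_modalStep_row (o : Bool) {s : ℕ} (hs : s < n) (l : List (Sym × Tag k))
    (row : List Bool) : ∀ j (m : ℕ → Cell k), j + row.length < n →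
    ∃ m', scan (modalStep n o) ((row.map fun b => (Sym.bit b, Tag.row)) ++ l) (s, j, m) =
        scan (modalStep n o) l (s, j + row.length, m') ∧
      (∀ c, (m' c).x = (m c).x ∧ (m' c).m = (m c).m) ∧ (∀ c, c ≠ s → m' c = m c) ∧
      ((m' s).y = true ↔ if o then (m s).y = true ∧
          ∀ i (h : i < row.length), row[i] = true → (m (j + 1 + i)).x = true
        else (m s).y = true ∨
          ∃ i, ∃ h : i < row.length, row[i] = true ∧ (m (j + 1 + i)).x = true) := by
  induction row with
  | nil =>
    intro j m _
    exact ⟨m, rfl, by simp, by simp, by cases o <;> simp⟩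
  | cons b row ih =>
    intro j m hj
    rw [List.length_cons] at hj
    obtain ⟨m', h₁, h₂, h₃, h₄⟩ := ih (j + 1)
      (wr n m s fun u => { u with y := comb o b (m (j + 1)).x u.y }) (by omega)
    have hx : ∀ c, ((wr n m s fun u => { u with y := comb o b (m (j + 1)).x u.y }) c).x =
        (m c).x ∧ ((wr n m s fun u => { u with y := comb o b (m (j + 1)).x u.y }) c).m =
        (m c).m := by
      intro c
      rw [wr, if_pos hs]
      rcases eq_or_ne c s with rfl | hc
      · simp
      · simp [hc]
    refine ⟨m', ?_, fun c => ?_, fun c hc => ?_, ?_⟩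
    · rw [List.map_cons, List.cons_append, scan]
      have : modalStep n o ((Sym.bit b, Tag.row) : Sym × Tag k)
          ((row.map fun b => (Sym.bit b, Tag.row)) ++ l) (s, j, m) =
          (s, j + 1, wr n m s fun u => { u with y := comb o b (m (j + 1)).x u.y }) := by
        simp [modalStep, bitOf, show j + 1 < n by omega]
      rw [this, h₁, List.length_cons, show j + 1 + row.length = j + (row.length + 1) by omega]
    · rw [(h₂ c).1, (h₂ c).2]
      exact hx c
    · rw [h₃ c hc, wr, if_pos hs, Function.update_of_ne hc]
    · rw [h₄]
      simp only [hx]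
      simp only [wr, if_pos hs, Function.update_self]
      cases o
      · simp only [comb, Bool.false_eq_true, if_false, Bool.or_eq_true, Bool.and_eq_true, or_assoc]
        refine or_congr_right ⟨?_, ?_⟩
        · rintro (h | ⟨i, hi, h⟩)
          · exact ⟨0, by simp, h⟩
          · exact ⟨i + 1, by simpa using hi, by
              simpa [show j + 1 + (i + 1) = j + 1 + 1 + i by omega] using h⟩
        · rintro ⟨i, hi, h⟩
          rcases i with _ | i
          · exact .inl h
          · exact .inr ⟨i, by simpa using hi, by
              simpa [show j + 1 + (i + 1) = j + 1 + 1 + i by omega] using h⟩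
      · simp only [comb, if_true, Bool.or_eq_true, Bool.and_eq_true, and_assoc]
        refine and_congr_right fun _ => ⟨?_, ?_⟩
        · rintro ⟨h, h'⟩ i hi hr
          rcases i with _ | i
          · simp only [List.getElem_cons_zero] at hr
            simpa [hr] using h
          · simpa [show j + 1 + (i + 1) = j + 1 + 1 + i by omega] using
              h' i (by simpa using hi) (by simpa using hr)
        · intro h
          refine ⟨?_, fun i hi hr => ?_⟩
          · cases b
            · simp
            · simpa using h 0 (by simp) rfl
          · simpa [show j + 1 + (i + 1) = j + 1 + 1 + i by omega] using
              h (i + 1) (by simpa using hi) (by simpa using hr)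

/-- The new denotation is built in `y` while `x` still holds the old one, and is copied only after
all worlds have been treated. The components `m` must be shown to survive, since they are used again
for the next choice of `f`. -/
theorem modal_spec (hT : ∀ a ∈ T, a.2.InFormula) (hT' : nameOf T = []) (I : Instance) (o : Bool)
    (hn : I.n + 1 < (I.recs.flatMap (tRec k) ++ T).length) (m : ℕ → Cell k) (s : Fin (I.n + 1)) :
    ((modal (I.recs.flatMap (tRec k) ++ T) o m (s + 1)).x = true ↔
      Holds o (fun u => I.adj s u = true) fun u => (m (u + 1)).x = true) ∧
    (modal (I.recs.flatMap (tRec k) ++ T) o m (s + 1)).m = (m (s + 1)).m := by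
  generalize hN : (I.recs.flatMap (tRec k) ++ T).length = n at hn
  have := (scan_instance (F := modalStep n o)
    (fun j x => x.1 = j ∧ (∀ c, (x.2.2 c).x = (m c).x ∧ (x.2.2 c).m = (m c).m) ∧
      ∀ s : Fin (I.n + 1), s.1 < j → ((x.2.2 (s + 1)).y = true ↔
        Holds o (fun u => I.adj s u = true) fun u => (m (u + 1)).x = true))
    I (T := T) (x := (0, 0, m)) ?_ hT' ?_ ?_).2
  · have h₁ := this.1 (s + 1)
    have h₂ := this.2 s s.2
    have hs : s.1 + 1 < n := by omega
    simp only [modal, hN, hs, if_true]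
    exact ⟨h₂, h₁.2⟩
  · rintro ⟨a, q⟩ ha l x
    have := hT _ ha
    simp only [modalStep]
    split
    · next h => subst h; exact this.elim
    · split
      · next h => subst h; exact this.elim
      · rfl
  · simp
  · rintro s l x ⟨h₁, h₂, h₃⟩
    have hs : s.1 + 1 < n := by omega
    have hx : ∀ c, ((wr n x.2.2 (s + 1) fun u => { u with y := o }) c).x = (x.2.2 c).x ∧
        ((wr n x.2.2 (s + 1) fun u => { u with y := o }) c).m = (x.2.2 c).m := by
      intro c
      rw [wr, if_pos hs]
      rcases eq_or_ne c (s + 1) with rfl | hc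
      · simp
      · simp [hc]
    obtain ⟨m', g₁, g₂, g₃, g₄⟩ := scan_modalStep_row o hs
      ((I.labels s).flatMap (tLabel k) ++ l) (List.ofFn (I.adj s)) 0
      (wr n x.2.2 (s + 1) fun u => { u with y := o }) (by simpa using hn)
    refine ⟨(s + 1, 0 + (List.ofFn (I.adj s)).length, m'), ?_, rfl, fun c => ?_, fun u hu => ?_⟩
    · rw [tRec, List.cons_append, List.cons_append, scan, scan, List.append_assoc]
      have e : ∀ a l', modalStep n o ((Sym.bit a, Tag.team) : Sym × Tag k) l'
          (modalStep n o (Sym.world, Tag.world) ((Sym.bit a, Tag.team) :: l') x) =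
          (s.1 + 1, 0, wr n x.2.2 (s + 1) fun u => { u with y := o }) := by
        intro a l'
        simp [modalStep, h₁]
      rw [e]
      refine g₁.trans (scan_append_of_id ?_ _ _)
      intro a ha l x
      simp [modalStep, mem_labels ha]
    · rw [(g₂ c).1, (g₂ c).2, (hx c).1, (hx c).2]
      exact h₂ c
    · by_cases hus : u = s
      · subst hus
        simp only at g₄ ⊢
        rw [g₄]
        simp only [hx, h₂]
        simp only [wr, if_pos hs, Function.update_self, Holds]
        cases o
        · simp only [Bool.false_eq_true, if_false, false_or, List.getElem_ofFn]
          constructor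
          · rintro ⟨i, hi, h⟩
            rw [List.length_ofFn] at hi
            exact ⟨⟨i, hi⟩, h.1, by simpa [add_comm] using h.2⟩
          · rintro ⟨i, h⟩
            exact ⟨i, by simp; omega, h.1, by simpa [add_comm] using h.2⟩
        · simp only [if_true, true_and, List.getElem_ofFn]
          constructor
          · intro h i hi
            simpa [add_comm] using h i (by simp; omega) hi
          · intro h i hi hr
            rw [List.length_ofFn] at hi
            simpa [add_comm] using h ⟨i, hi⟩ hr
      · have hne : u.1 ≠ s.1 := fun h => hus (Fin.ext h)
        have : (u : ℕ) + 1 ≠ s + 1 := by omega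
        simp only
        rw [g₃ _ this, wr, if_pos hs, Function.update_of_ne this]
        exact h₃ u (by omega)

theorem scan_teamStep (hT : ∀ a ∈ T, a.2.InFormula) (hT' : nameOf T = []) (I : Instance)
    (hn : I.n + 1 < n) (m : ℕ → Cell k) :
    (scan (teamStep n m) (I.recs.flatMap (tRec k) ++ T) (0, true)).2 = true ↔
      ∀ s, I.inTeam s = true → (m (s.1 + 1)).x = true := by
  have := (scan_instance (F := teamStep n m)
    (fun j x => x.1 = j ∧ (x.2 = true ↔ ∀ s : Fin (I.n + 1), s.1 < j → I.inTeam s = true →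
      (m (s.1 + 1)).x = true)) I (T := T) (x := (0, true)) ?_ hT' ?_ ?_).2
  · rw [this]
    exact forall_congr' fun s => by simp [s.2]
  · rintro ⟨a, q⟩ ha l x
    have := hT _ ha
    simp only [teamStep]
    split
    · next h => subst h; exact this.elim
    · split
      · next h => cases h; exact this.elim
      · rfl
  · simp
  · rintro s l x ⟨h₁, h₂⟩
    have hs : s.1 + 1 < n := by omega
    refine ⟨(s.1 + 1, x.2 && (!I.inTeam s || (m (s.1 + 1)).x)), ?_, rfl, ?_⟩
    · rw [tRec, List.cons_append, List.cons_append, scan, scan, List.append_assoc,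
        scan_append_of_id, scan_append_of_id]
      · rcases ht : I.inTeam s <;> simp [teamStep, Instance.record, h₁, ht, hs]
      · intro a ha l x
        have := mem_labels ha
        rcases a with ⟨a, q⟩
        simp only at this
        simp [teamStep, this]
      · intro a ha l x
        obtain ⟨b, rfl⟩ := mem_row ha
        simp [teamStep]
    · rw [Bool.and_eq_true, h₂]
      constructor
      · rintro ⟨h, h'⟩ u hu ht
        rcases Nat.lt_succ_iff_lt_or_eq.1 hu with hu | hu
        · exact h u hu ht
        · obtain rfl : u = s := Fin.ext hu
          simpa [ht] using h'
      · intro h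
        refine ⟨fun u hu => h u (by omega), ?_⟩
        rcases ht : I.inTeam s
        · rfl
        · simpa using h s (by omega) ht

end Modal

/-! ### Flat semantics -/

section Flat

variable {AP S : Type*} {k : ℕ}

open Classical in
/-- The truth value of a proposition. -/
noncomputable def truth (P : Prop) : Bool := decide P

theorem truth_iff {P : Prop} : truth P = true ↔ P := by simp [truth]

/-- The worlds satisfying a formula if its dependence atom is read as the requirement that the last
proposition has the value `f` of the others. -/
noncomputable def den (k : ℕ) (f : (Fin k → Bool) → Bool) (W : Kripke AP S) :
    Formula AP → Set S
  | .prop q => {s | q ∈ W.π s}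
  | .negProp q => {s | q ∉ W.π s}
  | .dep ps q => {s | q ∈ W.π s ↔
      f (fun r => truth (∃ p, ps[r.1]? = some p ∧ p ∈ W.π s)) = true}
  | .ax φ => {s | ∀ u, W.R s u → u ∈ den k f W φ}
  | .ex φ => {s | ∃ u, W.R s u ∧ u ∈ den k f W φ}
  | _ => ∅

/-- The heart of the proof. The induction works because every operator of the fragment is unary: a
single `f` serves the one atom, and the existential quantifier over `f` passes through each
modality. -/
theorem sat_iff_den {M : Set Op} (hM : M ⊆ {Op.ax, Op.ex, Op.neg, Op.dep}) (W : Kripke AP S)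
    {φ : Formula AP} (hφ : φ ∈ boundedFragment AP k M) (T : Set S) :
    Sat W T φ ↔ ∃ f, T ⊆ den k f W φ := by
  induction φ generalizing T with
  | top => simpa using hM hφ.2
  | bot => simpa using hM hφ.2
  | or φ ψ => simpa using hM hφ.2.1
  | cor φ ψ => simpa using hM hφ.2.1
  | and φ ψ => simpa using hM hφ.2.1
  -- The denotation of a literal does not involve `f`, so any function is a witness.
  | prop q => exact ⟨fun h => ⟨fun _ => false, h⟩, fun ⟨_, h⟩ => h⟩
  | negProp q => exact ⟨fun h => ⟨fun _ => false, h⟩, fun ⟨_, h⟩ => h⟩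
  | negDep ps q => simp [Sat, den, Set.subset_empty_iff]
  | ax φ ih =>
    rw [Sat, ih ⟨hφ.1, hφ.2.2⟩]
    refine exists_congr fun f => ⟨fun h s hs u hu => h ⟨s, hs, hu⟩, ?_⟩
    rintro h u ⟨s, hs, hu⟩
    exact h hs u hu
  | ex φ ih =>
    have ih := ih ⟨hφ.1, hφ.2.2⟩
    simp only [Sat, ih]
    constructor
    · rintro ⟨U, ⟨f, hf⟩, h⟩
      refine ⟨f, fun s hs => ?_⟩
      obtain ⟨u, hu, hR⟩ := h s hs
      exact ⟨u, hR, hf hu⟩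
    · rintro ⟨f, hf⟩
      -- The whole denotation is the largest admissible successor team for this `f`.
      refine ⟨den k f W φ, ⟨f, subset_rfl⟩, fun s hs => ?_⟩
      obtain ⟨u, hR, hu⟩ := hf hs
      exact ⟨u, hu, hR⟩
  | dep ps q =>
    -- Positions beyond the end of `ps` count as false, so atoms of smaller arity also use functions
    -- of `k` arguments.
    let vec : S → Fin k → Bool := fun s r => truth (∃ p, ps[r.1]? = some p ∧ p ∈ W.π s)
    have hvec : ∀ s u, vec s = vec u ↔ W.π s ∩ {p | p ∈ ps} = W.π u ∩ {p | p ∈ ps} := by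
      intro s u
      constructor
      · intro h
        ext p
        refine and_congr_left fun hp => ?_
        obtain ⟨i, hi, rfl⟩ := List.getElem_of_mem hp
        -- The arity bound makes every position of `ps` one of the `k` arguments.
        have := Bool.eq_iff_iff.1 (congrFun h ⟨i, hi.trans_le hφ.1⟩)
        rw [truth_iff, truth_iff] at this
        simpa [hi] using this
      · intro h
        funext r
        rw [Bool.eq_iff_iff, truth_iff, truth_iff]
        refine exists_congr fun p => and_congr_right fun hp => ?_
        have hp : p ∈ ps := List.mem_of_getElem? hp
        have : p ∈ W.π s ∩ {p | p ∈ ps} ↔ p ∈ W.π u ∩ {p | p ∈ ps} := by rw [h]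
        simpa [hp] using this
    have hq : ∀ s u, W.π s ∩ {q} = W.π u ∩ {q} ↔ (q ∈ W.π s ↔ q ∈ W.π u) := by
      intro s u
      constructor
      · intro h
        have : q ∈ W.π s ∩ {q} ↔ q ∈ W.π u ∩ {q} := by rw [h]
        simpa using this
      · intro h
        ext p
        refine and_congr_left fun hp => ?_
        rw [Set.mem_singleton_iff.1 hp]
        exact h
    have hd : ∀ f, den k f W (.dep ps q) = {s | q ∈ W.π s ↔ f (vec s) = true} := fun f => rfl
    simp only [Sat, hd, ← hvec, hq, ← imp_iff_not_or]
    constructor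
    · intro h
      -- The function is read off from the team: `v` is sent to true iff some world of the team with
      -- argument values `v` satisfies `q`. Dependence makes this independent of the world.
      refine ⟨fun v => truth (∃ s ∈ T, vec s = v ∧ q ∈ W.π s), fun s hs => ?_⟩
      simp only [Set.mem_ofPred_eq, truth_iff]
      constructor
      · exact fun hq => ⟨s, hs, rfl, hq⟩
      · rintro ⟨u, hu, hv, hq⟩
        exact (h u hu s hs hv).1 hq
    · rintro ⟨f, hf⟩ s hs u hu hv
      have h₁ : q ∈ W.π s ↔ f (vec s) = true := hf hs
      have h₂ : q ∈ W.π u ↔ f (vec u) = true := hf hu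
      rw [h₁, h₂, hv]

end Flat

/-! ### Correctness of the program -/

section Correct

variable {k : ℕ} {M : Set Op}

theorem foldr_opStep_of_ne (w : List (Sym × Tag k)) {u : List (Sym × Tag k)}
    (hu : ∀ a ∈ u.map Prod.fst, a ≠ .ax ∧ a ≠ .ex) (m : ℕ → Cell k) :
    u.foldr (opStep w) m = m := by
  induction u with
  | nil => rfl
  | cons a u ih =>
    rw [List.foldr_cons, ih fun b hb => hu b (by simp [hb])]
    have := hu a.1 (by simp)
    simp [opStep, this]

theorem mem_encName {p : Name} {a : Sym} (h : a ∈ encName p) : a ≠ .ax ∧ a ≠ .ex := by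
  rcases List.mem_cons.1 h with rfl | h
  · simp
  · obtain ⟨b, -, rfl⟩ := List.mem_map.1 h
    simp

theorem mem_encNames {ps : List Name} {a : Sym} (h : a ∈ ps.flatMap encName) :
    a ≠ .ax ∧ a ≠ .ex := by
  obtain ⟨p, -, hp⟩ := List.mem_flatMap.1 h
  exact mem_encName hp

theorem mem_encRec {r : Rec} {a : Sym} (h : a ∈ encRec r) : a ≠ .ax ∧ a ≠ .ex := by
  simp only [encRec, List.mem_cons, List.mem_append, List.mem_map] at h
  rcases h with rfl | rfl | ⟨b, -, rfl⟩ | h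
  · simp
  · simp
  · simp
  · exact mem_encNames h

/-- The tagged string of an instance. -/
noncomputable def Instance.tagged (k : ℕ) (M : Set Op) (I : Instance) : List (Sym × Tag k) :=
  tag (next k M) .init I.encode

theorem Instance.recs_ne_nil (I : Instance) : I.recs ≠ [] := by
  rw [← List.length_pos_iff, I.length_recs]
  omega

theorem Instance.tagged_eq (I : Instance) : I.tagged k M = I.recs.flatMap (tRec k) ++
    (.sep, .form) :: tag (next k M) .form (encFormula I.formula) := by
  rw [tagged, encode_eq]
  exact (tag_encRaw I.recs I.recs_ne_nil I.formula).1

theorem tail_inFormula (φ : Formula Name) :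
    ∀ a ∈ ((.sep, .form) :: tag (next k M) .form (encFormula φ) : List (Sym × Tag k)),
      a.2.InFormula := by
  intro a ha
  rcases List.mem_cons.1 ha with rfl | ha
  · trivial
  · exact inFormula_tag _ (x := .form) trivial a ha

/-- Every record contributes at least one letter, and the non-empty `T` makes the inequality strict,
so the cells with numbers `1, …, recs.length` exist. -/
theorem length_recs_lt (recs : List Rec) (T : List (Sym × Tag k)) (hT : T ≠ []) :
    recs.length < (recs.flatMap (tRec k) ++ T).length := by
  have : recs.length ≤ (recs.flatMap (tRec k)).length := by
    induction recs with
    | nil => simp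
    | cons r recs ih =>
      simp only [List.flatMap_cons, List.length_append, List.length_cons, tRec]
      omega
  have := List.length_pos_iff.2 hT
  rw [List.length_append]
  omega

theorem modal_tagged (I : Instance) (o : Bool) (m : ℕ → Cell k) (s : Fin (I.n + 1)) :
    ((modal (I.tagged k M) o m (s + 1)).x = true ↔
      Holds o (fun u => I.adj s u = true) fun u => (m (u + 1)).x = true) ∧
    (modal (I.tagged k M) o m (s + 1)).m = (m (s + 1)).m := by
  rw [I.tagged_eq]
  refine modal_spec (tail_inFormula I.formula) rfl I o ?_ m s
  have := length_recs_lt I.recs _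
    (List.cons_ne_nil (.sep, .form) (tag (next k M) .form (encFormula I.formula)))
  rwa [I.length_recs] at this

/-- The hypotheses on `m` concern only the atom, as `nameAt` and `kind` ignore modalities; so they
pass unchanged to the subformula. The state `x` is arbitrary because `opStep` looks at letters and
not at tags. -/
theorem foldr_encFormula (hM : M ⊆ {Op.ax, Op.ex, Op.neg, Op.dep}) (I : Instance)
    (f : (Fin k → Bool) → Bool) {φ : Formula Name} (hφ : φ ∈ boundedFragment Name k M)
    {m : ℕ → Cell k}
    (hm : ∀ (s : Fin (I.n + 1)) i, (m (s + 1)).m i = true ↔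
      ∃ p, φ.nameAt k i = some p ∧ p ∈ I.labels s)
    (hx : ∀ s : Fin (I.n + 1), (m (s + 1)).x = atomVal f (φ.kind k) (m (s + 1)).m)
    (x : Tag k) (s : Fin (I.n + 1)) :
    (((tag (next k M) x (encFormula φ)).foldr (opStep (I.tagged k M)) m (s + 1)).x = true ↔
      s ∈ den k f I.kripke φ) ∧
    ((tag (next k M) x (encFormula φ)).foldr (opStep (I.tagged k M)) m (s + 1)).m =
      (m (s + 1)).m := by
  induction φ generalizing x s with
  | top => simpa using hM hφ.2
  | bot => simpa using hM hφ.2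
  | or φ ψ => simpa using hM hφ.2.1
  | cor φ ψ => simpa using hM hφ.2.1
  | and φ ψ => simpa using hM hφ.2.1
  | prop q =>
    rw [foldr_opStep_of_ne]
    · refine ⟨?_, rfl⟩
      rw [hx]
      simp [atomVal, Formula.kind, hm, Formula.nameAt, den, Instance.kripke]
    · rw [map_fst_tag]
      exact fun a ha => mem_encName ha
  | negProp q =>
    rw [foldr_opStep_of_ne]
    · refine ⟨?_, rfl⟩
      rw [hx]
      simp [atomVal, Formula.kind, ← Bool.not_eq_true, hm, Formula.nameAt, den, Instance.kripke]
    · rw [map_fst_tag]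
      intro a ha
      rcases List.mem_cons.1 ha with rfl | ha
      · simp
      · exact mem_encName ha
  | dep ps q =>
    rw [foldr_opStep_of_ne]
    · refine ⟨?_, rfl⟩
      rw [hx]
      have hv : (fun r : Fin k => (m (s + 1)).m (some r)) = fun r =>
          truth (∃ p, ps[r.1]? = some p ∧ p ∈ I.kripke.π s) :=
        funext fun r => Bool.eq_iff_iff.2 ((hm s _).trans truth_iff.symm)
      have hq : (m (s + 1)).m none = true ↔ q ∈ I.kripke.π s :=
        (hm s _).trans (by simp [Formula.nameAt, Instance.kripke])
      simp only [atomVal, Formula.kind, hv, beq_iff_eq]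
      rw [Bool.eq_iff_iff, hq]
      exact Iff.rfl
    · rw [map_fst_tag]
      intro a ha
      simp only [encFormula, List.mem_cons, List.mem_append] at ha
      rcases ha with rfl | ha | rfl | ha
      · simp
      · exact mem_encNames ha
      · simp
      · exact mem_encName ha
  | negDep ps q =>
    rw [foldr_opStep_of_ne]
    · refine ⟨?_, rfl⟩
      rw [hx]
      simp [atomVal, Formula.kind, den]
    · rw [map_fst_tag]
      intro a ha
      simp only [encFormula, List.mem_cons, List.mem_append] at ha
      rcases ha with rfl | rfl | ha | rfl | ha
      · simp
      · simp
      · exact mem_encNames ha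
      · simp
      · exact mem_encName ha
  | ax φ ih =>
    have ih := ih ⟨hφ.1, hφ.2.2⟩ hm hx
    simp only [encFormula, tag, List.foldr_cons, opStep, if_true]
    rw [(modal_tagged I true _ s).1, (modal_tagged I true _ s).2]
    simp only [Holds, if_true, ih]
    exact ⟨Iff.rfl, trivial⟩
  | ex φ ih =>
    have ih := ih ⟨hφ.1, hφ.2.2⟩ hm hx
    simp only [encFormula, tag, List.foldr_cons, opStep, if_true,
      if_neg (show ¬ Sym.ex = Sym.ax by simp)]
    rw [(modal_tagged I false _ s).1, (modal_tagged I false _ s).2]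
    simp only [Holds, Bool.false_eq_true, if_false, ih]
    exact ⟨Iff.rfl, trivial⟩

theorem denote_tagged (hM : M ⊆ {Op.ax, Op.ex, Op.neg, Op.dep}) (I : Instance)
    (hφ : I.formula ∈ boundedFragment Name k M) (f : (Fin k → Bool) → Bool)
    {m : ℕ → Cell k} (hm : ∀ (s : Fin (I.n + 1)) i, (m (s + 1)).m i = true ↔
      ∃ p, I.formula.nameAt k i = some p ∧ p ∈ I.labels s) (s : Fin (I.n + 1)) :
    ((denote (I.tagged k M) (I.formula.kind k) f m (s + 1)).x = true ↔
      s ∈ den k f I.kripke I.formula) ∧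
    (denote (I.tagged k M) (I.formula.kind k) f m (s + 1)).m = (m (s + 1)).m := by
  have hn : ∀ s : Fin (I.n + 1), s.1 + 1 < (I.tagged k M).length := by
    intro s
    have := length_recs_lt I.recs _
      (List.cons_ne_nil (.sep, .form) (tag (next k M) .form (encFormula I.formula)))
    rw [← I.tagged_eq, I.length_recs] at this
    omega
  have h := foldr_encFormula hM I f hφ (m := fun c => if c < (I.tagged k M).length then
    { m c with x := atomVal f (I.formula.kind k) (m c).m } else m c)
    (by simpa [hn] using hm) (by simp [hn]) .form s
  simp only [hn, if_true] at h
  -- The backward sweep runs over the whole word, but records and separator contain no modal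
  -- letters.
  have e : ∀ m, (I.tagged k M).foldr (opStep (I.tagged k M)) m =
      (tag (next k M) .form (encFormula I.formula)).foldr (opStep (I.tagged k M)) m := by
    intro m
    conv_lhs => rw [I.tagged_eq]
    rw [List.foldr_append, List.foldr_cons, ← I.tagged_eq, foldr_opStep_of_ne]
    · simp [opStep]
    · rw [List.map_flatMap]
      intro a ha
      obtain ⟨r, -, hr⟩ := List.mem_flatMap.1 ha
      have := (tag_encRec (k := k) (M := M) r (.inl rfl)).1
      rw [← this, map_fst_tag] at hr
      exact mem_encRec hr
  rw [denote, e]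
  exact h

/-- Later choices start from memory left by earlier ones. This is harmless: each choice recomputes
`x` from the label marks, and those are preserved by `denote_tagged`. -/
theorem tryAll_tagged (hM : M ⊆ {Op.ax, Op.ex, Op.neg, Op.dep}) (I : Instance)
    (hφ : I.formula ∈ boundedFragment Name k M) (fs : List ((Fin k → Bool) → Bool)) :
    ∀ {m : ℕ → Cell k}, (∀ (s : Fin (I.n + 1)) i, (m (s + 1)).m i = true ↔
      ∃ p, I.formula.nameAt k i = some p ∧ p ∈ I.labels s) →
    (tryAll (I.tagged k M) (I.formula.kind k) fs m = true ↔
      ∃ f ∈ fs, I.team ⊆ den k f I.kripke I.formula) := by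
  induction fs with
  | nil => simp [tryAll]
  | cons f fs ih =>
    intro m hm
    have h := denote_tagged hM I hφ f hm
    have hn := length_recs_lt I.recs _
      (List.cons_ne_nil (.sep, .form) (tag (next k M) .form (encFormula I.formula)))
    rw [← I.tagged_eq, I.length_recs] at hn
    rw [tryAll, Bool.or_eq_true, ih fun s i => by rw [(h s).2, hm]]
    conv_lhs =>
      enter [1, 1, 1, 2]
      rw [I.tagged_eq]
    rw [scan_teamStep (tail_inFormula I.formula) rfl I hn]
    simp only [(h _).1, List.mem_cons, exists_eq_or_imp]
    rfl

/-- Stated for arbitrary records, since it must be applied to accepted words before they are known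
to encode an instance. -/
theorem check_tagged (recs : List Rec) (hr : recs ≠ []) (φ : Formula Name) :
    let w := tag (next k M) .init (encRaw recs φ)
    let m := (scan (countStep w.length) w (0, fun _ => default)).2
    ((scan (checkStep w.length m) w (0, true, true)).2.1 &&
      (scan (checkStep w.length m) w (0, true, true)).2.2) = true ↔
      ∀ r ∈ recs, r.2.1.length = recs.length := by
  intro w m
  have hw : w = _ := (tag_encRaw (k := k) (M := M) recs hr φ).1
  have hn := length_recs_lt recs _
    (List.cons_ne_nil (.sep, .form) (tag (next k M) .form (encFormula φ)))
  rw [← hw] at hn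
  have hm : ∀ c, (m c).y = decide (1 ≤ c ∧ c ≤ recs.length) := by
    intro c
    have := scan_countStep (n := w.length) (tail_inFormula (k := k) (M := M) φ) rfl recs hn c
    rw [← hw] at this
    exact congrArg Cell.y this
  have := scan_checkStep (tail_inFormula (k := k) (M := M) φ) rfl recs hr hn hm
  rwa [← hw] at this

/-- Equal row lengths are all that separates a list of records from an instance: the rows then form
a square matrix indexed by the worlds. -/
theorem exists_instance {recs : List Rec} (hr : recs ≠ [])
    (h : ∀ r ∈ recs, r.2.1.length = recs.length) (φ : Formula Name) :
    ∃ I : Instance, I.recs = recs ∧ I.formula = φ := by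
  obtain ⟨n, hn⟩ : ∃ n, recs.length = n + 1 :=
    ⟨recs.length - 1, by have := List.length_pos_iff.2 hr; omega⟩
  have hl : ∀ s : Fin (n + 1), (recs[s.1]'(by rw [hn]; exact s.2)).2.1.length = n + 1 :=
    fun s => by rw [h _ (List.getElem_mem _), hn]
  refine ⟨⟨n, fun s u => (recs[s.1]'(by rw [hn]; exact s.2)).2.1[u.1]'(by rw [hl]; exact u.2),
    fun s => (recs[s.1]'(by rw [hn]; exact s.2)).2.2,
    fun s => (recs[s.1]'(by rw [hn]; exact s.2)).1, φ⟩, ?_, rfl⟩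
  refine List.ext_getElem (by rw [Instance.length_recs]; exact hn.symm) fun i h₁ h₂ => ?_
  have hi : i < n + 1 := by rwa [hn] at h₂
  refine (Instance.getElem_recs _ ⟨i, hi⟩).trans (Prod.ext rfl (Prod.ext ?_ rfl))
  refine List.ext_getElem (by simp [Instance.record, hl ⟨i, hi⟩]) fun j _ _ => ?_
  simp only [Instance.record, List.getElem_ofFn]

theorem out_tagged (hM : M ⊆ {Op.ax, Op.ex, Op.neg, Op.dep}) (I : Instance)
    (hφ : I.formula ∈ boundedFragment Name k M) :
    Reg.out ((mainProg (Finset.univ : Finset ((Fin k → Bool) → Bool)).toList).eval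
      (tag (next k M) .init I.encode)
      ⟨Reg.init (I.encode.foldl (next k M) .init), fun _ => 0, fun _ => default⟩).v = true ↔
      Sat I.kripke I.team I.formula := by
  obtain ⟨h₁, h₂, h₃⟩ := tag_encFormula (k := k) hM I.formula hφ
  have hq : I.encode.foldl (next k M) .init = I.formula.kind k := by
    rw [I.encode_eq, (tag_encRaw I.recs I.recs_ne_nil I.formula).2, h₁]
  have hc := (check_tagged (k := k) (M := M) I.recs I.recs_ne_nil I.formula).2 (by
    intro r hr
    obtain ⟨s, -, rfl⟩ := List.mem_map.1 hr
    simp [Instance.record, I.length_recs])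
  rw [← I.encode_eq] at hc
  have hn := length_recs_lt I.recs _
    (List.cons_ne_nil (.sep, .form) (tag (next k M) .form (encFormula I.formula)))
  rw [eval_mainProg, hc, Bool.true_and, hq, h₂, Bool.true_and]
  refine (tryAll_tagged hM I hφ _ ?_).trans ?_
  · intro s i
    have hs : s.1 < I.recs.length := by rw [I.length_recs]; exact s.2
    rw [show tag (next k M) .init I.encode = _ from I.tagged_eq,
      scan_nameStep (tail_inFormula I.formula) rfl I.recs hn _ s hs,
      scan_countStep (tail_inFormula I.formula) rfl I.recs hn, I.getElem_recs s]
    simp only [names, nameIdx, Option.map_none, Option.toList_none, List.nil_append, h₃]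
    -- No label mark is set before the names of the formula are processed.
    exact or_iff_right (by simp [default])
  · simp [sat_iff_den hM I.kripke hφ I.team]

theorem inP_modelChecking (k : ℕ) (M : Set Op) (hM : M ⊆ {Op.ax, Op.ex, Op.neg, Op.dep}) :
    InP (modelChecking k M) := by
  refine inP_of_prog (next k M) .init Reg.init
    (mainProg (Finset.univ : Finset ((Fin k → Bool) → Bool)).toList) (wf_mainProg _) Reg.out _ ?_
  intro w
  constructor
  · rintro ⟨I, rfl, hφ, h⟩
    exact (out_tagged hM I hφ).2 h
  · intro h
    -- A positive answer contains the format checks: acceptance gives records and a formula of the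
    -- fragment, the row check gives an instance, and only then can `out_tagged` be applied to the
    -- answer as a whole.
    have h' := h
    rw [eval_mainProg, Bool.and_eq_true, Bool.and_eq_true] at h'
    obtain ⟨⟨hc, hq⟩, -⟩ := h'
    obtain ⟨recs, φ, hr, hφ, rfl⟩ := acc_of_accept k M w .init hq
    obtain ⟨I, rfl, rfl⟩ := exists_instance hr
      ((check_tagged (k := k) (M := M) recs hr φ).1 hc) φ
    rw [← I.encode_eq] at h
    exact ⟨I, I.encode_eq.symm, hφ, (out_tagged hM I hφ).1 h⟩

end Correct

end MDL

theorem theorem4p6 (k : ℕ) (M : Set MDL.Op)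
    (hM : M ⊆ {MDL.Op.ax, MDL.Op.ex, MDL.Op.neg, MDL.Op.dep}) :
    MDL.InP (MDL.modelChecking k M) :=
  MDL.inP_modelChecking k M hM
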